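/- Let $m>0$, $\alpha\ge 0$, and let $\Lambda:\mathbb R^3\to\mathbb R$ satisfy $\Lambda,\ |k|^{-1/2}\Lambda\in L^2(\mathbb R^3)$. Let $e^{(1)},e^{(2)}:\mathbb R^3\to\mathbb R^3$ be measurable with $e^{(\lambda)}(k)\cdot e^{(\lambda')}(k)=\delta_{\lambda\lambda'}$ and $e^{(\lambda)}(k)\cdot k=0$. Let $\mathcal K=\Gamma_{\rm s}(L^2(\mathbb R^3\times\{1,2\}))$ be the bosonic Fock space with vacuum $\Omega$, $\mathcal H=L^2(\mathbb R^3;dx)\otimes\mathcal K$, $p=-i\nabla_x$, and $$A(x)=\frac1{\sqrt2}\sum_{\lambda=1,2}\int_{\mathbb R^3}\frac{\Lambda(k)}{|k|^{1/2}}e^{(\lambda)}(k)\bigl(e^{ik\cdot x}a_\lambda(k)+e^{-ik\cdot x}a^*_\lambda(k)\bigr)dk,$$ $$H_f=\sum_\lambda\int|k|\,a^*_\lambda(k)a_\lambda(k)\,dk,\qquad P_f=\sum_\lambda\int k\,a^*_\lambda(k)a_\lambda(k)\,dk .$$ Let $\mathcal F_{\rm fin}$ be the linear span of all $a^*(f_1)\cdots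 a^*(f_n)\Omega$, $n\ge0$, $f_j\in C_0^\infty(\mathbb R^3\times\{1,2\})$; let $\mathcal D_0=C_0^\infty(\mathbb R^3)\,\hat\otimes\,\mathcal F_{\rm fin}$ (algebraic tensor product) and $\mathcal D_1=C_0^\infty(\mathbb R^3)$. Let $(p+\sqrt\alpha A(x))^2$ be the self-adjoint operator associated to the closure of the form $\sum_{j=1}^3\|(p_j+\sqrt\alpha A_j(x))\Psi\|^2$ on $\mathcal D_0$, let $V:\mathbb R^3\to\mathbb R$ be Borel measurable with $V\in L^1_{\rm loc}(\mathbb R^3)$, and consider the quadratic forms $$H^0=\sqrt{(p+\sqrt\alpha A(x))^2+m^2}-m+H_f,\qquad H^V=H^0+V .$$ Put $K(k)=\sqrt{k^2+m^2}-m$, $h=K(p)+V$ (a form on $L^2(\mathbb R^3)$), $\Omega(k)=e^{-ik\cdot x}H^0e^{ik\cdot x}$, $P=p\otimes I+I\otimes P_f$ and, in the extended real numbers, $$E^\sharp=\inf_{\Psi\in\mathcal D_0,\|\Psi\|=1}(\Psi|H^\sharp\Psi)\quad(\sharp=V,0),\qquad e_0=\inf_{f\in\mathcal D_1,\|f\|=1}(f|hf).$$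 Then the following hold. (H.1) $\mathcal D_0$ is dense, $\mathcal D_0\subseteq Q(H^0)\cap Q(V)$, and $H^0$ is closable and bounded from below on $\mathcal D_0$. Consequently, if also $H^V$ is closable and bounded from below on $\mathcal D_0$ (which is automatic for $V=0$), then the hypothesis "$\mathcal D_0$ is a dense subspace of $Q(H^0)\cap Q(V)$ on which $H^V$ and $H^0$ are closable and bounded from below" holds. (H.2) $P_{f,1},P_{f,2},P_{f,3}$ are (strongly) commuting self-adjoint operators and, for every $k\in\mathbb R^3$, $e^{ik\cdot P}\mathcal D_0=\mathcal D_0$ and $(e^{ik\cdot P}\Psi|H^0e^{ik\cdot P}\Phi)=(\Psi|H^0\Phi)$ for all $\Psi,\Phi\in\mathcal D_0$. (H.3) $K$ is measurable and $\tfrac12\{\Omega(k)+\Omega(-k)-2\Omega(0)\}\le K(k)$ on $\mathcal D_0$ for all $k\in\mathbb R^3$. (H.4) $\mathcal D_1\ne\{0\}$, $\mathcal D_1\subseteq Q(K(p))\cap Q(V)$, $f\Psi\in\mathcal D_0$ for all $f\in\mathcal D_1$, $\Psi\in\mathcal D_0$, and $\bar f\in\mathcal D_1$ for all $f\in\mathcal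 D_1$. Moreover $E^V\le E^0+e_0$; and if $e_0<0$, then the binding energy satisfies $E^0-E^V\ge -e_0>0$. -/

import Mathlib

open MeasureTheory
open scoped InnerProductSpace ContDiff

noncomputable section

namespace SRPF

/-! ### Quadratic forms on a Hilbert space -/

section Forms

variable {H : Type*} [NormedAddCommGroup H] [InnerProductSpace ℂ H]

/-- A (not necessarily closed) Hermitian quadratic form on `H`: a form domain `dom` and a sesquilinear
map `val`, conjugate-linear in the first variable.  Values of `val` outside `dom` are irrelevant. -/
structure QForm (H : Type*) [NormedAddCommGroup H] [InnerProductSpace ℂ H] where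
  dom : Submodule ℂ H
  val : H → H → ℂ
  conj_symm : ∀ Ψ ∈ dom, ∀ Φ ∈ dom, starRingEnd ℂ (val Φ Ψ) = val Ψ Φ
  add_right : ∀ Ψ ∈ dom, ∀ Φ ∈ dom, ∀ Φ' ∈ dom, val Ψ (Φ + Φ') = val Ψ Φ + val Ψ Φ'
  smul_right : ∀ Ψ ∈ dom, ∀ Φ ∈ dom, ∀ c : ℂ, val Ψ (c • Φ) = c * val Ψ Φ

/-- The real number `(Ψ | q Ψ)`. -/
def QForm.quad (q : QForm H) (Ψ : H) : ℝ := (q.val Ψ Ψ).re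

/-- Sum of forms, on the intersection of the form domains. -/
def QForm.add (q q' : QForm H) : QForm H where
  dom := q.dom ⊓ q'.dom
  val Ψ Φ := q.val Ψ Φ + q'.val Ψ Φ
  conj_symm Ψ hΨ Φ hΦ := by
    rw [map_add, q.conj_symm Ψ hΨ.1 Φ hΦ.1, q'.conj_symm Ψ hΨ.2 Φ hΦ.2]
  add_right Ψ hΨ Φ hΦ Φ' hΦ' := by
    rw [q.add_right Ψ hΨ.1 Φ hΦ.1 Φ' hΦ'.1, q'.add_right Ψ hΨ.2 Φ hΦ.2 Φ' hΦ'.2]; ring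
  smul_right Ψ hΨ Φ hΦ c := by
    rw [q.smul_right Ψ hΨ.1 Φ hΦ.1, q'.smul_right Ψ hΨ.2 Φ hΦ.2]; ring

/-- The form of the real constant `c`, i.e. of the operator `c • 1`. -/
def QForm.const (H : Type*) [NormedAddCommGroup H] [InnerProductSpace ℂ H] (c : ℝ) : QForm H where
  dom := ⊤
  val Ψ Φ := (c : ℂ) * ⟪Ψ, Φ⟫_ℂ
  conj_symm Ψ _ Φ _ := by rw [map_mul, Complex.conj_ofReal, inner_conj_symm]
  add_right Ψ _ Φ _ Φ' _ := by rw [inner_add_right]; ring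
  smul_right Ψ _ Φ _ a := by rw [inner_smul_right]; ring

/-- A partially defined operator, extended by zero as a function. -/
def extendZero {H' : Type*} [NormedAddCommGroup H'] [InnerProductSpace ℂ H'] (S : H →ₗ.[ℂ] H')
    (Ψ : H) : H' :=
  open Classical in if h : Ψ ∈ S.domain then S ⟨Ψ, h⟩ else 0

/-- The form `(Ψ | S* S Φ) = (S Ψ | S Φ)` with form domain `Dom S`.  If `A ≥ 0` is self-adjoint and
`S = A^{1/2}`, this is the form associated to `A`. -/
def QForm.ofOp {H' : Type*} [NormedAddCommGroup H'] [InnerProductSpace ℂ H'] (S : H →ₗ.[ℂ] H') :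
    QForm H where
  dom := S.domain
  val Ψ Φ := ⟪extendZero S Ψ, extendZero S Φ⟫_ℂ
  conj_symm Ψ _ Φ _ := inner_conj_symm _ _
  add_right Ψ _ Φ hΦ Φ' hΦ' := by
    have h : extendZero S (Φ + Φ') = extendZero S Φ + extendZero S Φ' := by
      simp only [extendZero, dif_pos hΦ, dif_pos hΦ', dif_pos (S.domain.add_mem hΦ hΦ')]
      rw [← S.map_add]; rfl
    rw [h, inner_add_right]
  smul_right Ψ _ Φ hΦ c := by
    have h : extendZero S (c • Φ) = c • extendZero S Φ := by
      simp only [extendZero, dif_pos hΦ, dif_pos (S.domain.smul_mem c hΦ)]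
      rw [← S.map_smul]; rfl
    rw [h, inner_smul_right]

/-- The form `L* q L`. -/
def QForm.comap {H₂ : Type*} [NormedAddCommGroup H₂] [InnerProductSpace ℂ H₂]
    (L : H →ₗ[ℂ] H₂) (q : QForm H₂) : QForm H where
  dom := q.dom.comap L
  val Ψ Φ := q.val (L Ψ) (L Φ)
  conj_symm Ψ hΨ Φ hΦ := q.conj_symm _ hΨ _ hΦ
  add_right Ψ hΨ Φ hΦ Φ' hΦ' := by rw [map_add, q.add_right _ hΨ _ hΦ _ hΦ']
  smul_right Ψ hΨ Φ hΦ c := by rw [map_smul, q.smul_right _ hΨ _ hΦ]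

/-- `q` is bounded from below on the subspace `D`. -/
def QForm.BoundedBelowOn (q : QForm H) (D : Submodule ℂ H) : Prop :=
  ∃ c : ℝ, ∀ Ψ ∈ D, c * ‖Ψ‖ ^ 2 ≤ q.quad Ψ

/-- `q`, restricted to `D`, is closable: if `Ψₙ → 0` and `q[Ψₙ - Ψₘ] → 0` then `q[Ψₙ] → 0`. -/
def QForm.ClosableOn (q : QForm H) (D : Submodule ℂ H) : Prop :=
  ∀ Ψ : ℕ → H, (∀ n, Ψ n ∈ D) → Filter.Tendsto Ψ Filter.atTop (nhds 0) →
    Filter.Tendsto (fun nm : ℕ × ℕ => q.quad (Ψ nm.1 - Ψ nm.2)) Filter.atTop (nhds 0) →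
    Filter.Tendsto (fun n => q.quad (Ψ n)) Filter.atTop (nhds 0)

/-- The ground state energy `inf {(Ψ | q Ψ) : Ψ ∈ D, ‖Ψ‖ = 1}`, in the extended reals. -/
def groundEnergy (q : QForm H) (D : Submodule ℂ H) : EReal :=
  ⨅ Ψ : {Ψ : H // Ψ ∈ D ∧ ‖Ψ‖ = 1}, (q.quad Ψ.1 : EReal)

end Forms

/-! ### Square roots of positive operators given by forms -/

section SquareRoot

variable {H H' : Type*} [NormedAddCommGroup H] [InnerProductSpace ℂ H] [CompleteSpace H]
  [NormedAddCommGroup H'] [InnerProductSpace ℂ H'] [CompleteSpace H']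

/-- Let `C` be a densely defined closable operator from `H` to `H'`, `m > 0`, and let `G` be the space of
all `(m w, C w)`, `w ∈ Dom C`.  Then `massResolvent m G` is the bounded operator `(T + m²)^{-1}`, where
`T = C* C̄` is the self-adjoint operator associated to the closure of the form `‖C w‖²`.

Indeed, if `(m v, C̄ v)` is the orthogonal projection of `(u, 0)` on the closure of `G`, then
`m² (w|v) + (C w|C̄ v) = m (w|u)` for all `w`, i.e. `v = m (T + m²)^{-1} u`; so the first component `m v`
of the projection is `m² (T + m²)^{-1} u`. -/
def massResolvent (m : ℝ) (G : Submodule ℂ (WithLp 2 (H × H'))) : H →L[ℂ] H :=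
  ((m : ℂ) ^ 2)⁻¹ •
    ((WithLp.fstL 2 ℂ H H').comp
      (G.topologicalClosure.starProjection.comp
        ((WithLp.prodContinuousLinearEquiv 2 ℂ H H').symm.toContinuousLinearMap.comp
          (ContinuousLinearMap.inl ℂ H H'))))

/-- For a bounded positive injective operator `R = B^{-1}`, the positive self-adjoint operator
`B^{1/4} = (R^{1/4})^{-1}`, with domain the range of `R^{1/4}`.  It is the square root of `√B = (R^{1/2})^{-1}`, so
that `QForm.ofOp` of it is the form associated to `√B`. -/
def fourthRootInv (R : H →L[ℂ] H) : H →ₗ.[ℂ] H :=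
  ((CFC.sqrt (CFC.sqrt R)).toLinearMap.toPMap ⊤).inverse

end SquareRoot

/-! ### The Hilbert space `L²(ℝᵈ; dx) ⊗ 𝒦 = L²(ℝᵈ; 𝒦)` and the hypotheses (H.1)–(H.4) -/

/-- Euclidean space `ℝᵈ`. -/
abbrev Rd (d : ℕ) := EuclideanSpace ℝ (Fin d)

/-- `L²(ℝᵈ; dx) ⊗ 𝒦`, realised as the space of `𝒦`-valued square integrable functions. -/
abbrev L2 (d : ℕ) (𝒦 : Type*) [NormedAddCommGroup 𝒦] [InnerProductSpace ℂ 𝒦] :=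
  Lp 𝒦 2 (volume : Measure (Rd d))

section Abstract

variable {d : ℕ} {𝒦 : Type*} [NormedAddCommGroup 𝒦] [InnerProductSpace ℂ 𝒦]

/-- Form domain `Dom(|V|^{1/2})` of the multiplication by `V(x)`. -/
def mulFormDomain (V : Rd d → ℝ) : Submodule ℂ (L2 d 𝒦) where
  carrier := {Ψ | MemLp (fun x => ((√|V x| : ℝ) : ℂ) • Ψ x) 2 volume}
  zero_mem' := by
    have h : (fun x => ((√|V x| : ℝ) : ℂ) • (0 : L2 d 𝒦) x) =ᵐ[volume] fun _ => (0 : 𝒦) := by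
      filter_upwards [Lp.coeFn_zero 𝒦 2 (volume : Measure (Rd d))] with x hx
      rw [hx, Pi.zero_apply, smul_zero]
    exact (memLp_congr_ae h).2 MemLp.zero'
  add_mem' := by
    intro Ψ Φ hΨ hΦ
    refine (memLp_congr_ae ?_).2 (MemLp.add hΨ hΦ)
    filter_upwards [Lp.coeFn_add Ψ Φ] with x hx
    simp only [hx, Pi.add_apply, smul_add]
  smul_mem' := by
    intro c Ψ hΨ
    refine (memLp_congr_ae ?_).2 (MemLp.const_smul hΨ c)
    filter_upwards [Lp.coeFn_smul c Ψ] with x hx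
    simp only [hx, Pi.smul_apply]
    rw [smul_comm]

theorem integrable_mulForm {V : Rd d → ℝ} (hV : Measurable V) {Ψ Φ : L2 d 𝒦}
    (hΨ : Ψ ∈ mulFormDomain V) (hΦ : Φ ∈ mulFormDomain V) :
    Integrable (fun x => (V x : ℂ) * ⟪Ψ x, Φ x⟫_ℂ) volume := by
  have h₁ : MemLp (fun x => ((√|V x| : ℝ) : ℂ) • Ψ x) 2 volume := hΨ
  have h₂ : MemLp (fun x => ((√|V x| : ℝ) : ℂ) • Φ x) 2 volume := hΦ
  have hm : Integrable (fun x => ‖((√|V x| : ℝ) : ℂ) • Ψ x‖ * ‖((√|V x| : ℝ) : ℂ) • Φ x‖)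
      volume := MemLp.integrable_mul h₁.norm h₂.norm
  refine hm.mono' ?_ (Filter.Eventually.of_forall fun x => ?_)
  · exact (Complex.measurable_ofReal.comp hV).aestronglyMeasurable.mul
      ((Lp.aestronglyMeasurable Ψ).inner (Lp.aestronglyMeasurable Φ))
  · have h : √|V x| * √|V x| = |V x| := Real.mul_self_sqrt (abs_nonneg _)
    simp only [norm_mul, norm_smul, Complex.norm_real, Real.norm_eq_abs,
      abs_of_nonneg (Real.sqrt_nonneg _)]
    calc |V x| * ‖⟪Ψ x, Φ x⟫_ℂ‖ ≤ |V x| * (‖Ψ x‖ * ‖Φ x‖) :=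
          mul_le_mul_of_nonneg_left (norm_inner_le_norm _ _) (abs_nonneg _)
      _ = √|V x| * ‖Ψ x‖ * (√|V x| * ‖Φ x‖) := by
          rw [mul_mul_mul_comm, h]

/-- The form of the multiplication by the real function `V(x)`:
`(Ψ | V Φ) = ∫ V(x) ⟨Ψ(x), Φ(x)⟩ dx` on `Q(V) = Dom(|V|^{1/2})`. -/
def mulForm (𝒦 : Type*) [NormedAddCommGroup 𝒦] [InnerProductSpace ℂ 𝒦] (V : Rd d → ℝ)
    (hV : Measurable V) : QForm (L2 d 𝒦) where
  dom := mulFormDomain V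
  val Ψ Φ := ∫ x, (V x : ℂ) * ⟪Ψ x, Φ x⟫_ℂ
  conj_symm Ψ _ Φ _ := by
    rw [← integral_conj]
    simp only [map_mul, Complex.conj_ofReal, inner_conj_symm]
  add_right Ψ hΨ Φ hΦ Φ' hΦ' := by
    rw [← integral_add (integrable_mulForm hV hΨ hΦ) (integrable_mulForm hV hΨ hΦ')]
    refine integral_congr_ae ?_
    filter_upwards [Lp.coeFn_add Φ Φ'] with x hx
    simp only [hx, Pi.add_apply, inner_add_right, mul_add]
  smul_right Ψ hΨ Φ hΦ c := by
    rw [← integral_const_mul]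
    refine integral_congr_ae ?_
    filter_upwards [Lp.coeFn_smul c Φ] with x hx
    simp only [hx, Pi.smul_apply, inner_smul_right]
    ring

/-- The form `H^V = H⁰ + V`. -/
def withPotential (H0 : QForm (L2 d 𝒦)) (V : Rd d → ℝ) (hV : Measurable V) : QForm (L2 d 𝒦) :=
  H0.add (mulForm 𝒦 V hV)

/-- The form of `K(p)` on `L²(ℝᵈ)`, `p = -i∇`.  With the Fourier transform
`f̂(ξ) = ∫ e^{-2πi x·ξ} f(x) dx`, the operator `p` is the multiplication by `2πξ`. -/
def momentumForm (K : Rd d → ℝ) (hK : Measurable K) : QForm (L2 d ℂ) :=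
  (mulForm ℂ (fun ξ => K ((2 * Real.pi) • ξ)) (hK.comp (measurable_const_smul _))).comap
    (Lp.fourierTransformₗᵢ (Rd d) ℂ).toLinearEquiv.toLinearMap

/-- The form `h = K(p) + V` on `L²(ℝᵈ)`. -/
def particleForm (K : Rd d → ℝ) (hK : Measurable K) (V : Rd d → ℝ) (hV : Measurable V) :
    QForm (L2 d ℂ) :=
  (momentumForm K hK).add (mulForm ℂ V hV)

theorem memLp_modulation (k : Rd d) (Ψ : L2 d 𝒦) :
    MemLp (fun x => Complex.exp (((inner ℝ k x : ℝ) : ℂ) * Complex.I) • Ψ x) 2 volume := by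
  refine (Lp.memLp Ψ).of_le ?_ (Filter.Eventually.of_forall fun x => ?_)
  · refine AEStronglyMeasurable.smul (Continuous.aestronglyMeasurable ?_)
      (Lp.aestronglyMeasurable Ψ)
    fun_prop
  · rw [norm_smul, Complex.norm_exp_ofReal_mul_I, one_mul]

/-- The multiplication operator `e^{i k·x}` on `L²(ℝᵈ; 𝒦)`. -/
def modulation (k : Rd d) : L2 d 𝒦 →ₗ[ℂ] L2 d 𝒦 where
  toFun Ψ := (memLp_modulation k Ψ).toLp _
  map_add' Ψ Φ := by
    rw [← MemLp.toLp_add]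
    refine MemLp.toLp_congr _ _ ?_
    filter_upwards [Lp.coeFn_add Ψ Φ] with x hx
    simp only [hx, Pi.add_apply, smul_add]
  map_smul' c Ψ := by
    rw [RingHom.id_apply, ← MemLp.toLp_const_smul]
    refine MemLp.toLp_congr _ _ ?_
    filter_upwards [Lp.coeFn_smul c Ψ] with x hx
    simp only [hx, Pi.smul_apply]
    rw [smul_comm]

/-- The form `Ω(k) = e^{-i k·x} H⁰ e^{i k·x}`. -/
def conjugated (H0 : QForm (L2 d 𝒦)) (k : Rd d) : QForm (L2 d 𝒦) := H0.comap (modulation k)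

/-- `U(k) = e^{i k·B}` for the vector `B = (B₁, …, B_d)` of operators: `U` is a strongly continuous
unitary representation of `ℝᵈ`, and `B_j` is the generator of `t ↦ U(t e_j)`, that is `B_j ψ = φ`
if and only if `d/dt U(t e_j) ψ = i φ` at `t = 0`.  By Stone's theorem such a `U` exists if and only if
the `B_j` are self-adjoint and strongly commuting. -/
structure IsExpGroup (B : Fin d → 𝒦 →ₗ.[ℂ] 𝒦) (U : Rd d → 𝒦 →L[ℂ] 𝒦) : Prop where
  map_zero : U 0 = ContinuousLinearMap.id ℂ 𝒦
  map_add : ∀ k l, U (k + l) = (U k).comp (U l)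
  norm_map : ∀ k ψ, ‖U k ψ‖ = ‖ψ‖
  continuous : ∀ ψ, Continuous fun k => U k ψ
  generator : ∀ j ψ φ, (ψ, φ) ∈ (B j).graph ↔
    HasDerivAt (fun t : ℝ => U (t • EuclideanSpace.single j (1 : ℝ)) ψ) (Complex.I • φ) 0

/-- The operator `e^{i k·P} = e^{i k·p} ⊗ e^{i k·P_f}` on `L²(ℝᵈ; 𝒦)`, for `P = p ⊗ 1 + 1 ⊗ P_f` and
`U(k) = e^{i k·P_f}`: it sends `Ψ` to `x ↦ U(k) Ψ(x + k)`. -/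
def totalTranslation (U : Rd d → 𝒦 →L[ℂ] 𝒦) (k : Rd d) : L2 d 𝒦 →ₗ[ℂ] L2 d 𝒦 :=
  ((U k).compLpL 2 (volume : Measure (Rd d))).toLinearMap ∘ₗ
    Lp.compMeasurePreservingₗ ℂ (fun x : Rd d => x + k) (measurePreserving_add_right volume k)

/-- Hypothesis (H.1). -/
structure HypH1 (H0 : QForm (L2 d 𝒦)) (V : Rd d → ℝ) (hV : Measurable V)
    (D0 : Submodule ℂ (L2 d 𝒦)) : Prop where
  dense : Dense (D0 : Set (L2 d 𝒦))
  le_dom : D0 ≤ H0.dom ⊓ (mulForm 𝒦 V hV).dom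
  boundedBelow : H0.BoundedBelowOn D0
  closable : H0.ClosableOn D0
  boundedBelow_V : (withPotential H0 V hV).BoundedBelowOn D0
  closable_V : (withPotential H0 V hV).ClosableOn D0

/-- Hypothesis (H.2), for a given vector `Pf` of operators on `𝒦`. -/
def HypH2 [CompleteSpace 𝒦] (H0 : QForm (L2 d 𝒦)) (D0 : Submodule ℂ (L2 d 𝒦))
    (Pf : Fin d → 𝒦 →ₗ.[ℂ] 𝒦) : Prop :=
  (∀ j, IsSelfAdjoint (Pf j)) ∧
  ∃ U : Rd d → 𝒦 →L[ℂ] 𝒦, IsExpGroup Pf U ∧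
    ∀ k, D0.map (totalTranslation U k) = D0 ∧
      ∀ Ψ ∈ D0, ∀ Φ ∈ D0,
        H0.val (totalTranslation U k Ψ) (totalTranslation U k Φ) = H0.val Ψ Φ

/-- Hypothesis (H.3), for a given measurable function `K`. -/
def HypH3 (H0 : QForm (L2 d 𝒦)) (D0 : Submodule ℂ (L2 d 𝒦)) (K : Rd d → ℝ) : Prop :=
  Measurable K ∧ ∀ k : Rd d, D0 ≤ (conjugated H0 k).dom ∧
    ∀ Ψ ∈ D0, (1 / 2 : ℝ) * ((conjugated H0 k).quad Ψ + (conjugated H0 (-k)).quad Ψ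
      - 2 * (conjugated H0 0).quad Ψ) ≤ K k * ‖Ψ‖ ^ 2

/-- Hypothesis (H.4), for given `K` and `D1`. -/
structure HypH4 (D0 : Submodule ℂ (L2 d 𝒦)) (K : Rd d → ℝ) (hK : Measurable K) (V : Rd d → ℝ)
    (hV : Measurable V) (D1 : Submodule ℂ (L2 d ℂ)) : Prop where
  nontrivial : D1 ≠ ⊥
  le_dom : D1 ≤ (momentumForm K hK).dom ⊓ (mulForm ℂ V hV).dom
  mul_mem : ∀ f ∈ D1, ∀ Ψ ∈ D0, ∃ Φ ∈ D0, Φ =ᵐ[volume] fun x => f x • Ψ x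
  star_mem : ∀ f ∈ D1, star f ∈ D1

/-- The operator `I ⊗ A` on `L²(ℝᵈ) ⊗ 𝒦` for a closed operator `A` on `𝒦`: `(I ⊗ A) Ψ (x) = A (Ψ x)` on
the domain of those `Ψ` for which the right-hand side is defined almost everywhere and square
integrable. -/
def fiberOp (A : 𝒦 →ₗ.[ℂ] 𝒦) : L2 d 𝒦 →ₗ.[ℂ] L2 d 𝒦 :=
  Submodule.toLinearPMap
    { carrier := {p | ∀ᵐ x, (p.1 x, p.2 x) ∈ A.graph}
      zero_mem' := by
        show ∀ᵐ x, ((0 : L2 d 𝒦) x, (0 : L2 d 𝒦) x) ∈ A.graph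
        filter_upwards [Lp.coeFn_zero 𝒦 2 (volume : Measure (Rd d))] with x hx
        rw [hx]
        exact A.graph.zero_mem
      add_mem' := by
        intro p q hp hq
        filter_upwards [hp, hq, Lp.coeFn_add p.1 q.1, Lp.coeFn_add p.2 q.2] with x h₁ h₂ h₃ h₄
        rw [Prod.fst_add, Prod.snd_add, h₃, h₄]
        exact A.graph.add_mem h₁ h₂
      smul_mem' := by
        intro c p hp
        filter_upwards [hp, Lp.coeFn_smul c p.1, Lp.coeFn_smul c p.2] with x h₁ h₂ h₃
        rw [Prod.smul_fst, Prod.smul_snd, h₂, h₃]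
        exact A.graph.smul_mem c h₁ }

end Abstract

/-! ### The bosonic Fock space over `L²(ℝ³ × {1,2})` -/

/-- The one-photon configuration space `ℝ³ × {1,2}` (momentum and polarization). -/
abbrev Photon := Rd 3 × Fin 2

/-- Lebesgue measure times counting measure. -/
abbrev photonMeasure : Measure Photon := (volume : Measure (Rd 3)).prod Measure.count

/-- The measure on the space of `n`-photon configurations. -/
abbrev photonMeasureN (n : ℕ) : Measure (Fin n → Photon) := Measure.pi fun _ => photonMeasure

theorem measurePreserving_perm (n : ℕ) (σ : Equiv.Perm (Fin n)) :
    MeasurePreserving (fun (k : Fin n → Photon) (i : Fin n) => k (σ i)) (photonMeasureN n)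
      (photonMeasureN n) := by
  have h := measurePreserving_piCongrLeft (fun _ : Fin n => photonMeasure) σ.symm
  convert h using 1
  funext k i
  have := (MeasurableEquiv.piCongrLeft_apply_apply (β := fun _ : Fin n => Photon) σ.symm k (σ i))
  simpa using this.symm

/-- The `n`-photon space `⊗ₛⁿ L²(ℝ³ × {1,2})`: the symmetric functions in `L²((ℝ³ × {1,2})ⁿ)`. -/
def symL2 (n : ℕ) : Submodule ℂ (Lp ℂ 2 (photonMeasureN n)) :=
  ⨅ σ : Equiv.Perm (Fin n), LinearMap.eqLocus
    (Lp.compMeasurePreservingₗ ℂ (fun (k : Fin n → Photon) i => k (σ i))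
      (measurePreserving_perm n σ)) LinearMap.id

instance completeSpace_symL2 (n : ℕ) : CompleteSpace (symL2 n) := by
  have h : IsClosed (symL2 n : Set (Lp ℂ 2 (photonMeasureN n))) := by
    rw [symL2, Submodule.coe_iInf]
    refine isClosed_iInter fun σ => ?_
    exact isClosed_eq (Lp.compMeasurePreservingₗᵢ ℂ (fun (k : Fin n → Photon) i => k (σ i))
      (measurePreserving_perm n σ)).continuous continuous_id
  exact h.completeSpace_coe

/-- The bosonic Fock space `Γₛ(L²(ℝ³ × {1,2})) = ⨁ₙ ⊗ₛⁿ L²(ℝ³ × {1,2})`. -/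
abbrev Fock := lp (fun n => symL2 n) 2

/-- The `n`-photon component of a Fock vector, as a function. -/
def comp (ψ : Fock) (n : ℕ) : (Fin n → Photon) → ℂ := ((ψ n : Lp ℂ 2 (photonMeasureN n)) : _ → ℂ)

theorem comp_zero (n : ℕ) : comp 0 n =ᵐ[photonMeasureN n] 0 :=
  Lp.coeFn_zero ℂ 2 (photonMeasureN n)

theorem comp_add (ψ φ : Fock) (n : ℕ) :
    comp (ψ + φ) n =ᵐ[photonMeasureN n] comp ψ n + comp φ n :=
  Lp.coeFn_add (ψ n : Lp ℂ 2 (photonMeasureN n)) (φ n : Lp ℂ 2 (photonMeasureN n))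

theorem comp_smul (c : ℂ) (ψ : Fock) (n : ℕ) :
    comp (c • ψ) n =ᵐ[photonMeasureN n] c • comp ψ n :=
  Lp.coeFn_smul c (ψ n : Lp ℂ 2 (photonMeasureN n))

/-- `ψ` is the vacuum `Ω = (1, 0, 0, …)`. -/
def IsVacuum (ψ : Fock) : Prop :=
  comp ψ 0 =ᵐ[photonMeasureN 0] (fun _ => 1) ∧ ∀ n, ψ (n + 1) = 0

theorem quasi_removeNth (n : ℕ) (i : Fin (n + 1)) :
    Measure.QuasiMeasurePreserving (fun (k : Fin (n + 1) → Photon) j => k (i.succAbove j))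
      (photonMeasureN (n + 1)) (photonMeasureN n) := by
  have h := (measurePreserving_piFinSuccAbove (fun _ : Fin (n + 1) => photonMeasure) i)
  exact Measure.quasiMeasurePreserving_snd.comp h.quasiMeasurePreserving

/-- The creation operator `a*(g)`, with its maximal domain:
`(a*(g)ψ)₀ = 0` and
`(a*(g)ψ)ₙ₊₁(k₀, …, kₙ) = (n+1)^{-1/2} ∑ᵢ g(kᵢ) ψₙ(k₀, …, k̂ᵢ, …, kₙ)`. -/
def creation (g : Photon → ℂ) : Fock →ₗ.[ℂ] Fock :=
  Submodule.toLinearPMap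
    { carrier := {p | p.2 0 = 0 ∧ ∀ n, comp p.2 (n + 1) =ᵐ[photonMeasureN (n + 1)] fun k =>
        ((√((n : ℝ) + 1) : ℝ) : ℂ)⁻¹ * ∑ i, g (k i) * comp p.1 n fun j => k (i.succAbove j)}
      zero_mem' := by
        refine ⟨rfl, fun n => ?_⟩
        have h : ∀ i : Fin (n + 1), ∀ᵐ k ∂photonMeasureN (n + 1),
            comp 0 n (fun j => k (i.succAbove j)) = 0 :=
          fun i => (quasi_removeNth n i).ae (comp_zero n)
        filter_upwards [comp_zero (n + 1), ae_all_iff.2 h] with k h₀ hk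
        simp only [Prod.snd_zero, Prod.fst_zero, h₀, hk]
        simp
      add_mem' := by
        rintro p q ⟨hp0, hp⟩ ⟨hq0, hq⟩
        refine ⟨?_, fun n => ?_⟩
        · rw [Prod.snd_add, lp.coeFn_add, Pi.add_apply, hp0, hq0, add_zero]
        have h : ∀ i : Fin (n + 1), ∀ᵐ k ∂photonMeasureN (n + 1),
            comp (p.1 + q.1) n (fun j => k (i.succAbove j)) =
              comp p.1 n (fun j => k (i.succAbove j)) + comp q.1 n (fun j => k (i.succAbove j)) :=
          fun i => (quasi_removeNth n i).ae (comp_add p.1 q.1 n)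
        filter_upwards [hp n, hq n, comp_add p.2 q.2 (n + 1), ae_all_iff.2 h] with k h₁ h₂ h₃ hk
        simp only [Prod.snd_add, Prod.fst_add, h₃, Pi.add_apply, h₁, h₂, hk, mul_add,
          Finset.sum_add_distrib]
      smul_mem' := by
        rintro c p ⟨hp0, hp⟩
        refine ⟨?_, fun n => ?_⟩
        · rw [Prod.smul_snd, lp.coeFn_smul, Pi.smul_apply, hp0, smul_zero]
        have h : ∀ i : Fin (n + 1), ∀ᵐ k ∂photonMeasureN (n + 1),
            comp (c • p.1) n (fun j => k (i.succAbove j)) =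
              c * comp p.1 n (fun j => k (i.succAbove j)) :=
          fun i => (quasi_removeNth n i).ae (comp_smul c p.1 n)
        filter_upwards [hp n, comp_smul c p.2 (n + 1), ae_all_iff.2 h] with k h₁ h₂ hk
        simp only [Prod.smul_snd, Prod.smul_fst, h₂, Pi.smul_apply, h₁, hk, smul_eq_mul,
          Finset.mul_sum]
        refine Finset.sum_congr rfl fun i _ => ?_
        ring }

/-- The annihilation operator `a(g) = (a*(g))*`. -/
def annihilation (g : Photon → ℂ) : Fock →ₗ.[ℂ] Fock := (creation g).adjoint

/-- Second quantization of the multiplication by the real functions `w`, or a function of it: the operator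
acting on the `n`-photon space as the multiplication by `w n`, with its maximal domain. -/
def sectorMul (w : ∀ n, (Fin n → Photon) → ℝ) : Fock →ₗ.[ℂ] Fock :=
  Submodule.toLinearPMap
    { carrier := {p | ∀ n, comp p.2 n =ᵐ[photonMeasureN n] fun k => (w n k : ℂ) * comp p.1 n k}
      zero_mem' := by
        intro n
        filter_upwards [comp_zero n] with k h
        simp [h]
      add_mem' := by
        intro p q hp hq n
        filter_upwards [hp n, hq n, comp_add p.1 q.1 n, comp_add p.2 q.2 n] with k h₁ h₂ h₃ h₄
        simp only [Prod.snd_add, Prod.fst_add, h₃, h₄, Pi.add_apply, h₁, h₂, mul_add]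
      smul_mem' := by
        intro c p hp n
        filter_upwards [hp n, comp_smul c p.1 n, comp_smul c p.2 n] with k h₁ h₂ h₃
        simp only [Prod.smul_snd, Prod.smul_fst, h₂, h₃, Pi.smul_apply, h₁, smul_eq_mul]
        ring }

/-- The photon momentum `P_{f,j} = ∑_λ ∫ k_j a*_λ(k) a_λ(k) dk`. -/
def fieldMomentum (j : Fin 3) : Fock →ₗ.[ℂ] Fock := sectorMul fun _ k => ∑ i, (k i).1 j

/-- The square root `H_f^{1/2}` of the photon energy `H_f = ∑_λ ∫ |k| a*_λ(k) a_λ(k) dk`, which is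
the multiplication by `|k₁| + ⋯ + |kₙ|` on the `n`-photon space. -/
def sqrtFieldEnergy : Fock →ₗ.[ℂ] Fock := sectorMul fun _ k => √(∑ i, ‖(k i).1‖)

/-- The coupling function of `A_j(x)`: `(k, λ) ↦ Λ(k) |k|^{-1/2} e^{(λ)}_j(k) e^{-i k·x}`. -/
def coupling (Λ : Rd 3 → ℝ) (e : Fin 2 → Rd 3 → Rd 3) (j : Fin 3) (x : Rd 3) : Photon → ℂ :=
  fun q => ((Λ q.1 / √‖q.1‖ * e q.2 q.1 j : ℝ) : ℂ) *
    Complex.exp (-(((inner ℝ q.1 x : ℝ) : ℂ) * Complex.I))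

/-- The quantized vector potential at the point `x`,
`A_j(x) = 2^{-1/2} ∑_λ ∫ Λ(k) |k|^{-1/2} e^{(λ)}_j(k) (e^{i k·x} a_λ(k) + e^{-i k·x} a*_λ(k)) dk`
(recall that `a(g)` is antilinear in `g`). -/
def vectorPotential (Λ : Rd 3 → ℝ) (e : Fin 2 → Rd 3 → Rd 3) (j : Fin 3) (x : Rd 3) :
    Fock →ₗ.[ℂ] Fock :=
  (((√2 : ℝ) : ℂ)⁻¹) • (annihilation (coupling Λ e j x) + creation (coupling Λ e j x))

/-! ### The domains -/

/-- `f ∈ C₀^∞(ℝ³)`, complex valued. -/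
def IsTest (f : Rd 3 → ℂ) : Prop := ContDiff ℝ ∞ f ∧ HasCompactSupport f

/-- The vectors `a*(f₁) ⋯ a*(fₙ) Ω`, `n ≥ 0`, with `f_j ∈ C₀^∞(ℝ³ × {1,2})`. -/
inductive IsProductState : Fock → Prop
  | vacuum (ψ : Fock) (h : IsVacuum ψ) : IsProductState ψ
  | create (f : Photon → ℂ) (hf : ∀ l, IsTest fun k => f (k, l)) (ψ φ : Fock)
      (hψ : IsProductState ψ) (h : (ψ, φ) ∈ (creation f).graph) : IsProductState φ

/-- The finite photon subspace. -/
def finitePhoton : Submodule ℂ Fock := Submodule.span ℂ {ψ | IsProductState ψ}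

/-- `D₀ = C₀^∞(ℝ³) ⊗̂ F_fin` (algebraic tensor product). -/
def D0 : Submodule ℂ (L2 3 Fock) :=
  Submodule.span ℂ {Ψ | ∃ f, IsTest f ∧ ∃ η ∈ finitePhoton, Ψ =ᵐ[volume] fun x => f x • η}

/-- `D₁ = C₀^∞(ℝ³)` as a subspace of `L²(ℝ³)`. -/
def D1 : Submodule ℂ (L2 3 ℂ) := Submodule.span ℂ {f | ∃ g, IsTest g ∧ f =ᵐ[volume] g}

/-! ### The semi-relativistic Pauli–Fierz Hamiltonian -/

/-- All vectors `(m Ψ, π₁Ψ, π₂Ψ, π₃Ψ)` with `Ψ ∈ D₀`, where `π_j = p_j ⊗ 1 + √α A_j(x)`.  On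
`Ψ = f ⊗ η` this is `(π_j Ψ)(x) = -i ∂_j f(x) η + √α f(x) A_j(x) η`. -/
def kinGraph (α m : ℝ) (Λ : Rd 3 → ℝ) (e : Fin 2 → Rd 3 → Rd 3) : Submodule ℂ (WithLp 2 (L2 3 Fock × PiLp 2 fun _ : Fin 3 => L2 3 Fock)) :=
  Submodule.span ℂ {G | ∃ f, IsTest f ∧ ∃ η ∈ finitePhoton,
    (G.fst =ᵐ[volume] fun x => (m : ℂ) • f x • η) ∧
    ∀ j : Fin 3, ∃ ξ : Rd 3 → Fock, (∀ x, (η, ξ x) ∈ (vectorPotential Λ e j x).graph) ∧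
      G.snd j =ᵐ[volume] fun x =>
        (-Complex.I * fderiv ℝ f x (EuclideanSpace.single j (1 : ℝ))) • η
          + ((√α : ℝ) : ℂ) • f x • ξ x}

/-- The form `H⁰ = √((p ⊗ 1 + √α A(x))² + m²) - m + 1 ⊗ H_f`.  Here `T = (p ⊗ 1 + √α A(x))²` is the
self-adjoint operator associated to the closure of the form `∑_j ‖π_j Ψ‖²` on `D₀`, and
`(T + m²)^{1/4}` is the square root of `√(T + m²)`. -/
def freeForm (α m : ℝ) (Λ : Rd 3 → ℝ) (e : Fin 2 → Rd 3 → Rd 3) : QForm (L2 3 Fock) :=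
  ((QForm.ofOp (fourthRootInv (massResolvent m (kinGraph α m Λ e)))).add (QForm.const _ (-m))).add
    (QForm.ofOp (fiberOp sqrtFieldEnergy))

/-- `K(k) = √(k² + m²) - m`. -/
def relKinetic (m : ℝ) (k : Rd 3) : ℝ := √(‖k‖ ^ 2 + m ^ 2) - m

theorem measurable_relKinetic (m : ℝ) : Measurable (relKinetic m) := by
  unfold relKinetic
  fun_prop

end SRPF

end

/-! Put `D = √((p + √α A)² + m²)`, so that `H⁰ = D - m + H_f`. Everything rests on one operator
inequality for `D`. Since `e^{-ik·x} π_j e^{ik·x} = π_j + k_j`, the parallelogram law shows that the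
average of `e^{∓ik·x} D² e^{±ik·x}` is `D² + k²`. Let `C` be the corresponding average for `D` and
`κ = K(k)`, so that `k² = κ² + 2κm`. The square of an average is at most the average of the squares,
and `D ≥ m`; hence `C² ≤ D² + k² ≤ (D + κ)²`. Monotonicity of the operator square root gives `C ≤ D
+ κ`. As `H_f` commutes with `e^{ik·x}`, this is (H.3). The inequality is `fourthRootInv_conj_le`,
and monotonicity enters through `re_inner_symmetrizable_le`.

Because `D` is unbounded, the argument is written in terms of `R = D⁻²` and `Q = R^{1/2} = D⁻¹`. The
resolvent `R` is a compression of the projection on the closed graph of `(m, π₁, π₂, π₃)`, and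
`formIso` identifies `H` with the closed form domain by `z ↦ Q z`. The form of `D` is `‖R^{-1/4}
Ψ‖²`.

For (H.1), `H⁰` is a sum of squared norms of closed operators and a constant, and `|V| |f|²` is
integrable for a test function `f`. For (H.2), `U(k) A(x + k) U(-k) = A(x)` with `U(k) =
e^{ik·P_f}`. Hence `e^{ik·P}` preserves the graph, so it commutes with `R` and its roots.

The energy inequality uses the trial states `f e^{iy·P} Ψ`, with `f ∈ D₁` and `Ψ ∈ D₀`, averaged
over all `y ∈ ℝ³`. After integration over `y` the norm, the field energy and the potential energy
split into products of integrals (`integral_mul_norm_sq_mulOp_transOp`). For the kinetic part,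
`R^{-1/4}` applied to `f(· - y) Ψ` is the Fourier transform at `y` of `ξ ↦ f̂(ξ) R^{-1/4} e^{2πiξ·x}
Ψ`. Plancherel therefore turns its average into `∫ |f̂(ξ)|² ‖R^{-1/4} e^{2πiξ·x} Ψ‖² dξ`. The
conjugate of `f` gives the same with `-ξ` in the exponential, and the mean of the two is bounded by
the operator inequality at `k = 2πξ` (`le_average_trial`, `le_add_particle`).

All this uses only the properties collected in `IsCovariantField`. On Fock space they follow from
multiplication operators on the `n`-photon sectors, the plane-wave dependence of the coupling
functions on `x`, and the density of `finitePhoton`. -/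

noncomputable section

namespace SRPF

/-! ### The form domain of a massive resolvent -/

section Resolvent

variable {H H' : Type*} [NormedAddCommGroup H] [InnerProductSpace ℂ H] [CompleteSpace H]
  [NormedAddCommGroup H'] [InnerProductSpace ℂ H'] [CompleteSpace H']

/-- `u ↦ P (u, 0)` where `P` is the orthogonal projection on the closure of `G`. -/
def projInl (G : Submodule ℂ (WithLp 2 (H × H'))) : H →L[ℂ] WithLp 2 (H × H') :=
  G.topologicalClosure.starProjection.comp
    ((WithLp.prodContinuousLinearEquiv 2 ℂ H H').symm.toContinuousLinearMap.comp
      (ContinuousLinearMap.inl ℂ H H'))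

variable {G : Submodule ℂ (WithLp 2 (H × H'))} {m : ℝ}

theorem projInl_mem (u : H) : projInl G u ∈ G.topologicalClosure :=
  Submodule.starProjection_apply_mem _ _

/-- The projection is self-adjoint and fixes `g`, so only the first component of `g` is seen. Thus
`projInl G` acts as the adjoint of `fst` restricted to the closure of `G`. -/
theorem inner_projInl {g : WithLp 2 (H × H')} (hg : g ∈ G.topologicalClosure) (u : H) :
    ⟪projInl G u, g⟫_ℂ = ⟪u, g.fst⟫_ℂ := by
  have h : G.topologicalClosure.starProjection g = g := Submodule.starProjection_eq_self_iff.2 hg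
  show ⟪G.topologicalClosure.starProjection (WithLp.toLp 2 (u, (0 : H'))), g⟫_ℂ = _
  rw [Submodule.inner_starProjection_left_eq_right, h, WithLp.prod_inner_apply]
  simp

theorem massResolvent_apply (u : H) :
    massResolvent m G u = ((m : ℂ) ^ 2)⁻¹ • (projInl G u).fst := rfl

/-- The factorisation `R = m⁻² J* J` with `J = projInl G`; positivity and injectivity of the
resolvent are read off from it. -/
theorem inner_massResolvent (u v : H) :
    ⟪u, massResolvent m G v⟫_ℂ = ((m : ℂ) ^ 2)⁻¹ * ⟪projInl G u, projInl G v⟫_ℂ := by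
  rw [massResolvent_apply, inner_smul_right, inner_projInl (projInl_mem v)]

theorem massResolvent_nonneg : 0 ≤ massResolvent m G := by
  rw [ContinuousLinearMap.nonneg_iff_isPositive, ContinuousLinearMap.isPositive_iff_complex]
  intro u
  have h : ⟪massResolvent m G u, u⟫_ℂ = (((m ^ 2)⁻¹ * ‖projInl G u‖ ^ 2 : ℝ) : ℂ) := by
    rw [← inner_conj_symm, inner_massResolvent, inner_self_eq_norm_sq_to_K]
    simp [← Complex.ofReal_pow]
  rw [h]
  constructor
  · rw [RCLike.re_eq_complex_re, Complex.ofReal_re]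
  · rw [RCLike.re_eq_complex_re, Complex.ofReal_re]
    positivity

/-- If `R u = 0` then `J u = 0`, that is, `u` is orthogonal to the first components of `G`, and
these are dense. -/
theorem massResolvent_injective (hm : m ≠ 0)
    (hG : Dense ((G.map (WithLp.fstL 2 ℂ H H').toLinearMap : Submodule ℂ H) : Set H)) :
    Function.Injective (massResolvent m G) := by
  rw [injective_iff_map_eq_zero]
  intro u hu
  have h0 : projInl G u = 0 := by
    have h := inner_massResolvent (m := m) (G := G) u u
    rw [hu, inner_zero_right, eq_comm, mul_eq_zero] at h
    have h2 : ((m : ℂ) ^ 2)⁻¹ ≠ 0 := by simpa using hm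
    exact inner_self_eq_zero.1 (h.resolve_left h2)
  refine hG.eq_zero_of_inner_right (𝕜 := ℂ) ?_
  rintro _ ⟨g, hg, rfl⟩
  have h := inner_projInl (G := G) (Submodule.le_topologicalClosure _ hg) u
  rw [h0, inner_zero_left] at h
  rw [← inner_conj_symm]
  show starRingEnd ℂ ⟪u, g.fst⟫_ℂ = 0
  rw [← h, map_zero]

end Resolvent

/-! ### Square roots of positive operators -/

section PositiveSqrt

variable {H : Type*} [NormedAddCommGroup H] [InnerProductSpace ℂ H] [CompleteSpace H]

theorem inner_left_eq_right_of_nonneg {H : Type*} [NormedAddCommGroup H] [InnerProductSpace ℂ H]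
    {A : H →L[ℂ] H} (hA : 0 ≤ A) (x y : H) :
    ⟪A x, y⟫_ℂ = ⟪x, A y⟫_ℂ :=
  ((ContinuousLinearMap.nonneg_iff_isPositive A).1 hA).1 x y

/-- The square root of a positive bounded operator. -/
def opSqrt (A : H →L[ℂ] H) : H →L[ℂ] H := CFC.sqrt A

theorem opSqrt_nonneg (A : H →L[ℂ] H) : 0 ≤ opSqrt A := CFC.sqrt_nonneg A

theorem opSqrt_mul_self {A : H →L[ℂ] H} (hA : 0 ≤ A) : opSqrt A * opSqrt A = A :=
  CFC.sqrt_mul_sqrt_self A hA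

theorem opSqrt_apply_opSqrt_apply {A : H →L[ℂ] H} (hA : 0 ≤ A) (x : H) :
    opSqrt A (opSqrt A x) = A x := by
  exact congrArg (fun B : H →L[ℂ] H => B x) (opSqrt_mul_self hA)

theorem inner_opSqrt_opSqrt {A : H →L[ℂ] H} (hA : 0 ≤ A) (x y : H) :
    ⟪opSqrt A x, opSqrt A y⟫_ℂ = ⟪x, A y⟫_ℂ := by
  rw [inner_left_eq_right_of_nonneg (opSqrt_nonneg A), opSqrt_apply_opSqrt_apply hA]

theorem opSqrt_injective {A : H →L[ℂ] H} (hA : 0 ≤ A) (hi : Function.Injective A) :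
    Function.Injective (opSqrt A) := by
  intro x y hxy
  apply hi
  rw [← opSqrt_apply_opSqrt_apply hA, hxy, opSqrt_apply_opSqrt_apply hA]

theorem denseRange_of_injective_of_nonneg {A : H →L[ℂ] H} (hA : 0 ≤ A)
    (hi : Function.Injective A) : DenseRange A := by
  have h : (LinearMap.range A.toLinearMap)ᗮ = ⊥ := by
    rw [Submodule.eq_bot_iff]
    intro x hx
    apply hi
    rw [map_zero, ← inner_self_eq_zero (𝕜 := ℂ), ← inner_left_eq_right_of_nonneg hA]
    exact (Submodule.mem_orthogonal _ _).1 hx _ ⟨A x, rfl⟩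
  have h2 := (Submodule.topologicalClosure_eq_top_iff).2 h
  have h3 := (Submodule.dense_iff_topologicalClosure_eq_top).2 h2
  rw [LinearMap.coe_range] at h3
  exact h3

theorem commute_opSqrt {A B : H →L[ℂ] H} (h : Commute A B) : Commute (opSqrt A) B :=
  h.cfcₙ_nnreal _

/-- For a positive operator `S`, a contraction `W` that is symmetric with respect to the inner product
`⟪x, S y⟫` is a contraction with respect to that inner product. -/
theorem re_inner_symmetrizable_le {S W : H →L[ℂ] H} (hS : 0 ≤ S) (hW : ∀ x, ‖W x‖ ≤ ‖x‖)
    (hSW : ∀ x y, ⟪W x, S y⟫_ℂ = ⟪x, S (W y)⟫_ℂ) (v : H) :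
    (⟪v, S (W v)⟫_ℂ).re ≤ (⟪v, S v⟫_ℂ).re := by
  set B := opSqrt S with hB
  -- Krein's argument. By symmetry of `Wⁿ` and Cauchy–Schwarz for `⟪x, S y⟫`, `p n ^ 2 ≤ p 0 * p (2
  -- n)`. If `p 1 > p 0`, this would amplify the ratio `p 1 / p 0` to exponential growth along the
  -- powers of two, whereas `p` is bounded because `W` is a contraction in norm.
  set p : ℕ → ℝ := fun n => ‖B ((W ^ n) v)‖ with hp
  have hsymm : ∀ n x y, ⟪(W ^ n) x, S y⟫_ℂ = ⟪x, S ((W ^ n) y)⟫_ℂ := by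
    intro n
    induction n with
    | zero => intro x y; simp
    | succ n ih =>
      intro x y
      rw [pow_succ, mul_apply_eq_comp, ih, hSW]
      congr 2
      rw [← mul_apply_eq_comp, ← pow_succ', pow_succ]
  have hcs : ∀ n, p n ^ 2 ≤ p 0 * p (2 * n) := by
    intro n
    have h1 : ((p n ^ 2 : ℝ) : ℂ) = ⟪B v, B ((W ^ (2 * n)) v)⟫_ℂ := by
      rw [inner_opSqrt_opSqrt hS, two_mul, pow_add, mul_apply_eq_comp, ← hsymm,
        ← inner_opSqrt_opSqrt hS, ← hB, inner_self_eq_norm_sq_to_K, hp]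
      simp
    have h2 : p n ^ 2 = ‖⟪B v, B ((W ^ (2 * n)) v)⟫_ℂ‖ := by
      rw [← h1, Complex.norm_real, Real.norm_of_nonneg (by positivity)]
    rw [h2]
    simpa [hp] using norm_inner_le_norm (𝕜 := ℂ) (B v) (B ((W ^ (2 * n)) v))
  have hWn : ∀ n, ‖(W ^ n) v‖ ≤ ‖v‖ := by
    intro n
    induction n with
    | zero => simp
    | succ n ih =>
      rw [pow_succ', mul_apply_eq_comp]
      exact (hW _).trans ih
  have hbd : ∀ n, p n ≤ ‖B‖ * ‖v‖ := fun n =>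
    (B.le_opNorm _).trans (mul_le_mul_of_nonneg_left (hWn n) (norm_nonneg _))
  have hp0 : ∀ n, 0 ≤ p n := fun n => norm_nonneg _
  have h1 : p 1 ≤ p 0 := by
    rcases (hp0 0).eq_or_lt with h0 | h0
    · have := hcs 1
      rw [← h0, zero_mul] at this
      have h3 : p 1 = 0 := by nlinarith [hp0 1]
      rw [h3, ← h0]
    by_contra! hlt
    have hρ : 1 < p 1 / p 0 := by rwa [one_lt_div h0]
    have key : ∀ n, p 0 * (p 1 / p 0) ^ (2 ^ n) ≤ p (2 ^ n) := by
      intro n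
      induction n with
      | zero => simp only [pow_zero, pow_one]; rw [mul_div_cancel₀ _ h0.ne']
      | succ n ih =>
        have h4 := hcs (2 ^ n)
        rw [← pow_succ'] at h4
        have h5 : (p 0 * (p 1 / p 0) ^ (2 ^ n)) ^ 2 ≤ p 0 * p (2 ^ (n + 1)) :=
          (pow_le_pow_left₀ (by positivity) ih 2).trans h4
        have h6 : (p 0 * (p 1 / p 0) ^ (2 ^ n)) ^ 2 = p 0 * (p 0 * (p 1 / p 0) ^ (2 ^ (n + 1))) := by
          rw [pow_succ 2 n, pow_mul]; ring
        rw [h6] at h5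
        exact le_of_mul_le_mul_left h5 h0
    obtain ⟨N, hN⟩ := pow_unbounded_of_one_lt (‖B‖ * ‖v‖ / p 0) hρ
    have h7 : (p 1 / p 0) ^ N ≤ (p 1 / p 0) ^ (2 ^ N) :=
      pow_le_pow_right₀ hρ.le Nat.lt_two_pow_self.le
    have h8 := (key N).trans (hbd _)
    rw [div_lt_iff₀' h0] at hN
    have := mul_le_mul_of_nonneg_left h7 h0.le
    linarith
  have h2 : (⟪v, S (W v)⟫_ℂ).re ≤ p 0 * p 1 := by
    rw [← inner_opSqrt_opSqrt hS, ← hB]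
    refine (Complex.re_le_norm _).trans ?_
    simpa [hp] using norm_inner_le_norm (𝕜 := ℂ) (B v) (B (W v))
  have h3 : (⟪v, S v⟫_ℂ).re = p 0 * p 0 := by
    rw [← inner_opSqrt_opSqrt hS, ← hB, inner_self_eq_norm_sq_to_K, hp]
    simp [sq]
  rw [h3]
  exact h2.trans (mul_le_mul_of_nonneg_left h1 (hp0 0))

/-- The operator `A^{-1}` for a bounded injective operator `A`. -/
theorem mem_graph_inverse_toPMap {H : Type*} [NormedAddCommGroup H] [InnerProductSpace ℂ H]
    {A : H →L[ℂ] H} (hi : Function.Injective A) (x y : H) :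
    (x, y) ∈ ((A.toLinearMap.toPMap ⊤).inverse).graph ↔ A y = x := by
  have hker : (A.toLinearMap.toPMap ⊤).toFun.ker = ⊥ := by
    rw [LinearMap.ker_eq_bot']
    rintro ⟨z, hz⟩ h
    have h' : A z = 0 := h
    rw [← map_zero A] at h'
    exact Subtype.ext (hi h')
  rw [LinearPMap.inverse_graph hker]
  constructor
  · rintro ⟨⟨a, b⟩, hab, heq⟩
    obtain ⟨z, hz1, hz2⟩ := (LinearPMap.mem_graph_iff _).1 hab
    simp only [LinearEquiv.coe_coe, LinearEquiv.prodComm_apply, Prod.swap_prod_mk,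
      Prod.mk.injEq] at heq
    simp only at hz1 hz2
    rw [← heq.1, ← heq.2, ← hz2, ← hz1]
    rfl
  · intro h
    refine ⟨(y, x), (LinearPMap.mem_graph_iff _).2 ⟨⟨y, trivial⟩, rfl, h⟩, rfl⟩

end PositiveSqrt

/-! ### Forms of closed operators and closability of their sums -/

section ExtendZero

variable {H H' : Type*} [NormedAddCommGroup H] [InnerProductSpace ℂ H]
  [NormedAddCommGroup H'] [InnerProductSpace ℂ H']

theorem extendZero_eq {S : H →ₗ.[ℂ] H'} {x : H} {y : H'} (h : (x, y) ∈ S.graph) :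
    extendZero S x = y := by
  obtain ⟨z, hz1, hz2⟩ := (LinearPMap.mem_graph_iff _).1 h
  simp only at hz1 hz2
  subst hz1
  rw [extendZero, dif_pos z.2]
  exact hz2

theorem mem_graph_extendZero {S : H →ₗ.[ℂ] H'} {x : H} (h : x ∈ S.domain) :
    (x, extendZero S x) ∈ S.graph := by
  rw [extendZero, dif_pos h]
  exact S.mem_graph ⟨x, h⟩

theorem ofOp_quad (S : H →ₗ.[ℂ] H') (x : H) : (QForm.ofOp S).quad x = ‖extendZero S x‖ ^ 2 := by
  show (⟪extendZero S x, extendZero S x⟫_ℂ).re = _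
  rw [inner_self_eq_norm_sq_to_K]
  simp [← Complex.ofReal_pow]

theorem const_quad (c : ℝ) (x : H) : (QForm.const H c).quad x = c * ‖x‖ ^ 2 := by
  show ((c : ℂ) * ⟪x, x⟫_ℂ).re = _
  rw [inner_self_eq_norm_sq_to_K]
  simp [← Complex.ofReal_pow]

theorem add_quad (q q' : QForm H) (x : H) : (q.add q').quad x = q.quad x + q'.quad x :=
  Complex.add_re _ _

theorem extendZero_sub {S : H →ₗ.[ℂ] H'} {x y : H} (hx : x ∈ S.domain) (hy : y ∈ S.domain) :
    extendZero S (x - y) = extendZero S x - extendZero S y :=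
  extendZero_eq (S.graph.sub_mem (mem_graph_extendZero hx) (mem_graph_extendZero hy))

/-- The images form a Cauchy sequence, and a closed operator cannot send a null sequence to a
nonzero limit. -/
theorem tendsto_extendZero_of_closed [CompleteSpace H'] {S : H →ₗ.[ℂ] H'} (hS : S.IsClosed)
    {Ψ : ℕ → H} (hΨ : ∀ n, Ψ n ∈ S.domain) (h0 : Filter.Tendsto Ψ Filter.atTop (nhds 0))
    (hc : Filter.Tendsto (fun nm : ℕ × ℕ => ‖extendZero S (Ψ nm.1 - Ψ nm.2)‖ ^ 2) Filter.atTop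
      (nhds 0)) :
    Filter.Tendsto (fun n => ‖extendZero S (Ψ n)‖ ^ 2) Filter.atTop (nhds 0) := by
  have hcau : CauchySeq fun n => extendZero S (Ψ n) := by
    rw [cauchySeq_iff_tendsto_dist_atTop_0]
    have h := hc.sqrt
    rw [Real.sqrt_zero] at h
    refine h.congr fun nm => ?_
    rw [Real.sqrt_sq (norm_nonneg _), extendZero_sub (hΨ _) (hΨ _), dist_eq_norm]
  obtain ⟨y, hy⟩ := cauchySeq_tendsto_of_complete hcau
  have hmem : ((0 : H), y) ∈ S.graph :=
    IsClosed.mem_of_tendsto hS (h0.prodMk_nhds hy)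
      (Filter.Eventually.of_forall fun n => mem_graph_extendZero (hΨ n))
  have hy0 : y = 0 := S.graph_fst_eq_zero_snd hmem rfl
  rw [hy0] at hy
  simpa using (hy.norm.pow 2)

/-- The sum of two forms `‖S₁Ψ‖²`, `‖S₂Ψ‖²` of closed operators, shifted by a constant, is
closable on every subspace of the form domain. -/
theorem closableOn_ofOp_add_const_add_ofOp {H₁ H₂ : Type*} [NormedAddCommGroup H₁]
    [InnerProductSpace ℂ H₁] [CompleteSpace H₁] [NormedAddCommGroup H₂] [InnerProductSpace ℂ H₂]
    [CompleteSpace H₂] {S₁ : H →ₗ.[ℂ] H₁} {S₂ : H →ₗ.[ℂ] H₂} (h₁ : S₁.IsClosed)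
    (h₂ : S₂.IsClosed) (c : ℝ) {D : Submodule ℂ H} (hD₁ : D ≤ S₁.domain) (hD₂ : D ≤ S₂.domain) :
    (((QForm.ofOp S₁).add (QForm.const H c)).add (QForm.ofOp S₂)).ClosableOn D := by
  intro Ψ hΨ h0 hc
  simp only [add_quad, ofOp_quad, const_quad] at hc ⊢
  have hn : Filter.Tendsto (fun n => c * ‖Ψ n‖ ^ 2) Filter.atTop (nhds 0) := by
    simpa using (h0.norm.pow 2).const_mul c
  have hnm : Filter.Tendsto (fun nm : ℕ × ℕ => c * ‖Ψ nm.1 - Ψ nm.2‖ ^ 2) Filter.atTop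
      (nhds 0) := by
    have h1 : Filter.Tendsto (fun nm : ℕ × ℕ => Ψ nm.1 - Ψ nm.2) Filter.atTop (nhds (0 - 0)) := by
      rw [← Filter.prod_atTop_atTop_eq]
      exact (h0.comp Filter.tendsto_fst).sub (h0.comp Filter.tendsto_snd)
    simpa using (h1.norm.pow 2).const_mul c
  -- Without the constant term the form is a sum of two squares, and each of them is dominated by
  -- the sum.
  have hs := hc.sub hnm
  rw [sub_zero] at hs
  have t₁ := tendsto_extendZero_of_closed h₁ (fun n => hD₁ (hΨ n)) h0
    (squeeze_zero (fun _ => sq_nonneg _)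
      (fun nm => by
        have := sq_nonneg ‖extendZero S₂ (Ψ nm.1 - Ψ nm.2)‖
        linarith) hs)
  have t₂ := tendsto_extendZero_of_closed h₂ (fun n => hD₂ (hΨ n)) h0
    (squeeze_zero (fun _ => sq_nonneg _)
      (fun nm => by
        have := sq_nonneg ‖extendZero S₁ (Ψ nm.1 - Ψ nm.2)‖
        linarith) hs)
  simpa using (t₁.add hn).add t₂

end ExtendZero

/-! ### The operator `R^{-1/4}` -/

section FourthRoot

variable {H : Type*} [NormedAddCommGroup H] [InnerProductSpace ℂ H] [CompleteSpace H]
  {R : H →L[ℂ] H}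

theorem fourthRoot_injective (hR : 0 ≤ R) (hi : Function.Injective R) :
    Function.Injective (opSqrt (opSqrt R)) :=
  opSqrt_injective (opSqrt_nonneg R) (opSqrt_injective hR hi)

theorem mem_graph_fourthRootInv (hR : 0 ≤ R) (hi : Function.Injective R) (x y : H) :
    (x, y) ∈ (fourthRootInv R).graph ↔ opSqrt (opSqrt R) y = x :=
  mem_graph_inverse_toPMap (fourthRoot_injective hR hi) x y

theorem fourthRootInv_isClosed (hR : 0 ≤ R) (hi : Function.Injective R) :
    (fourthRootInv R).IsClosed := by
  have h : ((fourthRootInv R).graph : Set (H × H)) =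
      {p | (opSqrt (opSqrt R)) p.2 = p.1} := by
    ext p
    exact mem_graph_fourthRootInv hR hi p.1 p.2
  show IsClosed ((fourthRootInv R).graph : Set (H × H))
  rw [h]
  exact isClosed_eq ((ContinuousLinearMap.continuous _).comp continuous_snd) continuous_fst

/-- Since `R^{1/2} z = R^{1/4} (R^{1/4} z)`, the range of `R^{1/2}` lies in the domain of
`R^{-1/4}`. This is how vectors of the closed form domain become vectors of finite kinetic energy.
-/
theorem sqrt_apply_mem_graph_fourthRootInv (hR : 0 ≤ R) (hi : Function.Injective R) (z : H) :
    (opSqrt R z, opSqrt (opSqrt R) z) ∈ (fourthRootInv R).graph :=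
  (mem_graph_fourthRootInv hR hi _ _).2 (opSqrt_apply_opSqrt_apply (opSqrt_nonneg R) z)

end FourthRoot

/-! ### The isometry onto the closed form domain -/

section FormIso

variable {H H' : Type*} [NormedAddCommGroup H] [InnerProductSpace ℂ H] [CompleteSpace H]
  [NormedAddCommGroup H'] [InnerProductSpace ℂ H'] [CompleteSpace H']

/-- The isometry from `H` onto a subspace of the closure of `G` which sends `z` to the vector with
first component `m R^{1/2} z`, where `R` is the massive resolvent. -/
def formIso (m : ℝ) (G : Submodule ℂ (WithLp 2 (H × H'))) : H →L[ℂ] WithLp 2 (H × H') :=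
  LinearMap.extendOfNorm ((m : ℂ)⁻¹ • (projInl G).toLinearMap)
    (opSqrt (massResolvent m G)).toLinearMap

variable {G : Submodule ℂ (WithLp 2 (H × H'))} {m : ℝ}

/-- Both squares equal `m² ⟪u, R u⟫`. This makes `formIso` well defined and isometric. -/
theorem norm_projInl (hm : 0 < m) (u : H) :
    ‖projInl G u‖ = m * ‖opSqrt (massResolvent m G) u‖ := by
  have h := inner_massResolvent (m := m) (G := G) u u
  rw [← inner_opSqrt_opSqrt massResolvent_nonneg, inner_self_eq_norm_sq_to_K,
    inner_self_eq_norm_sq_to_K] at h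
  have h2 : ‖opSqrt (massResolvent m G) u‖ ^ 2 = (m ^ 2)⁻¹ * ‖projInl G u‖ ^ 2 := by
    apply Complex.ofReal_injective
    push_cast
    exact h
  have h3 : ‖projInl G u‖ ^ 2 = (m * ‖opSqrt (massResolvent m G) u‖) ^ 2 := by
    rw [mul_pow, h2]
    field_simp
  exact (pow_left_inj₀ (norm_nonneg _) (by positivity) two_ne_zero).1 h3

section

variable (hm : 0 < m)
  (hG : Dense ((G.map (WithLp.fstL 2 ℂ H H').toLinearMap : Submodule ℂ H) : Set H))
include hm hG

theorem denseRange_sqrt_massResolvent :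
    DenseRange (opSqrt (massResolvent m G)) :=
  denseRange_of_injective_of_nonneg (opSqrt_nonneg _)
    (opSqrt_injective massResolvent_nonneg (massResolvent_injective hm.ne' hG))

theorem formIso_sqrt (u : H) :
    formIso m G (opSqrt (massResolvent m G) u) = (m : ℂ)⁻¹ • projInl G u := by
  refine LinearMap.extendOfNorm_eq (f := (m : ℂ)⁻¹ • (projInl G).toLinearMap)
    (denseRange_sqrt_massResolvent hm hG) ⟨1, fun x => ?_⟩ u
  show ‖(m : ℂ)⁻¹ • projInl G x‖ ≤ 1 * ‖opSqrt (massResolvent m G) x‖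
  rw [norm_smul, norm_projInl hm, norm_inv, Complex.norm_real, Real.norm_of_nonneg hm.le, one_mul,
    inv_mul_cancel_left₀ hm.ne']

theorem norm_formIso (z : H) : ‖formIso m G z‖ = ‖z‖ := by
  refine (denseRange_sqrt_massResolvent hm hG).induction_on
    (p := fun z => ‖formIso m G z‖ = ‖z‖) z (isClosed_eq (by fun_prop) (by fun_prop)) fun u => ?_
  rw [formIso_sqrt hm hG, norm_smul, norm_projInl hm, norm_inv, Complex.norm_real,
    Real.norm_of_nonneg hm.le, inv_mul_cancel_left₀ hm.ne']

theorem formIso_mem (z : H) : formIso m G z ∈ G.topologicalClosure := by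
  refine (denseRange_sqrt_massResolvent hm hG).induction_on
    (p := fun z => formIso m G z ∈ G.topologicalClosure) z
    (G.isClosed_topologicalClosure.preimage (formIso m G).continuous) fun u => ?_
  rw [formIso_sqrt hm hG]
  exact Submodule.smul_mem _ _ (projInl_mem u)

theorem formIso_fst (z : H) :
    (formIso m G z).fst = (m : ℂ) • opSqrt (massResolvent m G) z := by
  refine (denseRange_sqrt_massResolvent hm hG).induction_on
    (p := fun z => (formIso m G z).fst = (m : ℂ) • opSqrt (massResolvent m G) z) z
    (isClosed_eq ((WithLp.fstL 2 ℂ H H').continuous.comp (formIso m G).continuous)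
      (by fun_prop)) fun u => ?_
  rw [formIso_sqrt hm hG, opSqrt_apply_opSqrt_apply massResolvent_nonneg, massResolvent_apply,
    smul_smul, WithLp.smul_fst]
  congr 1
  have : (m : ℂ) ≠ 0 := by exact_mod_cast hm.ne'
  field_simp

/-- Paired with `u`, the left side is `⟪Θ R^{1/2} u, g⟫ = m⁻¹ ⟪P (u, 0), g⟫ = m⁻¹ ⟪u, g.fst⟫` with
`Θ = formIso m G`. So every `m⁻¹ g.fst` with `g` in the closure of `G` lies in the range of
`R^{1/2}`, with the explicit preimage `Θ* g`. -/
theorem sqrt_adjoint_formIso {g : WithLp 2 (H × H')} (hg : g ∈ G.topologicalClosure) :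
    opSqrt (massResolvent m G) ((formIso m G).adjoint g) = (m : ℂ)⁻¹ • g.fst := by
  refine ext_inner_left ℂ fun u => ?_
  have h : ⟪u, opSqrt (massResolvent m G) ((formIso m G).adjoint g)⟫_ℂ =
      ⟪opSqrt (massResolvent m G) u, (formIso m G).adjoint g⟫_ℂ :=
    (inner_left_eq_right_of_nonneg (opSqrt_nonneg (massResolvent m G)) _ _).symm
  rw [h, ContinuousLinearMap.adjoint_inner_right,
    formIso_sqrt hm hG, inner_smul_left, inner_projInl hg, inner_smul_right]
  simp

theorem norm_adjoint_formIso_le (g : WithLp 2 (H × H')) : ‖(formIso m G).adjoint g‖ ≤ ‖g‖ := by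
  have h1 : ‖(formIso m G).adjoint‖ ≤ 1 := by
    rw [LinearIsometryEquiv.norm_map]
    exact ContinuousLinearMap.opNorm_le_bound _ zero_le_one fun z => by
      rw [norm_formIso hm hG, one_mul]
  simpa using (ContinuousLinearMap.le_opNorm _ g).trans
    (mul_le_mul_of_nonneg_right h1 (norm_nonneg g))

/-- Vectors of the closed form domain belong to the domain of the fourth root. -/
theorem mem_graph_fourthRootInv_of_mem_closure {g : WithLp 2 (H × H')}
    (hg : g ∈ G.topologicalClosure) :
    ((m : ℂ)⁻¹ • g.fst,
      opSqrt (opSqrt (massResolvent m G)) ((formIso m G).adjoint g)) ∈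
      (fourthRootInv (massResolvent m G)).graph := by
  rw [← sqrt_adjoint_formIso hm hG hg]
  exact sqrt_apply_mem_graph_fourthRootInv massResolvent_nonneg
    (massResolvent_injective hm.ne' hG) _

end

end FormIso

/-! ### Operator concavity of the square root -/

section Concavity

variable {H H' : Type*} [NormedAddCommGroup H] [InnerProductSpace ℂ H] [CompleteSpace H]
  [NormedAddCommGroup H'] [InnerProductSpace ℂ H'] [CompleteSpace H']
  {G : Submodule ℂ (WithLp 2 (H × H'))} {m : ℝ}

theorem map_mem_topologicalClosure {E F : Type*} [NormedAddCommGroup E] [NormedSpace ℂ E]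
    [NormedAddCommGroup F] [NormedSpace ℂ F] {G : Submodule ℂ E} {G' : Submodule ℂ F}
    (N : E →L[ℂ] F) (h : ∀ g ∈ G, N g ∈ G') {g : E} (hg : g ∈ G.topologicalClosure) :
    N g ∈ G'.topologicalClosure := by
  have h1 : Set.MapsTo N (G : Set E) (G' : Set F) := fun x hx => h x hx
  exact h1.closure N.continuous hg

theorem isUnit_one_add_smul {Q : H →L[ℂ] H} (hQ : 0 ≤ Q) {κ : ℝ} (hκ : 0 ≤ κ) :
    IsUnit (1 + (κ : ℂ) • Q) := by
  have h : (0 : H →L[ℂ] H) ≤ (κ : ℂ) • Q := by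
    rw [ContinuousLinearMap.nonneg_iff_isPositive] at hQ ⊢
    exact hQ.smul_of_nonneg (by exact_mod_cast hκ)
  exact CStarAlgebra.isUnit_of_le (1 : H →L[ℂ] H) (le_add_of_nonneg_right h)

/-- The bound `D ≥ m`, written as `m D⁻² ≤ D⁻¹`. First, `m ‖Q w‖ ≤ ‖w‖` because `m Q w` is a
component of the isometric image of `w`; then take `w = Q^{1/2} z`. -/
theorem norm_sqrt_massResolvent_sq_le (hm : 0 < m)
    (hG : Dense ((G.map (WithLp.fstL 2 ℂ H H').toLinearMap : Submodule ℂ H) : Set H)) (z : H) :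
    m * ‖opSqrt (massResolvent m G) z‖ ^ 2 ≤ (⟪z, opSqrt (massResolvent m G) z⟫_ℂ).re := by
  set Q := opSqrt (massResolvent m G) with hQ
  have hQ0 : 0 ≤ Q := opSqrt_nonneg _
  have hbd : ∀ w, m * ‖Q w‖ ≤ ‖w‖ := by
    intro w
    have h1 : ‖(formIso m G w).fst‖ ≤ ‖formIso m G w‖ := by
      have h3 := WithLp.prod_norm_sq_eq_of_L2 (formIso m G w)
      nlinarith [norm_nonneg (formIso m G w).fst, norm_nonneg (formIso m G w).snd,
        norm_nonneg (formIso m G w)]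
    rw [norm_formIso hm hG, formIso_fst hm hG, norm_smul, Complex.norm_real,
      Real.norm_of_nonneg hm.le] at h1
    exact h1
  set B := opSqrt Q with hB
  have h1 : (⟪z, Q z⟫_ℂ).re = ‖B z‖ ^ 2 := by
    rw [← inner_opSqrt_opSqrt hQ0, inner_self_eq_norm_sq_to_K]
    simp [← Complex.ofReal_pow, hB]
  have h2 : ‖Q z‖ ^ 2 = (⟪B z, Q (B z)⟫_ℂ).re := by
    have h3 : Q (B z) = B (Q z) := by
      rw [← opSqrt_apply_opSqrt_apply hQ0, ← opSqrt_apply_opSqrt_apply hQ0 z]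
    rw [h3, inner_opSqrt_opSqrt hQ0, ← inner_left_eq_right_of_nonneg hQ0,
      inner_self_eq_norm_sq_to_K]
    simp [← Complex.ofReal_pow]
  rw [h1, h2]
  have h4 : (⟪B z, Q (B z)⟫_ℂ).re ≤ ‖B z‖ * ‖Q (B z)‖ :=
    (Complex.re_le_norm _).trans (norm_inner_le_norm _ _)
  nlinarith [hbd (B z), norm_nonneg (B z)]

/-- Let `A` be the operator of the form `‖g‖²` on the closure of `G`.  If the conjugations of `A` with
the unitary operators `Mp`, `Mm = Mp*` satisfy `Mm A Mp + Mp A Mm ≤ 2 (A + s)` and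
`(κ + m)² = s + m²`, then `Mm √A Mp + Mp √A Mm ≤ 2 (√A + κ)`. -/
theorem fourthRootInv_conj_le (hm : 0 < m)
    (hG : Dense ((G.map (WithLp.fstL 2 ℂ H H').toLinearMap : Submodule ℂ H) : Set H))
    {Mp Mm : H →L[ℂ] H} (hadj : ∀ x y, ⟪Mp x, y⟫_ℂ = ⟪x, Mm y⟫_ℂ)
    (hMp : ∀ x, ‖Mp x‖ = ‖x‖) (hMm : ∀ x, ‖Mm x‖ = ‖x‖)
    {Np Nm : WithLp 2 (H × H') →L[ℂ] WithLp 2 (H × H')}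
    (hNp : ∀ g ∈ G, Np g ∈ G) (hNm : ∀ g ∈ G, Nm g ∈ G)
    (hNp1 : ∀ g, (Np g).fst = Mp g.fst) (hNm1 : ∀ g, (Nm g).fst = Mm g.fst)
    {s κ : ℝ} (hκ : 0 ≤ κ) (hκs : (κ + m) ^ 2 = s + m ^ 2)
    (hpar : ∀ g, ‖Np g‖ ^ 2 + ‖Nm g‖ ^ 2 ≤ 2 * ‖g‖ ^ 2 + 2 * s * ‖(m : ℂ)⁻¹ • g.fst‖ ^ 2)
    {g : WithLp 2 (H × H')} (hg : g ∈ G.topologicalClosure) :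
    1 / 2 * (‖extendZero (fourthRootInv (massResolvent m G)) (Mp ((m : ℂ)⁻¹ • g.fst))‖ ^ 2 +
      ‖extendZero (fourthRootInv (massResolvent m G)) (Mm ((m : ℂ)⁻¹ • g.fst))‖ ^ 2) ≤
      ‖extendZero (fourthRootInv (massResolvent m G)) ((m : ℂ)⁻¹ • g.fst)‖ ^ 2 +
        κ * ‖(m : ℂ)⁻¹ • g.fst‖ ^ 2 := by
  set R := massResolvent m G with hR
  set Q := opSqrt R with hQ
  set Θ := formIso m G with hΘ
  have hQ0 : 0 ≤ Q := opSqrt_nonneg _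
  have hRi : Function.Injective R := massResolvent_injective hm.ne' hG
  have hR0 : 0 ≤ R := massResolvent_nonneg
  have hmC : (m : ℂ) ≠ 0 := by exact_mod_cast hm.ne'
  -- As `Q = (√A)⁻¹`, these are the bounded operators `√A Mp (√A)⁻¹` and `√A Mm (√A)⁻¹`. They exist
  -- because `Np` and `Nm` preserve the closed form domain.
  set Zp : H →L[ℂ] H := Θ.adjoint.comp (Np.comp Θ) with hZp
  set Zm : H →L[ℂ] H := Θ.adjoint.comp (Nm.comp Θ) with hZm
  have hQZp : ∀ z, Q (Zp z) = Mp (Q z) := by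
    intro z
    have h1 := sqrt_adjoint_formIso hm hG (map_mem_topologicalClosure Np hNp (formIso_mem hm hG z))
    rw [hNp1, formIso_fst hm hG, map_smul, smul_smul, inv_mul_cancel₀ hmC, one_smul] at h1
    exact h1
  have hQZm : ∀ z, Q (Zm z) = Mm (Q z) := by
    intro z
    have h1 := sqrt_adjoint_formIso hm hG (map_mem_topologicalClosure Nm hNm (formIso_mem hm hG z))
    rw [hNm1, formIso_fst hm hG, map_smul, smul_smul, inv_mul_cancel₀ hmC, one_smul] at h1
    exact h1
  have hadj' : ∀ x y, ⟪Mm x, y⟫_ℂ = ⟪x, Mp y⟫_ℂ := by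
    intro x y
    rw [← inner_conj_symm, ← hadj, inner_conj_symm]
  have hQsymm := fun x y => inner_left_eq_right_of_nonneg hQ0 x y
  -- `X` is the average of `Mm √A Mp` and `Mp √A Mm`, multiplied on the right by `(√A)⁻¹`. The goal
  -- becomes `Re ⟪Q z, X z⟫ ≤ Re ⟪Q z, (1 + κ Q) z⟫`.
  set X : H →L[ℂ] H := (2 : ℂ)⁻¹ • (Mm.comp Zp + Mp.comp Zm) with hX
  have hXsymm : ∀ a b, ⟪X a, Q b⟫_ℂ = ⟪Q a, X b⟫_ℂ := by
    intro a b
    simp only [hX, smul_apply, add_apply,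
      ContinuousLinearMap.comp_apply, inner_smul_left, inner_smul_right, inner_add_left,
      inner_add_right]
    rw [hadj', hadj, ← hQZp, ← hQZm, ← hadj, ← hadj', ← hQZp, ← hQZm, hQsymm, hQsymm]
    simp [show (starRingEnd ℂ) 2 = 2 from Complex.conj_ofNat 2]
  -- Division by `√A + κ`: with `E = (1 + κ Q)⁻¹`, the operator `S = Q E` is `(√A + κ)⁻¹`, and `W =
  -- X E` is symmetric for `⟪x, S y⟫`. Each identity is checked on vectors `z + κ Q z`, which
  -- exhaust `H`.
  obtain ⟨D, hD⟩ := isUnit_one_add_smul hQ0 hκ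
  set E : H →L[ℂ] H := (D⁻¹ : (H →L[ℂ] H)ˣ).val with hE
  have hED : ∀ z, E (z + (κ : ℂ) • Q z) = z := by
    intro z
    have h1 : (E * D.val) z = z := by rw [hE, Units.inv_mul]; rfl
    rw [hD] at h1
    exact h1
  have hDsurj : ∀ v, ∃ z, v = z + (κ : ℂ) • Q z := by
    intro v
    refine ⟨E v, ?_⟩
    have h1 : (D.val * E) v = v := by rw [hE, Units.mul_inv]; rfl
    rw [hD] at h1
    exact h1.symm
  set S : H →L[ℂ] H := Q.comp E with hS
  set W : H →L[ℂ] H := X.comp E with hW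
  have hSz : ∀ z, S (z + (κ : ℂ) • Q z) = Q z := fun z => by
    rw [hS, ContinuousLinearMap.comp_apply, hED]
  have hWz : ∀ z, W (z + (κ : ℂ) • Q z) = X z := fun z => by
    rw [hW, ContinuousLinearMap.comp_apply, hED]
  have hQre : ∀ z, ⟪z, Q z⟫_ℂ = ((‖opSqrt Q z‖ ^ 2 : ℝ) : ℂ) := by
    intro z
    rw [← inner_opSqrt_opSqrt hQ0, inner_self_eq_norm_sq_to_K]
    simp
  have hQQ : ∀ z, ⟪Q z, Q z⟫_ℂ = ((‖Q z‖ ^ 2 : ℝ) : ℂ) := by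
    intro z
    rw [inner_self_eq_norm_sq_to_K]
    simp
  have hS0 : 0 ≤ S := by
    rw [ContinuousLinearMap.nonneg_iff_isPositive, ContinuousLinearMap.isPositive_iff_complex]
    intro v
    obtain ⟨z, rfl⟩ := hDsurj v
    have h1 : ⟪S (z + (κ : ℂ) • Q z), z + (κ : ℂ) • Q z⟫_ℂ =
        ((‖opSqrt Q z‖ ^ 2 + κ * ‖Q z‖ ^ 2 : ℝ) : ℂ) := by
      rw [hSz, inner_add_right, inner_smul_right, hQQ, hQsymm, hQre]
      push_cast
      ring
    rw [h1, RCLike.re_eq_complex_re, Complex.ofReal_re]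
    exact ⟨rfl, by positivity⟩
  have hSsymm := fun x y => inner_left_eq_right_of_nonneg hS0 x y
  have hSW : ∀ x y, ⟪W x, S y⟫_ℂ = ⟪x, S (W y)⟫_ℂ := by
    intro x y
    obtain ⟨a, rfl⟩ := hDsurj x
    obtain ⟨b, rfl⟩ := hDsurj y
    rw [← hSsymm (a + (κ : ℂ) • Q a), hWz, hWz, hSz, hSz, hXsymm]
  -- The comparison of squares: `‖X z‖² ≤ ‖z‖² + s ‖Q z‖² ≤ ‖z + κ Q z‖²`. The last inequality uses
  -- `s = κ² + 2κm` and `m ‖Q z‖² ≤ ⟪z, Q z⟫`.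
  have hWle : ∀ v, ‖W v‖ ≤ ‖v‖ := by
    intro v
    obtain ⟨z, rfl⟩ := hDsurj v
    rw [hWz]
    have h1 : ‖Zp z‖ ^ 2 + ‖Zm z‖ ^ 2 ≤ 2 * ‖z‖ ^ 2 + 2 * s * ‖Q z‖ ^ 2 := by
      have h2 : ‖Zp z‖ ≤ ‖Np (Θ z)‖ := norm_adjoint_formIso_le hm hG _
      have h3 : ‖Zm z‖ ≤ ‖Nm (Θ z)‖ := norm_adjoint_formIso_le hm hG _
      have h4 := hpar (Θ z)
      rw [norm_formIso hm hG, formIso_fst hm hG, smul_smul, inv_mul_cancel₀ hmC, one_smul] at h4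
      have h5 := pow_le_pow_left₀ (norm_nonneg _) h2 2
      have h6 := pow_le_pow_left₀ (norm_nonneg _) h3 2
      linarith
    have h2 : ‖X z‖ ^ 2 ≤ 1 / 2 * (‖Zp z‖ ^ 2 + ‖Zm z‖ ^ 2) := by
      have h3 : ‖X z‖ ≤ 2⁻¹ * (‖Zp z‖ + ‖Zm z‖) := by
        have h4 : X z = (2 : ℂ)⁻¹ • (Mm (Zp z) + Mp (Zm z)) := rfl
        rw [h4, norm_smul, ← hMm (Zp z), ← hMp (Zm z)]
        have h5 : ‖(2 : ℂ)⁻¹‖ = 2⁻¹ := by simp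
        rw [h5]
        exact mul_le_mul_of_nonneg_left (norm_add_le _ _) (by norm_num)
      have h6 := pow_le_pow_left₀ (norm_nonneg _) h3 2
      nlinarith [sq_nonneg (‖Zp z‖ - ‖Zm z‖)]
    have h3 : ‖z + (κ : ℂ) • Q z‖ ^ 2 =
        ‖z‖ ^ 2 + 2 * κ * (⟪z, Q z⟫_ℂ).re + κ ^ 2 * ‖Q z‖ ^ 2 := by
      rw [@norm_add_sq ℂ, inner_smul_right, norm_smul, Complex.norm_real, mul_pow,
        Real.norm_eq_abs, sq_abs, RCLike.re_eq_complex_re, Complex.re_ofReal_mul]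
      ring
    have h4 := norm_sqrt_massResolvent_sq_le hm hG z
    have h5 : s = κ ^ 2 + 2 * κ * m := by linarith [hκs, add_sq κ m]
    have h6 : ‖X z‖ ^ 2 ≤ ‖z + (κ : ℂ) • Q z‖ ^ 2 := by
      rw [h3]
      have h7 : 2 * κ * (m * ‖Q z‖ ^ 2) ≤ 2 * κ * (⟪z, Q z⟫_ℂ).re :=
        mul_le_mul_of_nonneg_left h4 (by positivity)
      have h8 : s * ‖Q z‖ ^ 2 = κ ^ 2 * ‖Q z‖ ^ 2 + 2 * κ * (m * ‖Q z‖ ^ 2) := by rw [h5]; ring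
      linarith
    exact (pow_le_pow_iff_left₀ (norm_nonneg _) (norm_nonneg _) two_ne_zero).1 h6
  set z := Θ.adjoint g with hz
  have hφ : (m : ℂ)⁻¹ • g.fst = Q z := (sqrt_adjoint_formIso hm hG hg).symm
  have hB : ∀ w, ‖extendZero (fourthRootInv R) (Q w)‖ ^ 2 = (⟪w, Q w⟫_ℂ).re := by
    intro w
    rw [extendZero_eq (sqrt_apply_mem_graph_fourthRootInv hR0 hRi w), hQre, Complex.ofReal_re]
  have hK := re_inner_symmetrizable_le hS0 hWle hSW (z + (κ : ℂ) • Q z)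
  rw [hφ, ← hQZp, ← hQZm, hB, hB, hB]
  rw [← hSsymm, hWz, ← hSsymm, hSz] at hK
  have h1 : (⟪Q z, X z⟫_ℂ).re = 1 / 2 * ((⟪Zp z, Q (Zp z)⟫_ℂ).re + (⟪Zm z, Q (Zm z)⟫_ℂ).re) := by
    have h2 : ⟪Q z, X z⟫_ℂ = ((1 / 2 : ℝ) : ℂ) * (⟪Zp z, Q (Zp z)⟫_ℂ + ⟪Zm z, Q (Zm z)⟫_ℂ) := by
      simp only [hX, smul_apply, add_apply,
        ContinuousLinearMap.comp_apply, inner_smul_right, inner_add_right]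
      rw [← hadj, ← hadj', ← hQZp, ← hQZm, hQsymm, hQsymm]
      simp
    rw [h2, Complex.re_ofReal_mul, Complex.add_re]
  have h2 : (⟪Q z, z + (κ : ℂ) • Q z⟫_ℂ).re = (⟪z, Q z⟫_ℂ).re + κ * ‖Q z‖ ^ 2 := by
    rw [inner_add_right, inner_smul_right, hQQ, hQsymm, Complex.add_re, Complex.re_ofReal_mul,
      Complex.ofReal_re]
  rw [h1, h2] at hK
  exact hK

end Concavity

/-! ### Operators commuting with the resolvent -/

section Commutation

variable {H H' : Type*} [NormedAddCommGroup H] [InnerProductSpace ℂ H] [CompleteSpace H]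
  [NormedAddCommGroup H'] [InnerProductSpace ℂ H'] [CompleteSpace H']
  {G : Submodule ℂ (WithLp 2 (H × H'))} {m : ℝ}

/-- The operator `T ⊕ N` and its adjoint `T' ⊕ N'` both preserve the closure of `G`, hence `T ⊕ N`
commutes with the orthogonal projection. -/
theorem commute_massResolvent {T T' : H →L[ℂ] H} (hT : ∀ x y, ⟪T x, y⟫_ℂ = ⟪x, T' y⟫_ℂ)
    {N N' : H' →L[ℂ] H'} (hN : ∀ x y, ⟪N x, y⟫_ℂ = ⟪x, N' y⟫_ℂ)
    (hG : ∀ g ∈ G, WithLp.toLp 2 (T g.fst, N g.snd) ∈ G)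
    (hG' : ∀ g ∈ G, WithLp.toLp 2 (T' g.fst, N' g.snd) ∈ G) :
    Commute (massResolvent m G) T := by
  let e := WithLp.prodContinuousLinearEquiv 2 ℂ H H'
  let A : WithLp 2 (H × H') →L[ℂ] WithLp 2 (H × H') :=
    e.symm.toContinuousLinearMap.comp ((T.prodMap N).comp e.toContinuousLinearMap)
  let A' : WithLp 2 (H × H') →L[ℂ] WithLp 2 (H × H') :=
    e.symm.toContinuousLinearMap.comp ((T'.prodMap N').comp e.toContinuousLinearMap)
  have hA : ∀ g, A g = WithLp.toLp 2 (T g.fst, N g.snd) := fun g => rfl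
  have hA' : ∀ g, A' g = WithLp.toLp 2 (T' g.fst, N' g.snd) := fun g => rfl
  have key : ∀ u, projInl G (T u) = A (projInl G u) := by
    intro u
    show G.topologicalClosure.starProjection (WithLp.toLp 2 (T u, (0 : H'))) = _
    refine Submodule.eq_starProjection_of_mem_of_inner_eq_zero
      (map_mem_topologicalClosure A (fun g hg => hG g hg) (projInl_mem u)) fun w hw => ?_
    have h1 : ∀ x y, ⟪A x, y⟫_ℂ = ⟪x, A' y⟫_ℂ := by
      intro x y
      rw [hA, hA', WithLp.prod_inner_apply, WithLp.prod_inner_apply]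
      exact congrArg₂ (· + ·) (hT _ _) (hN _ _)
    have h2 : A' w ∈ G.topologicalClosure :=
      map_mem_topologicalClosure A' (fun g hg => hG' g hg) hw
    rw [inner_sub_left, h1, inner_projInl h2, WithLp.prod_inner_apply]
    show ⟪T u, w.fst⟫_ℂ + ⟪(0 : H'), w.snd⟫_ℂ - ⟪u, T' w.fst⟫_ℂ = 0
    rw [inner_zero_left, hT, add_zero, sub_self]
  refine ContinuousLinearMap.ext fun u => ?_
  show massResolvent m G (T u) = T (massResolvent m G u)
  rw [massResolvent_apply, massResolvent_apply, key, map_smul]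
  rfl

/-- By functional calculus `T` commutes with `R^{1/4}`, so applying `T` to `R^{1/4} y = x` gives
`R^{1/4} (T y) = T x`. -/
theorem extendZero_fourthRootInv_of_commute {R T : H →L[ℂ] H} (hR : 0 ≤ R)
    (hi : Function.Injective R) (h : Commute R T) {x : H} (hx : x ∈ (fourthRootInv R).domain) :
    T x ∈ (fourthRootInv R).domain ∧
      extendZero (fourthRootInv R) (T x) = T (extendZero (fourthRootInv R) x) := by
  have h1 := (mem_graph_fourthRootInv hR hi _ _).1 (mem_graph_extendZero hx)
  have h2 : Commute (opSqrt (opSqrt R)) T := commute_opSqrt (commute_opSqrt h)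
  have h3 : (T x, T (extendZero (fourthRootInv R) x)) ∈ (fourthRootInv R).graph := by
    rw [mem_graph_fourthRootInv hR hi]
    have h4 := congrArg (fun B : H →L[ℂ] H => B (extendZero (fourthRootInv R) x)) h2.eq
    exact h4.trans (congrArg T h1)
  exact ⟨LinearPMap.mem_domain_of_mem_graph h3, extendZero_eq h3⟩

end Commutation

end SRPF

namespace SRPF

/-! ### Shortcut instances -/

abbrev fockNormedAddCommGroup : NormedAddCommGroup Fock := inferInstance
abbrev fockInnerProductSpace : InnerProductSpace ℂ Fock := inferInstance
theorem completeSpace_fock : CompleteSpace Fock := inferInstance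
abbrev fockTopologicalSpace : TopologicalSpace Fock := inferInstance
abbrev fockAddCommGroup : AddCommGroup Fock := inferInstance
abbrev fockAddCommMonoid : AddCommMonoid Fock := inferInstance
abbrev fockModule : Module ℂ Fock := inferInstance

attribute [local instance] fockNormedAddCommGroup fockInnerProductSpace completeSpace_fock
  fockTopologicalSpace fockAddCommGroup fockAddCommMonoid fockModule

/-! ### Multiplication by bounded functions -/

section MulOp

variable {X : Type*} [MeasurableSpace X] {μ : Measure X} {E : Type*} [NormedAddCommGroup E]
  [InnerProductSpace ℂ E]

/-- Bounded measurable functions. -/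
structure IsMultiplier (θ : X → ℂ) : Prop where
  measurable : Measurable θ
  bdd : ∃ C : ℝ, ∀ x, ‖θ x‖ ≤ C

theorem IsMultiplier.memLp {θ : X → ℂ} (hθ : IsMultiplier θ) {f : X → E} (hf : MemLp f 2 μ) :
    MemLp (fun x => θ x • f x) 2 μ := by
  obtain ⟨C, hC⟩ := hθ.bdd
  refine hf.of_le_mul (c := C) (hθ.measurable.aestronglyMeasurable.smul hf.1)
    (Filter.Eventually.of_forall fun x => ?_)
  rw [norm_smul]
  exact mul_le_mul_of_nonneg_right (hC x) (norm_nonneg _)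

variable (μ E) in
/-- The operator of multiplication by a bounded measurable function. -/
def mulOp {θ : X → ℂ} (hθ : IsMultiplier θ) : Lp E 2 μ →L[ℂ] Lp E 2 μ :=
  LinearMap.mkContinuous
    { toFun := fun F => (hθ.memLp (Lp.memLp F)).toLp _
      map_add' := fun F G => by
        rw [← MemLp.toLp_add]
        refine MemLp.toLp_congr _ _ ?_
        filter_upwards [Lp.coeFn_add F G] with x hx
        simp only [hx, Pi.add_apply, smul_add]
      map_smul' := fun c F => by
        rw [RingHom.id_apply, ← MemLp.toLp_const_smul]
        refine MemLp.toLp_congr _ _ ?_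
        filter_upwards [Lp.coeFn_smul c F] with x hx
        simp only [hx, Pi.smul_apply]
        rw [smul_comm] } hθ.bdd.choose fun F => by
    refine Lp.norm_le_mul_norm_of_ae_le_mul ?_
    filter_upwards [(hθ.memLp (Lp.memLp F)).coeFn_toLp] with x hx
    refine (congrArg norm hx).trans_le ?_
    rw [norm_smul]
    exact mul_le_mul_of_nonneg_right (hθ.bdd.choose_spec x) (norm_nonneg _)

theorem coeFn_mulOp {θ : X → ℂ} (hθ : IsMultiplier θ) (F : Lp E 2 μ) :
    mulOp μ E hθ F =ᵐ[μ] fun x => θ x • F x :=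
  (hθ.memLp (Lp.memLp F)).coeFn_toLp

theorem norm_mulOp_le {θ : X → ℂ} (hθ : IsMultiplier θ) {C : ℝ} (hC : ∀ x, ‖θ x‖ ≤ C)
    (F : Lp E 2 μ) : ‖mulOp μ E hθ F‖ ≤ C * ‖F‖ := by
  refine Lp.norm_le_mul_norm_of_ae_le_mul ?_
  filter_upwards [coeFn_mulOp hθ F] with x hx
  rw [hx, norm_smul]
  exact mul_le_mul_of_nonneg_right (hC x) (norm_nonneg _)

theorem inner_mulOp {θ θ' : X → ℂ} (hθ : IsMultiplier θ) (hθ' : IsMultiplier θ')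
    (h : ∀ x, θ' x = starRingEnd ℂ (θ x)) (F G : Lp E 2 μ) :
    ⟪mulOp μ E hθ F, G⟫_ℂ = ⟪F, mulOp μ E hθ' G⟫_ℂ := by
  rw [L2.inner_def, L2.inner_def]
  refine integral_congr_ae ?_
  filter_upwards [coeFn_mulOp hθ F, coeFn_mulOp hθ' G] with x h1 h2
  rw [h1, h2, inner_smul_left, inner_smul_right, h]

theorem mulOp_one {θ : X → ℂ} (hθ : IsMultiplier θ) (h : ∀ x, θ x = 1) (F : Lp E 2 μ) :
    mulOp μ E hθ F = F := by
  refine Lp.ext ?_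
  filter_upwards [coeFn_mulOp hθ F] with x h1
  rw [h1, h, one_smul]

theorem norm_mulOp_of_norm_eq_one {θ : X → ℂ} (hθ : IsMultiplier θ) (h : ∀ x, ‖θ x‖ = 1)
    (F : Lp E 2 μ) : ‖mulOp μ E hθ F‖ = ‖F‖ := by
  refine le_antisymm ?_ ?_
  · simpa using norm_mulOp_le hθ (fun x => (h x).le) F
  · refine Lp.norm_le_norm_of_ae_le ?_
    filter_upwards [coeFn_mulOp hθ F] with x hx
    rw [hx, norm_smul, h, one_mul]

theorem sub_mulOp {θ θ' θ'' : X → ℂ} (hθ : IsMultiplier θ) (hθ' : IsMultiplier θ')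
    (hθ'' : IsMultiplier θ'') (h : ∀ x, θ x - θ' x = θ'' x) (F : Lp E 2 μ) :
    mulOp μ E hθ F - mulOp μ E hθ' F = mulOp μ E hθ'' F := by
  refine Lp.ext ?_
  filter_upwards [Lp.coeFn_sub (mulOp μ E hθ F) (mulOp μ E hθ' F), coeFn_mulOp hθ F,
    coeFn_mulOp hθ' F, coeFn_mulOp hθ'' F] with x h0 h1 h2 h3
  rw [h0, Pi.sub_apply, h1, h2, h3, ← sub_smul, h]

/-- Dominated convergence for multiplication operators. -/
theorem tendsto_mulOp_zero {ι : Type*} {l : Filter ι} [l.IsCountablyGenerated] {θ : ι → X → ℂ}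
    (hθ : ∀ i, IsMultiplier (θ i)) {C : ℝ} (hC : ∀ i x, ‖θ i x‖ ≤ C)
    (h0 : ∀ x, Filter.Tendsto (fun i => θ i x) l (nhds 0)) (F : Lp E 2 μ) :
    Filter.Tendsto (fun i => mulOp μ E (hθ i) F) l (nhds 0) := by
  have hint : Integrable (fun x => ‖F x‖ ^ 2) μ := (Lp.memLp F).norm.integrable_sq
  have hsq : ∀ i, ‖mulOp μ E (hθ i) F‖ ^ 2 = ∫ x, ‖θ i x‖ ^ 2 * ‖F x‖ ^ 2 ∂μ := by
    intro i
    have h1 : ((‖mulOp μ E (hθ i) F‖ ^ 2 : ℝ) : ℂ) =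
        ((∫ x, ‖θ i x‖ ^ 2 * ‖F x‖ ^ 2 ∂μ : ℝ) : ℂ) := by
      have h2 : ⟪mulOp μ E (hθ i) F, mulOp μ E (hθ i) F⟫_ℂ =
          ((‖mulOp μ E (hθ i) F‖ ^ 2 : ℝ) : ℂ) := by
        rw [inner_self_eq_norm_sq_to_K]; simp
      rw [← h2, L2.inner_def, ← integral_complex_ofReal]
      refine integral_congr_ae ?_
      filter_upwards [coeFn_mulOp (hθ i) F] with x hx
      rw [hx, inner_self_eq_norm_sq_to_K, norm_smul]
      simp [mul_pow]
    exact_mod_cast h1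
  rw [tendsto_zero_iff_norm_tendsto_zero]
  have h2 : Filter.Tendsto (fun i => ‖mulOp μ E (hθ i) F‖ ^ 2) l (nhds 0) := by
    simp_rw [hsq]
    rw [← integral_zero X ℝ (μ := μ)]
    refine tendsto_integral_filter_of_dominated_convergence (fun x => C ^ 2 * ‖F x‖ ^ 2)
      (Filter.Eventually.of_forall fun i => ?_) (Filter.Eventually.of_forall fun i =>
        Filter.Eventually.of_forall fun x => ?_) (hint.const_mul _)
      (Filter.Eventually.of_forall fun x => ?_)
    · exact (((hθ i).measurable.norm.pow_const 2).aestronglyMeasurable).mul hint.1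
    · rw [Real.norm_of_nonneg (by positivity)]
      exact mul_le_mul_of_nonneg_right (pow_le_pow_left₀ (norm_nonneg _) (hC i x) 2)
        (by positivity)
    · simpa using ((h0 x).norm.pow 2).mul_const (‖F x‖ ^ 2)
  have h3 := h2.sqrt
  rw [Real.sqrt_zero] at h3
  exact h3.congr fun i => Real.sqrt_sq (norm_nonneg _)

end MulOp

/-! ### Modulations -/

section Modulation

variable {d : ℕ} {𝒦 : Type*} [NormedAddCommGroup 𝒦] [InnerProductSpace ℂ 𝒦]

/-- The plane wave `e^{i k·x}`. -/
def planeWave (k x : Rd d) : ℂ := Complex.exp (((inner ℝ k x : ℝ) : ℂ) * Complex.I)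

theorem norm_planeWave (k x : Rd d) : ‖planeWave k x‖ = 1 := Complex.norm_exp_ofReal_mul_I _

theorem continuous_planeWave : Continuous fun p : Rd d × Rd d => planeWave p.1 p.2 := by
  unfold planeWave
  fun_prop

theorem isMultiplier_planeWave (k : Rd d) : IsMultiplier (planeWave k) :=
  ⟨(continuous_planeWave.comp (by fun_prop : Continuous fun x : Rd d => (k, x))).measurable,
    1, fun x => (norm_planeWave k x).le⟩

theorem planeWave_add (k l x : Rd d) : planeWave (k + l) x = planeWave k x * planeWave l x := by
  unfold planeWave
  rw [← Complex.exp_add, inner_add_left]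
  push_cast
  ring_nf

theorem planeWave_zero (x : Rd d) : planeWave 0 x = 1 := by simp [planeWave]

theorem planeWave_neg (k x : Rd d) : planeWave (-k) x = starRingEnd ℂ (planeWave k x) := by
  unfold planeWave
  rw [← Complex.exp_conj, inner_neg_left]
  simp

/-- Multiplication by `e^{i k·x}` as a bounded operator. -/
def modOp (k : Rd d) : L2 d 𝒦 →L[ℂ] L2 d 𝒦 := mulOp volume 𝒦 (isMultiplier_planeWave k)

theorem modulation_apply (k : Rd d) (Ψ : L2 d 𝒦) : modulation k Ψ = modOp k Ψ := rfl

theorem coeFn_modOp (k : Rd d) (Ψ : L2 d 𝒦) :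
    modOp k Ψ =ᵐ[volume] fun x => planeWave k x • Ψ x := coeFn_mulOp _ _

theorem norm_modOp (k : Rd d) (Ψ : L2 d 𝒦) : ‖modOp k Ψ‖ = ‖Ψ‖ :=
  norm_mulOp_of_norm_eq_one _ (norm_planeWave k) Ψ

theorem modOp_zero (Ψ : L2 d 𝒦) : modOp 0 Ψ = Ψ := mulOp_one _ planeWave_zero Ψ

theorem inner_modOp (k : Rd d) (Ψ Φ : L2 d 𝒦) : ⟪modOp k Ψ, Φ⟫_ℂ = ⟪Ψ, modOp (-k) Φ⟫_ℂ :=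
  inner_mulOp _ _ (planeWave_neg k) Ψ Φ

/-- Dominated convergence: the difference of two plane waves is bounded by 2 and tends to 0
pointwise. -/
theorem continuous_modOp (Ψ : L2 d 𝒦) : Continuous fun k : Rd d => modOp k Ψ := by
  rw [continuous_iff_continuousAt]
  intro k₀
  rw [ContinuousAt, tendsto_iff_norm_sub_tendsto_zero, ← tendsto_zero_iff_norm_tendsto_zero]
  have hm : ∀ k : Rd d, IsMultiplier fun x => planeWave k x - planeWave k₀ x := fun k =>
    ⟨(isMultiplier_planeWave k).measurable.sub (isMultiplier_planeWave k₀).measurable, 2,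
      fun x => (norm_sub_le _ _).trans (by rw [norm_planeWave, norm_planeWave]; norm_num)⟩
  have hsub : ∀ k, modOp k Ψ - modOp k₀ Ψ = mulOp volume 𝒦 (hm k) Ψ := fun k =>
    sub_mulOp _ _ _ (fun x => rfl) Ψ
  simp_rw [hsub]
  refine tendsto_mulOp_zero hm (C := 2) (fun k x => (norm_sub_le _ _).trans
    (by rw [norm_planeWave, norm_planeWave]; norm_num)) (fun x => ?_) Ψ
  have hc : Continuous fun k : Rd d => planeWave k x - planeWave k₀ x :=
    (continuous_planeWave.comp (by fun_prop : Continuous fun k : Rd d => (k, x))).sub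
      continuous_const
  simpa using hc.tendsto k₀

end Modulation

/-! ### Bounded multiplication operators on the Fock space -/

section SectorOp

theorem mem_symL2_iff {n : ℕ} {F : Lp ℂ 2 (photonMeasureN n)} :
    F ∈ symL2 n ↔ ∀ σ : Equiv.Perm (Fin n),
      (fun k : Fin n → Photon => F fun i => k (σ i)) =ᵐ[photonMeasureN n] F := by
  rw [symL2, Submodule.mem_iInf]
  refine forall_congr' fun σ => ?_
  rw [LinearMap.mem_eqLocus, LinearMap.id_apply, Lp.ext_iff]
  have h := Lp.coeFn_compMeasurePreserving F (measurePreserving_perm n σ)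
  constructor
  · intro h2
    exact h.symm.trans h2
  · intro h2
    exact h.trans h2

/-- Uniformly bounded measurable symmetric functions on the `n`-photon configuration spaces. -/
structure IsSectorMultiplier (θ : ∀ n, (Fin n → Photon) → ℂ) : Prop where
  measurable : ∀ n, Measurable (θ n)
  symm : ∀ n (σ : Equiv.Perm (Fin n)) k, θ n (fun i => k (σ i)) = θ n k
  bdd : ∃ C : ℝ, ∀ n k, ‖θ n k‖ ≤ C

theorem IsSectorMultiplier.isMultiplier {θ : ∀ n, (Fin n → Photon) → ℂ}
    (hθ : IsSectorMultiplier θ) (n : ℕ) : IsMultiplier (θ n) :=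
  ⟨hθ.measurable n, hθ.bdd.choose, hθ.bdd.choose_spec n⟩

theorem mulOp_mem_symL2 {n : ℕ} {θ : (Fin n → Photon) → ℂ} (hθ : IsMultiplier θ)
    (hs : ∀ (σ : Equiv.Perm (Fin n)) k, θ (fun i => k (σ i)) = θ k)
    {F : Lp ℂ 2 (photonMeasureN n)} (hF : F ∈ symL2 n) :
    mulOp (photonMeasureN n) ℂ hθ F ∈ symL2 n := by
  rw [mem_symL2_iff] at hF ⊢
  intro σ
  have h1 := (measurePreserving_perm n σ).quasiMeasurePreserving.ae (coeFn_mulOp hθ F)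
  filter_upwards [h1, coeFn_mulOp hθ F, hF σ] with k h1 h2 h3
  rw [h1, h2, hs, h3]

theorem norm_sq_fock (ψ : Fock) : HasSum (fun n => ‖ψ n‖ ^ 2) (‖ψ‖ ^ 2) := by
  have h := lp.hasSum_norm (p := 2) (by norm_num) ψ
  simpa using h

theorem norm_fock_le_of_forall {ψ φ : Fock} {C : ℝ} (hC : 0 ≤ C) (h : ∀ n, ‖ψ n‖ ≤ C * ‖φ n‖) :
    ‖ψ‖ ≤ C * ‖φ‖ := by
  have h1 : ‖ψ‖ ^ 2 ≤ C ^ 2 * ‖φ‖ ^ 2 := by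
    refine hasSum_le (fun n => ?_) (norm_sq_fock ψ) ((norm_sq_fock φ).mul_left (C ^ 2))
    rw [← mul_pow]
    exact pow_le_pow_left₀ (norm_nonneg _) (h n) 2
  rw [← mul_pow] at h1
  exact (pow_le_pow_iff_left₀ (norm_nonneg _) (by positivity) two_ne_zero).1 h1

theorem memℓp_of_norm_le {f : ∀ n, symL2 n} {φ : Fock} {C : ℝ} (h : ∀ n, ‖f n‖ ≤ C * ‖φ n‖) :
    Memℓp f 2 := by
  refine memℓp_gen ?_
  have h2 : (2 : ENNReal).toReal = 2 := by norm_num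
  rw [h2]
  refine Summable.of_nonneg_of_le (fun n => by positivity) (fun n => ?_)
    ((norm_sq_fock φ).summable.mul_left (C ^ 2))
  rw [← mul_pow]
  have := pow_le_pow_left₀ (norm_nonneg _) (h n) 2
  simpa using this

theorem fock_ext {ψ φ : Fock} (h : ∀ n, comp ψ n =ᵐ[photonMeasureN n] comp φ n) : ψ = φ := by
  refine lp.ext (funext fun n => Subtype.ext (Lp.ext (h n)))

theorem inner_fock (ψ φ : Fock) : HasSum
    (fun n => ∫ k, starRingEnd ℂ (comp ψ n k) * comp φ n k ∂photonMeasureN n) ⟪ψ, φ⟫_ℂ := by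
  have h := lp.hasSum_inner (𝕜 := ℂ) ψ φ
  have h2 : (fun n => ⟪ψ n, φ n⟫_ℂ) =
      fun n => ∫ k, starRingEnd ℂ (comp ψ n k) * comp φ n k ∂photonMeasureN n := by
    funext n
    rw [Submodule.coe_inner, L2.inner_def]
    refine integral_congr_ae (Filter.Eventually.of_forall fun k => ?_)
    exact mul_comm _ _
  rw [h2] at h
  exact h

/-- The operator acting on the `n`-photon space as the multiplication by `θ n`. -/
def sectorOp {θ : ∀ n, (Fin n → Photon) → ℂ} (hθ : IsSectorMultiplier θ) : Fock →L[ℂ] Fock :=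
  LinearMap.mkContinuous
    { toFun := fun ψ =>
        ⟨fun n => ⟨mulOp (photonMeasureN n) ℂ (hθ.isMultiplier n) (ψ n),
            mulOp_mem_symL2 _ (hθ.symm n) (ψ n).2⟩,
          memℓp_of_norm_le (C := hθ.bdd.choose) fun n =>
            norm_mulOp_le (hθ.isMultiplier n) (hθ.bdd.choose_spec n) _⟩
      map_add' := fun ψ φ => lp.ext <| funext fun n => Subtype.ext <| by
        exact map_add (mulOp (photonMeasureN n) ℂ (hθ.isMultiplier n))
          (ψ n : Lp ℂ 2 (photonMeasureN n)) (φ n)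
      map_smul' := fun c ψ => lp.ext <| funext fun n => Subtype.ext <| by
        exact map_smul (mulOp (photonMeasureN n) ℂ (hθ.isMultiplier n)) c
          (ψ n : Lp ℂ 2 (photonMeasureN n)) } (max hθ.bdd.choose 0) fun ψ =>
    norm_fock_le_of_forall (le_max_right _ _) fun n =>
      norm_mulOp_le (hθ.isMultiplier n) (fun k => (hθ.bdd.choose_spec n k).trans
        (le_max_left _ _)) _

theorem comp_sectorOp {θ : ∀ n, (Fin n → Photon) → ℂ} (hθ : IsSectorMultiplier θ) (ψ : Fock)
    (n : ℕ) : comp (sectorOp hθ ψ) n =ᵐ[photonMeasureN n] fun k => θ n k * comp ψ n k :=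
  coeFn_mulOp (hθ.isMultiplier n) (ψ n : Lp ℂ 2 (photonMeasureN n))

theorem sectorOp_apply {θ : ∀ n, (Fin n → Photon) → ℂ} (hθ : IsSectorMultiplier θ) (ψ : Fock)
    (n : ℕ) : (sectorOp hθ ψ n : Lp ℂ 2 (photonMeasureN n)) =
      mulOp (photonMeasureN n) ℂ (hθ.isMultiplier n) (ψ n) := rfl

attribute [irreducible] mulOp sectorOp modOp

theorem inner_sectorOp {θ θ' : ∀ n, (Fin n → Photon) → ℂ} (hθ : IsSectorMultiplier θ)
    (hθ' : IsSectorMultiplier θ') (h : ∀ n k, θ' n k = starRingEnd ℂ (θ n k)) (ψ φ : Fock) :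
    ⟪sectorOp hθ ψ, φ⟫_ℂ = ⟪ψ, sectorOp hθ' φ⟫_ℂ := by
  rw [lp.inner_eq_tsum, lp.inner_eq_tsum]
  refine tsum_congr fun n => ?_
  rw [Submodule.coe_inner, Submodule.coe_inner, sectorOp_apply, sectorOp_apply]
  exact inner_mulOp _ _ (h n) _ _

theorem tendsto_sectorOp_zero {ι : Type*} {l : Filter ι} [l.IsCountablyGenerated]
    {θ : ι → ∀ n, (Fin n → Photon) → ℂ} (hθ : ∀ i, IsSectorMultiplier (θ i)) {C : ℝ}
    (hC : ∀ i n k, ‖θ i n k‖ ≤ C) (h0 : ∀ n k, Filter.Tendsto (fun i => θ i n k) l (nhds 0))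
    (ψ : Fock) : Filter.Tendsto (fun i => sectorOp (hθ i) ψ) l (nhds 0) := by
  rw [tendsto_zero_iff_norm_tendsto_zero]
  have hn : ∀ i n, ‖sectorOp (hθ i) ψ n‖ =
      ‖mulOp (photonMeasureN n) ℂ ((hθ i).isMultiplier n) (ψ n)‖ := fun i n => by
    rw [← sectorOp_apply]
    rfl
  have h2 : Filter.Tendsto (fun i => ‖sectorOp (hθ i) ψ‖ ^ 2) l (nhds 0) := by
    have h3 : ∀ i, ‖sectorOp (hθ i) ψ‖ ^ 2 = ∑' n, ‖sectorOp (hθ i) ψ n‖ ^ 2 :=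
      fun i => (norm_sq_fock _).tsum_eq.symm
    simp_rw [h3, hn]
    rw [← tsum_zero (α := ℝ) (β := ℕ)]
    refine tendsto_tsum_of_dominated_convergence (bound := fun n => C ^ 2 * ‖ψ n‖ ^ 2)
      ((norm_sq_fock ψ).summable.mul_left _) (fun n => ?_)
      (Filter.Eventually.of_forall fun i n => ?_)
    · have h4 := tendsto_mulOp_zero (fun i => (hθ i).isMultiplier n) (fun i => hC i n) (h0 n)
        (ψ n : Lp ℂ 2 (photonMeasureN n))
      simpa using h4.norm.pow 2
    · rw [Real.norm_of_nonneg (by positivity), ← mul_pow]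
      exact pow_le_pow_left₀ (norm_nonneg _)
        (norm_mulOp_le ((hθ i).isMultiplier n) (hC i n) _) 2
  have h3 := h2.sqrt
  rw [Real.sqrt_zero] at h3
  exact h3.congr fun i => Real.sqrt_sq (norm_nonneg _)

end SectorOp

/-! ### Second quantized multiplication operators -/

theorem mem_graph_adjoint_iff {H : Type*} [NormedAddCommGroup H] [InnerProductSpace ℂ H]
    [CompleteSpace H] {A : H →ₗ.[ℂ] H} (hA : Dense (A.domain : Set H)) (y z : H) :
    (y, z) ∈ A.adjoint.graph ↔ ∀ x w, (x, w) ∈ A.graph → ⟪w, y⟫_ℂ = ⟪x, z⟫_ℂ := by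
  rw [LinearPMap.adjoint_graph_eq_graph_adjoint hA, Submodule.mem_adjoint_iff]
  simp only [sub_eq_zero]

section SectorMul

variable {w : ∀ n, (Fin n → Photon) → ℝ}

theorem mem_graph_sectorMul (w : ∀ n, (Fin n → Photon) → ℝ) (ψ φ : Fock) :
    (ψ, φ) ∈ (sectorMul w).graph ↔
      ∀ n, comp φ n =ᵐ[photonMeasureN n] fun k => (w n k : ℂ) * comp ψ n k := by
  rw [sectorMul, Submodule.toLinearPMap_graph_eq]
  · rfl
  · rintro ⟨ψ, φ⟩ h (rfl : ψ = 0)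
    refine fock_ext fun n => ?_
    filter_upwards [h n, comp_zero n] with k h1 h2
    rw [h1, h2]
    simp

/-- Convergence in `L²` gives convergence almost everywhere along a subsequence, and the pointwise
relation passes to the limit. The second subsequence is taken inside the first so that both
components converge. -/
theorem sectorMul_isClosed (w : ∀ n, (Fin n → Photon) → ℝ) :
    IsClosed ((sectorMul w).graph : Set (Fock × Fock)) := by
  refine IsSeqClosed.isClosed fun p q hp hpq => ?_
  have h1 := (Prod.tendsto_iff p q).1 hpq
  show (q.1, q.2) ∈ (sectorMul w).graph
  rw [mem_graph_sectorMul]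
  intro n
  have hev : ∀ ψ : ℕ → Fock, ∀ φ, Filter.Tendsto ψ Filter.atTop (nhds φ) →
      Filter.Tendsto (fun i => (ψ i n : Lp ℂ 2 (photonMeasureN n))) Filter.atTop
        (nhds (φ n : Lp ℂ 2 (photonMeasureN n))) := by
    intro ψ φ h
    exact (continuous_subtype_val.tendsto _).comp
      (((lp.lipschitzWith_one_eval (E := fun n => symL2 n) 2 n).continuous.tendsto φ).comp h)
  obtain ⟨s₁, hs₁, ha₁⟩ := (tendstoInMeasure_of_tendsto_Lp (hev _ _ h1.1)).exists_seq_tendsto_ae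
  obtain ⟨s₂, hs₂, ha₂⟩ := (tendstoInMeasure_of_tendsto_Lp
    ((hev _ _ h1.2).comp hs₁.tendsto_atTop)).exists_seq_tendsto_ae
  have hgr : ∀ᵐ k ∂photonMeasureN n, ∀ i, comp (p i).2 n k = (w n k : ℂ) * comp (p i).1 n k :=
    ae_all_iff.2 fun i => (mem_graph_sectorMul w _ _).1 (hp i) n
  filter_upwards [ha₁, ha₂, hgr] with k h2 h3 h4
  refine tendsto_nhds_unique h3 ?_
  have h5 := (h2.comp hs₂.tendsto_atTop).const_mul (w n k : ℂ)
  refine h5.congr fun i => ?_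
  exact (h4 (s₁ (s₂ i))).symm

variable (hw : ∀ n, Measurable (w n))
  (hs : ∀ n (σ : Equiv.Perm (Fin n)) k, w n (fun i => k (σ i)) = w n k)

include hw hs in
/-- Every bounded Borel function of the operator is a bounded multiplication operator. -/
theorem isSectorMultiplier_comp {f : ℝ → ℂ} (hf : Measurable f) {C : ℝ} (hC : ∀ s, ‖f s‖ ≤ C) :
    IsSectorMultiplier fun n k => f (w n k) :=
  ⟨fun n => hf.comp (hw n), fun n σ k => by rw [hs], C, fun n k => hC _⟩

/-- The function `1` on `[-N, N]`, and `0` elsewhere. -/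
def cutoff (N : ℕ) (s : ℝ) : ℂ := if |s| ≤ N then 1 else 0

theorem measurable_cutoff (N : ℕ) : Measurable (cutoff N) :=
  Measurable.ite (measurableSet_le (by fun_prop) measurable_const) measurable_const
    measurable_const

theorem norm_cutoff_le (N : ℕ) (s : ℝ) : ‖cutoff N s‖ ≤ 1 := by
  unfold cutoff; split_ifs <;> simp

theorem norm_mul_cutoff_le (N : ℕ) (s : ℝ) : ‖(s : ℂ) * cutoff N s‖ ≤ N := by
  unfold cutoff
  split_ifs with h
  · simpa using h
  · simp

include hw hs in
theorem sectorOp_cutoff_mem_graph (N : ℕ) (ψ : Fock) :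
    (sectorOp (isSectorMultiplier_comp hw hs (measurable_cutoff N) (norm_cutoff_le N)) ψ,
      sectorOp (isSectorMultiplier_comp hw hs (f := fun s => (s : ℂ) * cutoff N s)
        (Complex.measurable_ofReal.mul (measurable_cutoff N)) (norm_mul_cutoff_le N)) ψ) ∈
      (sectorMul w).graph := by
  rw [mem_graph_sectorMul]
  intro n
  filter_upwards [comp_sectorOp (isSectorMultiplier_comp hw hs (measurable_cutoff N)
    (norm_cutoff_le N)) ψ n, comp_sectorOp (isSectorMultiplier_comp hw hs
      (f := fun s => (s : ℂ) * cutoff N s)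
      (Complex.measurable_ofReal.mul (measurable_cutoff N)) (norm_mul_cutoff_le N)) ψ n]
    with k h1 h2
  rw [h1, h2, mul_assoc]

include hw hs in
-- The truncations of `ψ` to `|w| ≤ N` lie in the domain and tend to `ψ` by dominated convergence.
theorem sectorMul_dense : Dense ((sectorMul w).domain : Set Fock) := by
  intro ψ
  let θ : ℕ → ∀ n, (Fin n → Photon) → ℂ := fun N n k => cutoff N (w n k) - 1
  have hb : ∀ N s, ‖cutoff N s - 1‖ ≤ 2 := fun N s =>
    (norm_sub_le _ _).trans (by have := norm_cutoff_le N s; rw [norm_one]; linarith)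
  have hθ : ∀ N, IsSectorMultiplier (θ N) := fun N =>
    isSectorMultiplier_comp hw hs ((measurable_cutoff N).sub measurable_const) (hb N)
  have hlim := tendsto_sectorOp_zero hθ (C := 2) (fun N n k => hb N _) (fun n k => ?_) ψ
    (l := Filter.atTop)
  · have hlim2 := hlim.add_const ψ
    rw [zero_add] at hlim2
    refine mem_closure_of_tendsto hlim2 (Filter.Eventually.of_forall fun N => ?_)
    have h1 : sectorOp (hθ N) ψ + ψ = sectorOp (isSectorMultiplier_comp hw hs
        (measurable_cutoff N) (norm_cutoff_le N)) ψ := by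
      refine fock_ext fun n => ?_
      filter_upwards [comp_add (sectorOp (hθ N) ψ) ψ n, comp_sectorOp (hθ N) ψ n,
        comp_sectorOp (isSectorMultiplier_comp hw hs (measurable_cutoff N)
          (norm_cutoff_le N)) ψ n] with k h1 h2 h3
      rw [h1, Pi.add_apply, h2, h3]
      simp only [θ]
      ring
    rw [h1]
    exact LinearPMap.mem_domain_of_mem_graph (sectorOp_cutoff_mem_graph hw hs N ψ)
  · refine tendsto_const_nhds.congr' ?_
    obtain ⟨N₀, hN₀⟩ := exists_nat_ge |w n k|
    filter_upwards [Filter.eventually_ge_atTop N₀] with N hN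
    have h : |w n k| ≤ N := hN₀.trans (by exact_mod_cast hN)
    simp [θ, cutoff, h]

theorem sectorMul_symm {ψ φ ψ' φ' : Fock} (h : (ψ, φ) ∈ (sectorMul w).graph)
    (h' : (ψ', φ') ∈ (sectorMul w).graph) : ⟪φ, ψ'⟫_ℂ = ⟪ψ, φ'⟫_ℂ := by
  rw [mem_graph_sectorMul] at h h'
  refine (inner_fock φ ψ').unique ?_
  convert inner_fock ψ φ' using 2 with n
  refine integral_congr_ae ?_
  filter_upwards [h n, h' n] with k h1 h2
  rw [h1, h2, map_mul, Complex.conj_ofReal]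
  ring

include hw hs in
-- Truncated vectors are in the domain, so the adjoint relation yields `w y = z` on `{|w| ≤ N}` for
-- every `N`, and a large `N` removes the truncation at each configuration. Besides
-- self-adjointness, this identifies the generator of the translation group.
theorem mem_graph_sectorMul_of_adjoint {y z : Fock}
    (h : ∀ x v, (x, v) ∈ (sectorMul w).graph → ⟪v, y⟫_ℂ = ⟪x, z⟫_ℂ) :
    (y, z) ∈ (sectorMul w).graph := by
  have key : ∀ N : ℕ, sectorOp (isSectorMultiplier_comp hw hs (f := fun s => (s : ℂ) * cutoff N s)
        (Complex.measurable_ofReal.mul (measurable_cutoff N)) (norm_mul_cutoff_le N)) y =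
      sectorOp (isSectorMultiplier_comp hw hs (measurable_cutoff N) (norm_cutoff_le N)) z := by
    intro N
    have hc : ∀ s, cutoff N s = starRingEnd ℂ (cutoff N s) := fun s => by
      unfold cutoff; split_ifs <;> simp
    refine ext_inner_left ℂ fun x => ?_
    have hg := sectorOp_cutoff_mem_graph hw hs N x
    have h1 := inner_sectorOp (isSectorMultiplier_comp hw hs (f := fun s => (s : ℂ) * cutoff N s)
        (Complex.measurable_ofReal.mul (measurable_cutoff N)) (norm_mul_cutoff_le N))
      (isSectorMultiplier_comp hw hs (f := fun s => (s : ℂ) * cutoff N s)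
        (Complex.measurable_ofReal.mul (measurable_cutoff N)) (norm_mul_cutoff_le N))
      (fun n k => by rw [map_mul, Complex.conj_ofReal, ← hc]) x y
    have h2 := inner_sectorOp
      (isSectorMultiplier_comp hw hs (measurable_cutoff N) (norm_cutoff_le N))
      (isSectorMultiplier_comp hw hs (measurable_cutoff N) (norm_cutoff_le N))
      (fun n k => hc _) x z
    rw [← h1, ← h2]
    exact h _ _ hg
  rw [mem_graph_sectorMul]
  intro n
  have h1 : ∀ᵐ k ∂photonMeasureN n, ∀ N : ℕ,
      (w n k : ℂ) * cutoff N (w n k) * comp y n k = cutoff N (w n k) * comp z n k := by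
    refine ae_all_iff.2 fun N => ?_
    have h2 := comp_sectorOp (isSectorMultiplier_comp hw hs (f := fun s => (s : ℂ) * cutoff N s)
      (Complex.measurable_ofReal.mul (measurable_cutoff N)) (norm_mul_cutoff_le N)) y n
    rw [key N] at h2
    filter_upwards [h2, comp_sectorOp (isSectorMultiplier_comp hw hs (measurable_cutoff N)
      (norm_cutoff_le N)) z n] with k h3 h4
    rw [← h3, h4]
  filter_upwards [h1] with k hk
  obtain ⟨N, hN⟩ := exists_nat_ge |w n k|
  have := hk N
  simpa [cutoff, hN] using this.symm

include hw hs in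
theorem sectorMul_isSelfAdjoint : IsSelfAdjoint (sectorMul w) := by
  rw [LinearPMap.isSelfAdjoint_def]
  refine LinearPMap.eq_of_eq_graph (SetLike.ext fun p => ?_)
  have h := mem_graph_adjoint_iff (sectorMul_dense hw hs) p.1 p.2
  refine h.trans ⟨mem_graph_sectorMul_of_adjoint hw hs, fun hp x v hxv => sectorMul_symm hxv hp⟩

end SectorMul

/-! ### The group generated by the field momentum -/

section FieldGroup

/-- The total momentum of a photon configuration, in the direction `k`. -/
def totalMomentum (k : Rd 3) (n : ℕ) (q : Fin n → Photon) : ℝ := ∑ i, inner ℝ k (q i).1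

theorem measurable_totalMomentum (k : Rd 3) (n : ℕ) : Measurable (totalMomentum k n) := by
  unfold totalMomentum
  refine Finset.measurable_sum _ fun i _ => ?_
  exact Measurable.const_inner ((measurable_pi_apply i).fst)

theorem totalMomentum_symm (k : Rd 3) (n : ℕ) (σ : Equiv.Perm (Fin n)) (q : Fin n → Photon) :
    totalMomentum k n (fun i => q (σ i)) = totalMomentum k n q :=
  Equiv.sum_comp σ fun i => (inner ℝ k (q i).1 : ℝ)

theorem totalMomentum_add (k l : Rd 3) (n : ℕ) (q : Fin n → Photon) :
    totalMomentum (k + l) n q = totalMomentum k n q + totalMomentum l n q := by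
  simp only [totalMomentum, inner_add_left, Finset.sum_add_distrib]

theorem totalMomentum_single (j : Fin 3) (n : ℕ) (q : Fin n → Photon) :
    totalMomentum (EuclideanSpace.single j 1) n q = ∑ i, (q i).1 j := by
  simp [totalMomentum, EuclideanSpace.inner_single_left]

theorem totalMomentum_smul (t : ℝ) (k : Rd 3) (n : ℕ) (q : Fin n → Photon) :
    totalMomentum (t • k) n q = t * totalMomentum k n q := by
  simp only [totalMomentum, real_inner_smul_left, Finset.mul_sum]

theorem totalMomentum_neg (k : Rd 3) (n : ℕ) (q : Fin n → Photon) :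
    totalMomentum (-k) n q = -totalMomentum k n q := by
  simp [totalMomentum]

/-- The phase `e^{i k·(q₁ + ⋯ + qₙ)}`. -/
def phase (k : Rd 3) (n : ℕ) (q : Fin n → Photon) : ℂ :=
  Complex.exp ((totalMomentum k n q : ℂ) * Complex.I)

theorem norm_phase (k : Rd 3) (n : ℕ) (q : Fin n → Photon) : ‖phase k n q‖ = 1 :=
  Complex.norm_exp_ofReal_mul_I _

theorem isSectorMultiplier_phase (k : Rd 3) : IsSectorMultiplier (phase k) :=
  isSectorMultiplier_comp (measurable_totalMomentum k) (totalMomentum_symm k)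
    (f := fun s => Complex.exp ((s : ℂ) * Complex.I)) (C := 1) (by fun_prop)
    (fun s => (Complex.norm_exp_ofReal_mul_I s).le)

theorem phase_add (k l : Rd 3) (n : ℕ) (q : Fin n → Photon) :
    phase (k + l) n q = phase k n q * phase l n q := by
  rw [phase, phase, phase, totalMomentum_add, ← Complex.exp_add]
  push_cast
  ring_nf

theorem phase_neg (k : Rd 3) (n : ℕ) (q : Fin n → Photon) :
    phase (-k) n q = starRingEnd ℂ (phase k n q) := by
  rw [phase, phase, totalMomentum_neg, ← Complex.exp_conj]
  simp

theorem phase_zero (n : ℕ) (q : Fin n → Photon) : phase 0 n q = 1 := by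
  simp [phase, totalMomentum]

theorem continuous_phase (n : ℕ) (q : Fin n → Photon) : Continuous fun k => phase k n q := by
  unfold phase totalMomentum
  fun_prop

/-- The unitary operator `e^{i k·P_f}`. -/
def fieldTranslation (k : Rd 3) : Fock →L[ℂ] Fock := sectorOp (isSectorMultiplier_phase k)

theorem comp_fieldTranslation (k : Rd 3) (ψ : Fock) (n : ℕ) :
    comp (fieldTranslation k ψ) n =ᵐ[photonMeasureN n] fun q => phase k n q * comp ψ n q :=
  comp_sectorOp _ _ _

theorem fieldTranslation_zero : fieldTranslation 0 = ContinuousLinearMap.id ℂ Fock := by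
  refine ContinuousLinearMap.ext fun ψ => fock_ext fun n => ?_
  filter_upwards [comp_fieldTranslation 0 ψ n] with q h
  rw [h, phase_zero, one_mul]
  rfl

theorem fieldTranslation_add (k l : Rd 3) :
    fieldTranslation (k + l) = (fieldTranslation k).comp (fieldTranslation l) := by
  refine ContinuousLinearMap.ext fun ψ => fock_ext fun n => ?_
  filter_upwards [comp_fieldTranslation (k + l) ψ n, comp_fieldTranslation l ψ n,
    comp_fieldTranslation k (fieldTranslation l ψ) n] with q h1 h2 h3
  rw [h1, ContinuousLinearMap.comp_apply, h3, h2, phase_add, mul_assoc]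

theorem inner_fieldTranslation (k : Rd 3) (ψ φ : Fock) :
    ⟪fieldTranslation k ψ, φ⟫_ℂ = ⟪ψ, fieldTranslation (-k) φ⟫_ℂ :=
  inner_sectorOp _ _ (phase_neg k) ψ φ

attribute [irreducible] fieldTranslation

theorem fieldTranslation_neg_apply (k : Rd 3) (ψ : Fock) :
    fieldTranslation (-k) (fieldTranslation k ψ) = ψ := by
  rw [← ContinuousLinearMap.comp_apply, ← fieldTranslation_add, neg_add_cancel,
    fieldTranslation_zero]
  rfl

theorem norm_fieldTranslation (k : Rd 3) (ψ : Fock) : ‖fieldTranslation k ψ‖ = ‖ψ‖ := by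
  have h : ⟪fieldTranslation k ψ, fieldTranslation k ψ⟫_ℂ = ⟪ψ, ψ⟫_ℂ := by
    rw [inner_fieldTranslation, fieldTranslation_neg_apply]
  rw [inner_self_eq_norm_sq_to_K, inner_self_eq_norm_sq_to_K] at h
  have h2 : ‖fieldTranslation k ψ‖ ^ 2 = ‖ψ‖ ^ 2 := by
    apply Complex.ofReal_injective
    push_cast
    exact h
  exact (pow_left_inj₀ (norm_nonneg _) (norm_nonneg _) two_ne_zero).1 h2

theorem continuous_fieldTranslation (ψ : Fock) : Continuous fun k => fieldTranslation k ψ := by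
  rw [continuous_iff_continuousAt]
  intro k₀
  rw [ContinuousAt, tendsto_iff_norm_sub_tendsto_zero, ← tendsto_zero_iff_norm_tendsto_zero]
  have hb : ∀ k n q, ‖phase k n q - phase k₀ n q‖ ≤ 2 := fun k n q =>
    (norm_sub_le _ _).trans (by rw [norm_phase, norm_phase]; norm_num)
  have hm : ∀ k : Rd 3, IsSectorMultiplier fun n q => phase k n q - phase k₀ n q := fun k =>
    ⟨fun n => ((isSectorMultiplier_phase k).measurable n).sub
      ((isSectorMultiplier_phase k₀).measurable n), fun n σ q => by
        rw [(isSectorMultiplier_phase k).symm, (isSectorMultiplier_phase k₀).symm], 2, hb k⟩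
  have hsub : ∀ k, fieldTranslation k ψ - fieldTranslation k₀ ψ = sectorOp (hm k) ψ := by
    intro k
    rw [sub_eq_iff_eq_add]
    refine fock_ext fun n => ?_
    filter_upwards [comp_add (sectorOp (hm k) ψ) (fieldTranslation k₀ ψ) n,
      comp_sectorOp (hm k) ψ n, comp_fieldTranslation k ψ n, comp_fieldTranslation k₀ ψ n]
      with q h1 h2 h3 h4
    rw [h1, Pi.add_apply, h2, h3, h4]
    ring
  simp_rw [hsub]
  refine tendsto_sectorOp_zero hm hb (fun n q => ?_) ψ
  have hc : Continuous fun k : Rd 3 => phase k n q - phase k₀ n q :=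
    (continuous_phase n q).sub continuous_const
  simpa using hc.tendsto k₀

theorem fieldTranslation_mem_graph_sectorMul (k : Rd 3) {w : ∀ n, (Fin n → Photon) → ℝ}
    {ψ φ : Fock} (h : (ψ, φ) ∈ (sectorMul w).graph) :
    (fieldTranslation k ψ, fieldTranslation k φ) ∈ (sectorMul w).graph := by
  rw [mem_graph_sectorMul] at h ⊢
  intro n
  filter_upwards [h n, comp_fieldTranslation k ψ n, comp_fieldTranslation k φ n] with q h1 h2 h3
  rw [h3, h2, h1]
  ring

/-- The remainder `(e^{its} - 1) / (ts) - i` of the difference quotient. -/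
def expRemainder (t s : ℝ) : ℂ :=
  if s = 0 then 0 else
    (Complex.exp (((t * s : ℝ) : ℂ) * Complex.I) - 1) / ((t * s : ℝ) : ℂ) - Complex.I

theorem measurable_expRemainder (t : ℝ) : Measurable (expRemainder t) := by
  refine Measurable.ite (measurableSet_singleton 0) measurable_const ?_
  fun_prop

theorem norm_expRemainder_le (t s : ℝ) : ‖expRemainder t s‖ ≤ 2 := by
  unfold expRemainder
  split_ifs with h
  · simp
  refine (norm_sub_le _ _).trans ?_
  rw [Complex.norm_I, norm_div, mul_comm _ Complex.I]
  -- At `t = 0` the quotient is `0 / 0 = 0`, so the bound covers that value as well.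
  have h1 : ‖Complex.exp (Complex.I * ((t * s : ℝ) : ℂ)) - 1‖ / ‖((t * s : ℝ) : ℂ)‖ ≤ 1 := by
    refine div_le_one_of_le₀ ?_ (norm_nonneg _)
    rw [Complex.norm_real]
    exact Real.norm_exp_I_mul_ofReal_sub_one_le
  linarith

theorem tendsto_expRemainder (s : ℝ) :
    Filter.Tendsto (fun t => expRemainder t s) (nhdsWithin 0 {0}ᶜ) (nhds 0) := by
  by_cases h : s = 0
  · simp [expRemainder, h]
  have h1 : HasDerivAt (fun t : ℝ => Complex.exp (((t * s : ℝ) : ℂ) * Complex.I))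
      ((s : ℂ) * Complex.I) 0 := by
    have h2 : HasDerivAt (fun t : ℝ => ((t * s : ℝ) : ℂ) * Complex.I) ((s : ℂ) * Complex.I) 0 := by
      have h3 : HasDerivAt (fun t : ℝ => t * s) s 0 := by
        simpa using (hasDerivAt_id (0 : ℝ)).mul_const s
      exact h3.ofReal_comp.mul_const Complex.I
    simpa using h2.cexp
  rw [hasDerivAt_iff_tendsto_slope_zero] at h1
  have h2 := (h1.const_mul ((s : ℂ)⁻¹)).sub_const Complex.I
  have hs : (s : ℂ) ≠ 0 := by exact_mod_cast h
  have h3 : (s : ℂ)⁻¹ * ((s : ℂ) * Complex.I) - Complex.I = 0 := by field_simp; ring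
  rw [h3] at h2
  refine h2.congr fun t => ?_
  simp only [expRemainder, h, if_false, zero_add, zero_mul, Complex.ofReal_zero, Complex.exp_zero,
    Complex.real_smul, Complex.ofReal_inv, Complex.ofReal_mul]
  rw [div_eq_inv_mul, mul_inv]
  ring

theorem mem_graph_fieldMomentum (j : Fin 3) (ψ φ : Fock) :
    (ψ, φ) ∈ (fieldMomentum j).graph ↔ (ψ, φ) ∈
      (sectorMul (totalMomentum (EuclideanSpace.single j 1))).graph := by
  have h : fieldMomentum j = sectorMul (totalMomentum (EuclideanSpace.single j 1)) := by
    unfold fieldMomentum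
    congr 1
    funext n q
    rw [totalMomentum_single]
  rw [h]

theorem hasDerivAt_zero_iff_tendsto {H : Type*} [NormedAddCommGroup H] [InnerProductSpace ℂ H]
    (u : ℝ → H) (φ : H) : HasDerivAt u φ 0 ↔
      Filter.Tendsto (fun t : ℝ => (t : ℂ)⁻¹ • (u t - u 0)) (nhdsWithin 0 {0}ᶜ) (nhds φ) := by
  rw [hasDerivAt_iff_tendsto_slope_zero]
  refine Filter.tendsto_congr fun t => ?_
  rw [zero_add, ← Complex.ofReal_inv, RCLike.real_smul_eq_coe_smul (K := ℂ)]
  rfl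

theorem sub_eq_add_neg_one_smul {H : Type*} [AddCommGroup H] [Module ℂ H] (x y : H) :
    x - y = x + (-1 : ℂ) • y := by
  rw [neg_one_smul, sub_eq_add_neg]

/-- With `φ = w ψ`, the quotient `(e^{itw} - 1) ψ / t` equals `(r + i) φ`, where the remainder `r`
is bounded by 2 and tends to 0 pointwise. Where `w = 0` both sides vanish. -/
theorem tendsto_slope_fieldTranslation (k : Rd 3) {ψ φ : Fock}
    (h : (ψ, φ) ∈ (sectorMul (totalMomentum k)).graph) :
    Filter.Tendsto (fun t : ℝ => (t : ℂ)⁻¹ • (fieldTranslation (t • k) ψ -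
      fieldTranslation ((0 : ℝ) • k) ψ)) (nhdsWithin 0 {0}ᶜ) (nhds (Complex.I • φ)) := by
  have hm : ∀ t, IsSectorMultiplier fun n q => expRemainder t (totalMomentum k n q) := fun t =>
    isSectorMultiplier_comp (measurable_totalMomentum k) (totalMomentum_symm k)
      (measurable_expRemainder t) (norm_expRemainder_le t)
  have h1 := (tendsto_sectorOp_zero hm (C := 2) (fun t n q => norm_expRemainder_le t _)
    (fun n q => tendsto_expRemainder _) φ).add_const (Complex.I • φ)
  rw [zero_add] at h1
  refine h1.congr' ?_
  filter_upwards [self_mem_nhdsWithin] with t ht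
  have ht0 : (t : ℂ) ≠ 0 := by exact_mod_cast ht
  have h2 : fieldTranslation (t • k) ψ - fieldTranslation ((0 : ℝ) • k) ψ =
      fieldTranslation (t • k) ψ + (-1 : ℂ) • ψ := by
    have h3 : fieldTranslation ((0 : ℝ) • k) ψ = ψ := by
      have h4 : (0 : ℝ) • k = 0 := zero_smul ℝ k
      rw [h4, fieldTranslation_zero]
      rfl
    exact (congrArg (fun y => fieldTranslation (t • k) ψ - y) h3).trans
      (sub_eq_add_neg_one_smul _ _)
  rw [h2]
  refine fock_ext fun n => ?_
  filter_upwards [comp_add (sectorOp (hm t) φ) (Complex.I • φ) n, comp_smul Complex.I φ n,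
    comp_sectorOp (hm t) φ n, (mem_graph_sectorMul _ _ _).1 h n,
    comp_fieldTranslation (t • k) ψ n, comp_smul (-1) ψ n,
    comp_add (fieldTranslation (t • k) ψ) ((-1 : ℂ) • ψ) n,
    comp_smul ((t : ℂ)⁻¹) (fieldTranslation (t • k) ψ + (-1 : ℂ) • ψ) n]
    with q h1 h2 h3 h4 h5 h6 h7 h8
  refine h1.trans (Eq.trans ?_ h8.symm)
  refine (congrArg₂ (· + ·) h3 h2).trans (Eq.trans ?_
    (congrArg (fun z => (t : ℂ)⁻¹ * z) (h7.trans (congrArg₂ (· + ·) h5 h6))).symm)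
  simp only [Pi.smul_apply, smul_eq_mul]
  rw [h4, phase, totalMomentum_smul]
  generalize comp ψ n q = z
  simp only [expRemainder]
  split_ifs with h0
  · simp [h0]
  · have h9 : (totalMomentum k n q : ℂ) ≠ 0 := by exact_mod_cast h0
    push_cast
    field_simp
    ring

/-- The function `⟪x, V(t) ψ⟫ = ⟪V(-t) x, ψ⟫` is differentiated at 0 in two ways. Thus a vector
differentiable along the group satisfies the adjoint relation of the multiplication operator, which
is the nontrivial half of the description of the generator. -/
theorem inner_eq_of_tendsto_slope {H : Type*} [NormedAddCommGroup H] [InnerProductSpace ℂ H]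
    {V : ℝ → H → H} (hV : ∀ t x y, ⟪V t x, y⟫_ℂ = ⟪x, V (-t) y⟫_ℂ) {x v ψ φ : H}
    (h1 : Filter.Tendsto (fun t : ℝ => (t : ℂ)⁻¹ • (V t x - V 0 x)) (nhdsWithin 0 {0}ᶜ)
      (nhds (Complex.I • v)))
    (h : HasDerivAt (fun t => V t ψ) (Complex.I • φ) 0) : ⟪v, ψ⟫_ℂ = ⟪x, φ⟫_ℂ := by
  rw [← hasDerivAt_zero_iff_tendsto (fun t => V t x)] at h1
  have h2 : HasDerivAt (fun t : ℝ => ⟪x, V t ψ⟫_ℂ) (⟪x, Complex.I • φ⟫_ℂ) 0 :=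
    ((hasDerivAt_const (0 : ℝ) x).inner ℂ h).congr_deriv (by rw [inner_zero_left, add_zero])
  have h4 : HasDerivAt (fun t : ℝ => V (-t) x) (-(Complex.I • v)) 0 := by
    have h5 : HasDerivAt (fun t => V t x) (Complex.I • v) (-(0 : ℝ)) := by rwa [neg_zero]
    have h6 := HasDerivAt.scomp (0 : ℝ) h5 (hasDerivAt_neg (0 : ℝ))
    rw [neg_one_smul] at h6
    exact h6
  have h6 : HasDerivAt (fun t : ℝ => ⟪x, V t ψ⟫_ℂ) (-⟪Complex.I • v, ψ⟫_ℂ) 0 := by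
    have h7 : HasDerivAt (fun t : ℝ => ⟪V (-t) x, ψ⟫_ℂ) (-⟪Complex.I • v, ψ⟫_ℂ) 0 :=
      (h4.inner ℂ (hasDerivAt_const (0 : ℝ) ψ)).congr_deriv
        (by rw [inner_zero_right, zero_add, inner_neg_left])
    refine h7.congr_of_eventuallyEq (Filter.Eventually.of_forall fun t => ?_)
    simp only [hV, neg_neg]
  have h5 := h2.unique h6
  rw [inner_smul_right, inner_smul_left, Complex.conj_I, neg_mul, neg_neg] at h5
  exact (mul_left_cancel₀ Complex.I_ne_zero h5).symm

theorem isExpGroup_fieldTranslation : IsExpGroup fieldMomentum fieldTranslation where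
  map_zero := fieldTranslation_zero
  map_add := fieldTranslation_add
  norm_map := norm_fieldTranslation
  continuous := continuous_fieldTranslation
  generator j ψ φ := by
    rw [mem_graph_fieldMomentum]
    refine ⟨fun h => (hasDerivAt_zero_iff_tendsto _ _).2 (tendsto_slope_fieldTranslation _ h),
      fun h => ?_⟩
    refine mem_graph_sectorMul_of_adjoint (measurable_totalMomentum _) (totalMomentum_symm _) ?_
    intro x v hxv
    refine inner_eq_of_tendsto_slope
      (V := fun t ψ => fieldTranslation (t • EuclideanSpace.single j 1) ψ) (fun t x y => ?_)
      (tendsto_slope_fieldTranslation _ hxv) h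
    simp only [neg_smul]
    exact inner_fieldTranslation _ _ _

theorem fieldMomentum_isSelfAdjoint (j : Fin 3) : IsSelfAdjoint (fieldMomentum j) := by
  have h : fieldMomentum j = sectorMul (totalMomentum (EuclideanSpace.single j 1)) :=
    LinearPMap.eq_of_eq_graph (SetLike.ext fun p => mem_graph_fieldMomentum j p.1 p.2)
  rw [h]
  exact sectorMul_isSelfAdjoint (measurable_totalMomentum _) (totalMomentum_symm _)

end FieldGroup

/-! ### Tensor products of one photon and `n` photon functions -/

section Tensor

variable {n : ℕ}

theorem memLp_mul_prod {X Y : Type*} [MeasurableSpace X] [MeasurableSpace Y] {μ : Measure X}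
    {ν : Measure Y} [SFinite μ] [SFinite ν] {f : X → ℂ} {g : Y → ℂ} (hf : MemLp f 2 μ)
    (hg : MemLp g 2 ν) : MemLp (fun p : X × Y => f p.1 * g p.2) 2 (μ.prod ν) := by
  have hmeas : AEStronglyMeasurable (fun p : X × Y => f p.1 * g p.2) (μ.prod ν) :=
    hf.1.comp_fst.mul hg.1.comp_snd
  rw [memLp_two_iff_integrable_sq_norm hmeas]
  have h := ((memLp_two_iff_integrable_sq_norm hf.1).1 hf).mul_prod
    ((memLp_two_iff_integrable_sq_norm hg.1).1 hg)
  simpa only [norm_mul, mul_pow] using h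

theorem integral_norm_sq_mul_prod {X Y : Type*} [MeasurableSpace X] [MeasurableSpace Y]
    {μ : Measure X} {ν : Measure Y} [SFinite μ] [SFinite ν] (f : X → ℂ) (g : Y → ℂ) :
    ∫ p : X × Y, ‖f p.1 * g p.2‖ ^ 2 ∂(μ.prod ν) = (∫ x, ‖f x‖ ^ 2 ∂μ) * ∫ y, ‖g y‖ ^ 2 ∂ν := by
  simp only [norm_mul, mul_pow]
  exact integral_prod_mul (fun x => ‖f x‖ ^ 2) fun y => ‖g y‖ ^ 2

theorem norm_sq_eq_integral {X : Type*} [MeasurableSpace X] {μ : Measure X} {E : Type*}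
    [NormedAddCommGroup E] [InnerProductSpace ℂ E] (F : Lp E 2 μ) :
    ‖F‖ ^ 2 = ∫ x, ‖F x‖ ^ 2 ∂μ := by
  have h1 : ((‖F‖ ^ 2 : ℝ) : ℂ) = ((∫ x, ‖F x‖ ^ 2 ∂μ : ℝ) : ℂ) := by
    have h2 : ⟪F, F⟫_ℂ = ((‖F‖ ^ 2 : ℝ) : ℂ) := by
      rw [inner_self_eq_norm_sq_to_K]; simp
    rw [← h2, L2.inner_def, ← integral_complex_ofReal]
    refine integral_congr_ae (Filter.Eventually.of_forall fun x => ?_)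
    simp [inner_self_eq_norm_sq_to_K]
  exact_mod_cast h1

/-- The function `(k₀, …, kₙ) ↦ g(k₀) F(k₁, …, kₙ)`. -/
def tensFun (g : Photon → ℂ) (F : (Fin n → Photon) → ℂ) (k : Fin (n + 1) → Photon) : ℂ :=
  g (k 0) * F fun j => k j.succ

theorem measurePreserving_headTail (n : ℕ) :
    MeasurePreserving (fun k : Fin (n + 1) → Photon => (k 0, fun j : Fin n => k j.succ))
      (photonMeasureN (n + 1)) (photonMeasure.prod (photonMeasureN n)) := by
  have h := measurePreserving_piFinSuccAbove (fun _ : Fin (n + 1) => photonMeasure) 0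
  have h2 : (fun k : Fin (n + 1) → Photon => (k 0, fun j : Fin n => k j.succ)) =
      MeasurableEquiv.piFinSuccAbove (fun _ : Fin (n + 1) => Photon) 0 := by
    funext k
    rfl
  rw [h2]
  exact h

theorem quasi_head (n : ℕ) :
    Measure.QuasiMeasurePreserving (fun k : Fin (n + 1) → Photon => k 0) (photonMeasureN (n + 1))
      photonMeasure :=
  Measure.quasiMeasurePreserving_fst.comp (measurePreserving_headTail n).quasiMeasurePreserving

theorem quasi_tail (n : ℕ) :
    Measure.QuasiMeasurePreserving (fun (k : Fin (n + 1) → Photon) (j : Fin n) => k j.succ)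
      (photonMeasureN (n + 1)) (photonMeasureN n) :=
  Measure.quasiMeasurePreserving_snd.comp (measurePreserving_headTail n).quasiMeasurePreserving

theorem memLp_tensFun {g : Photon → ℂ} {F : (Fin n → Photon) → ℂ} (hg : MemLp g 2 photonMeasure)
    (hF : MemLp F 2 (photonMeasureN n)) : MemLp (tensFun g F) 2 (photonMeasureN (n + 1)) :=
  (memLp_mul_prod hg hF).comp_measurePreserving (measurePreserving_headTail n)

theorem norm_toLp_tensFun (g : Lp ℂ 2 photonMeasure) (F : Lp ℂ 2 (photonMeasureN n)) :
    ‖(memLp_tensFun (Lp.memLp g) (Lp.memLp F)).toLp _‖ = ‖g‖ * ‖F‖ := by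
  have h : ‖(memLp_tensFun (Lp.memLp g) (Lp.memLp F)).toLp _‖ ^ 2 = (‖g‖ * ‖F‖) ^ 2 := by
    rw [norm_sq_eq_integral, mul_pow, norm_sq_eq_integral g, norm_sq_eq_integral F,
      ← integral_norm_sq_mul_prod,
      ← (measurePreserving_piFinSuccAbove (fun _ : Fin (n + 1) => photonMeasure) 0).integral_comp']
    refine integral_congr_ae ?_
    filter_upwards [(memLp_tensFun (Lp.memLp g) (Lp.memLp F)).coeFn_toLp] with k hk
    rw [hk]
    rfl
  exact (pow_left_inj₀ (norm_nonneg _) (by positivity) two_ne_zero).1 h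

variable (n) in
/-- The tensor product `g ⊗ F`, as a continuous bilinear map. -/
def tens : Lp ℂ 2 photonMeasure →L[ℂ] Lp ℂ 2 (photonMeasureN n) →L[ℂ]
    Lp ℂ 2 (photonMeasureN (n + 1)) :=
  LinearMap.mkContinuous₂
    (LinearMap.mk₂ ℂ (fun g F => (memLp_tensFun (Lp.memLp g) (Lp.memLp F)).toLp _)
      (fun g g' F => by
        rw [← MemLp.toLp_add]
        refine MemLp.toLp_congr _ _ ?_
        filter_upwards [(quasi_head n).ae (Lp.coeFn_add g g')] with k hk
        simp only [tensFun, hk, Pi.add_apply, add_mul])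
      (fun c g F => by
        rw [← MemLp.toLp_const_smul]
        refine MemLp.toLp_congr _ _ ?_
        filter_upwards [(quasi_head n).ae (Lp.coeFn_smul c g)] with k hk
        simp only [tensFun, hk, Pi.smul_apply, smul_eq_mul, mul_assoc])
      (fun g F F' => by
        rw [← MemLp.toLp_add]
        refine MemLp.toLp_congr _ _ ?_
        filter_upwards [(quasi_tail n).ae (Lp.coeFn_add F F')] with k hk
        simp only [tensFun, hk, Pi.add_apply, mul_add])
      (fun c g F => by
        rw [← MemLp.toLp_const_smul]
        refine MemLp.toLp_congr _ _ ?_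
        filter_upwards [(quasi_tail n).ae (Lp.coeFn_smul c F)] with k hk
        simp only [tensFun, hk, Pi.smul_apply, smul_eq_mul]
        ring))
    1 fun g F => by
      rw [one_mul]
      exact (norm_toLp_tensFun g F).le

theorem coeFn_tens (g : Lp ℂ 2 photonMeasure) (F : Lp ℂ 2 (photonMeasureN n)) :
    tens n g F =ᵐ[photonMeasureN (n + 1)] tensFun g F :=
  (memLp_tensFun (Lp.memLp g) (Lp.memLp F)).coeFn_toLp

theorem norm_tens (g : Lp ℂ 2 photonMeasure) (F : Lp ℂ 2 (photonMeasureN n)) :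
    ‖tens n g F‖ = ‖g‖ * ‖F‖ := norm_toLp_tensFun g F

attribute [irreducible] tens

end Tensor

/-! ### Creation operators on the `n`-photon spaces -/

section Creation

variable {n : ℕ}

/-- The action of a permutation on `n`-photon functions. -/
def permOp (σ : Equiv.Perm (Fin n)) :
    Lp ℂ 2 (photonMeasureN n) →ₗᵢ[ℂ] Lp ℂ 2 (photonMeasureN n) :=
  Lp.compMeasurePreservingₗᵢ ℂ (fun (k : Fin n → Photon) i => k (σ i)) (measurePreserving_perm n σ)

theorem coeFn_permOp (σ : Equiv.Perm (Fin n)) (F : Lp ℂ 2 (photonMeasureN n)) :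
    permOp σ F =ᵐ[photonMeasureN n] fun k => F fun i => k (σ i) :=
  Lp.coeFn_compMeasurePreserving F (measurePreserving_perm n σ)

theorem mem_symL2_iff_permOp {F : Lp ℂ 2 (photonMeasureN n)} :
    F ∈ symL2 n ↔ ∀ σ, permOp σ F = F := by
  rw [symL2, Submodule.mem_iInf]
  rfl

/-- The permutation of `{0, …, n}` which sends `0` to `i` and is increasing on `{1, …, n}`. -/
def frontPerm (i : Fin (n + 1)) : Equiv.Perm (Fin (n + 1)) := i.cycleRange.symm

theorem frontPerm_zero (i : Fin (n + 1)) : frontPerm i 0 = i := Fin.cycleRange_symm_zero i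

theorem frontPerm_succ (i : Fin (n + 1)) (j : Fin n) : frontPerm i j.succ = i.succAbove j :=
  Fin.cycleRange_symm_succ i j

/-- The sum of the terms `g(kᵢ) F(k₀, …, k̂ᵢ, …, kₙ)`. -/
def symTens (g : Lp ℂ 2 photonMeasure) :
    Lp ℂ 2 (photonMeasureN n) →L[ℂ] Lp ℂ 2 (photonMeasureN (n + 1)) :=
  ∑ i : Fin (n + 1), (permOp (frontPerm i)).toContinuousLinearMap.comp (tens n g)

theorem symTens_apply (g : Lp ℂ 2 photonMeasure) (F : Lp ℂ 2 (photonMeasureN n)) :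
    symTens g F = ∑ i : Fin (n + 1), permOp (frontPerm i) (tens n g F) := by
  simp [symTens]

theorem coeFn_finset_sum {X : Type*} [MeasurableSpace X] {μ : Measure X} {ι : Type*}
    (s : Finset ι) (f : ι → Lp ℂ 2 μ) :
    ⇑(∑ i ∈ s, f i) =ᵐ[μ] fun x => ∑ i ∈ s, f i x := by
  classical
  induction s using Finset.induction_on with
  | empty =>
    rw [Finset.sum_empty]
    filter_upwards [Lp.coeFn_zero ℂ 2 μ] with x hx
    rw [hx, Pi.zero_apply, Finset.sum_empty]
  | insert a s ha ih =>
    rw [Finset.sum_insert ha]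
    filter_upwards [Lp.coeFn_add (f a) (∑ i ∈ s, f i), ih] with x h1 h2
    rw [h1, Pi.add_apply, h2, Finset.sum_insert ha]

theorem coeFn_permOp_tens (i : Fin (n + 1)) (g : Lp ℂ 2 photonMeasure)
    (F : Lp ℂ 2 (photonMeasureN n)) :
    permOp (frontPerm i) (tens n g F) =ᵐ[photonMeasureN (n + 1)]
      fun k => g (k i) * F fun j => k (i.succAbove j) := by
  filter_upwards [coeFn_permOp (frontPerm i) (tens n g F),
    (measurePreserving_perm (n + 1) (frontPerm i)).quasiMeasurePreserving.ae (coeFn_tens g F)]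
    with k h1 h2
  rw [h1, h2, tensFun, frontPerm_zero]
  simp only [frontPerm_succ]

theorem coeFn_symTens (g : Lp ℂ 2 photonMeasure) (F : Lp ℂ 2 (photonMeasureN n)) :
    symTens g F =ᵐ[photonMeasureN (n + 1)]
      fun k => ∑ i, g (k i) * F fun j => k (i.succAbove j) := by
  rw [symTens_apply]
  filter_upwards [coeFn_finset_sum Finset.univ fun i => permOp (frontPerm i) (tens n g F),
    ae_all_iff.2 fun i => coeFn_permOp_tens i g F] with k h1 h2
  rw [h1]
  exact Finset.sum_congr rfl fun i _ => h2 i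

/-- The permutation `τ` with `σ (i.succAbove j) = (σ i).succAbove (τ j)`. -/
theorem exists_perm_succAbove (σ : Equiv.Perm (Fin (n + 1))) (i : Fin (n + 1)) :
    ∃ τ : Equiv.Perm (Fin n), ∀ j, σ (i.succAbove j) = (σ i).succAbove (τ j) := by
  have h : ∀ j, ∃ l, (σ i).succAbove l = σ (i.succAbove j) := fun j =>
    Fin.exists_succAbove_eq fun h => Fin.succAbove_ne i j (σ.injective h)
  choose τ hτ using h
  have hinj : Function.Injective τ := fun a b hab => by
    have h1 : σ (i.succAbove a) = σ (i.succAbove b) := by rw [← hτ a, ← hτ b, hab]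
    exact Fin.succAbove_right_injective (σ.injective h1)
  exact ⟨Equiv.ofBijective τ (Finite.injective_iff_bijective.1 hinj), fun j => (hτ j).symm⟩

/-- A permutation `σ` moves the term in which slot `i` is singled out to the one with slot `σ i`. On
the remaining slots it induces a permutation `τ`, under which `F` is invariant. -/
theorem symTens_mem (g : Lp ℂ 2 photonMeasure) {F : Lp ℂ 2 (photonMeasureN n)}
    (hF : F ∈ symL2 n) : symTens g F ∈ symL2 (n + 1) := by
  rw [mem_symL2_iff] at hF ⊢
  intro σ
  choose τ hτ using exists_perm_succAbove σ
  have h1 : ∀ᵐ k ∂photonMeasureN (n + 1), ∀ i : Fin (n + 1),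
      F (fun j => k (i.succAbove (τ (σ.symm i) j))) = F fun j => k (i.succAbove j) :=
    ae_all_iff.2 fun i => (quasi_removeNth n i).ae (hF (τ (σ.symm i)))
  filter_upwards [coeFn_symTens g F, h1, (measurePreserving_perm (n + 1)
    σ).quasiMeasurePreserving.ae (coeFn_symTens g F)] with k h2 h3 h4
  rw [h4, h2]
  refine Fintype.sum_equiv σ _ _ fun i => ?_
  have h5 := h3 (σ i)
  rw [Equiv.symm_apply_apply] at h5
  simp only [hτ]
  rw [h5]

variable (n) in
/-- The creation operator from the `n`-photon space to the `n+1`-photon space, as a continuous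
bilinear map. -/
def sectorCreation : Lp ℂ 2 photonMeasure →L[ℂ] symL2 n →L[ℂ] symL2 (n + 1) :=
  LinearMap.mkContinuous₂
    (LinearMap.mk₂ ℂ
      (fun g F => ((√((n : ℝ) + 1) : ℝ) : ℂ)⁻¹ •
        (⟨symTens g F, symTens_mem g F.2⟩ : symL2 (n + 1)))
      (fun g g' F => by
        rw [← smul_add]
        congr 1
        refine Subtype.ext ?_
        simp [symTens_apply, Finset.sum_add_distrib])
      (fun c g F => by
        rw [smul_comm]
        congr 1
        refine Subtype.ext ?_
        simp [symTens_apply, Finset.smul_sum])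
      (fun g F F' => by
        rw [← smul_add]
        congr 1
        refine Subtype.ext ?_
        simp [symTens_apply, Finset.sum_add_distrib])
      (fun c g F => by
        rw [smul_comm]
        congr 1
        refine Subtype.ext ?_
        simp [symTens_apply, Finset.smul_sum]))
    (‖((√((n : ℝ) + 1) : ℝ) : ℂ)⁻¹‖ * (n + 1)) fun g F => by
      rw [LinearMap.mk₂_apply, norm_smul, mul_assoc, mul_assoc]
      refine mul_le_mul_of_nonneg_left ?_ (norm_nonneg _)
      have h : ‖symTens g (F : Lp ℂ 2 (photonMeasureN n))‖ ≤ (n + 1) * (‖g‖ * ‖F‖) := by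
        rw [symTens_apply]
        refine (norm_sum_le _ _).trans ?_
        simp [norm_tens]
      exact h

theorem coe_sectorCreation (g : Lp ℂ 2 photonMeasure) (F : symL2 n) :
    (sectorCreation n g F : Lp ℂ 2 (photonMeasureN (n + 1))) =
      ((√((n : ℝ) + 1) : ℝ) : ℂ)⁻¹ • symTens g (F : Lp ℂ 2 (photonMeasureN n)) := rfl

theorem coeFn_sectorCreation (g : Lp ℂ 2 photonMeasure) (F : symL2 n) :
    (sectorCreation n g F : Lp ℂ 2 (photonMeasureN (n + 1))) =ᵐ[photonMeasureN (n + 1)] fun k =>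
      ((√((n : ℝ) + 1) : ℝ) : ℂ)⁻¹ *
        ∑ i, g (k i) * (F : Lp ℂ 2 (photonMeasureN n)) fun j => k (i.succAbove j) := by
  rw [coe_sectorCreation]
  filter_upwards [Lp.coeFn_smul ((√((n : ℝ) + 1) : ℝ) : ℂ)⁻¹
    (symTens g (F : Lp ℂ 2 (photonMeasureN n))), coeFn_symTens g F] with k h1 h2
  rw [h1, Pi.smul_apply, h2, smul_eq_mul]

attribute [irreducible] sectorCreation symTens permOp

theorem quasi_eval (n : ℕ) (i : Fin (n + 1)) :
    Measure.QuasiMeasurePreserving (fun k : Fin (n + 1) → Photon => k i) (photonMeasureN (n + 1))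
      photonMeasure := by
  have h := (quasi_head n).comp
    (measurePreserving_perm (n + 1) (frontPerm i)).quasiMeasurePreserving
  simpa only [Function.comp_def, frontPerm_zero] using h

theorem coeFn_sectorCreation_toLp {g : Photon → ℂ} (hg : MemLp g 2 photonMeasure) (F : symL2 n) :
    (sectorCreation n (hg.toLp g) F : Lp ℂ 2 (photonMeasureN (n + 1)))
      =ᵐ[photonMeasureN (n + 1)] fun k => ((√((n : ℝ) + 1) : ℝ) : ℂ)⁻¹ *
        ∑ i, g (k i) * (F : Lp ℂ 2 (photonMeasureN n)) fun j => k (i.succAbove j) := by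
  filter_upwards [coeFn_sectorCreation (hg.toLp g) F, ae_all_iff.2 fun i =>
    (quasi_eval n i).ae hg.coeFn_toLp] with k h1 h2
  rw [h1]
  simp only [h2]

theorem mem_graph_creation_iff_ae (g : Photon → ℂ) (ψ φ : Fock) :
    (ψ, φ) ∈ (creation g).graph ↔ φ 0 = 0 ∧ ∀ n, comp φ (n + 1) =ᵐ[photonMeasureN (n + 1)] fun k =>
        ((√((n : ℝ) + 1) : ℝ) : ℂ)⁻¹ * ∑ i, g (k i) * comp ψ n fun j => k (i.succAbove j) := by
  rw [creation, Submodule.toLinearPMap_graph_eq]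
  · rfl
  · rintro ⟨ψ, φ⟩ ⟨h0, h⟩ (rfl : ψ = 0)
    refine fock_ext fun n => ?_
    cases n with
    | zero =>
      have h1 : φ 0 = (0 : Fock) 0 := h0
      have h2 : comp φ 0 = comp 0 0 := by rw [comp, comp, h1]
      rw [h2]
    | succ n =>
      have h' : ∀ i : Fin (n + 1), ∀ᵐ k ∂photonMeasureN (n + 1),
          comp 0 n (fun j => k (i.succAbove j)) = 0 :=
        fun i => (quasi_removeNth n i).ae (comp_zero n)
      filter_upwards [h n, comp_zero (n + 1), ae_all_iff.2 h'] with k h1 h2 h3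
      rw [h1, h2]
      simp [h3]

theorem mem_graph_creation {g : Photon → ℂ} (hg : MemLp g 2 photonMeasure) (ψ φ : Fock) :
    (ψ, φ) ∈ (creation g).graph ↔
      φ 0 = 0 ∧ ∀ n, φ (n + 1) = sectorCreation n (hg.toLp g) (ψ n) := by
  rw [mem_graph_creation_iff_ae]
  refine and_congr_right fun _ => forall_congr' fun n => ?_
  have h1 := coeFn_sectorCreation_toLp hg (ψ n)
  constructor
  · intro h
    exact Subtype.ext (Lp.ext (h.trans h1.symm))
  · intro h
    have h2 : comp φ (n + 1) = ((sectorCreation n (hg.toLp g) (ψ n) :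
      Lp ℂ 2 (photonMeasureN (n + 1))) : _ → ℂ) := by rw [comp, h]
    rw [h2]
    exact h1

end Creation

/-! ### Vectors with finitely many photons -/

section Finite

/-- The Fock vector with components `F n` for `n < N`, and `0` for `n ≥ N`. -/
def ofSectors (N : ℕ) (F : ∀ n, symL2 n) : Fock := ∑ n ∈ Finset.range N, lp.single 2 n (F n)

theorem ofSectors_apply (N : ℕ) (F : ∀ n, symL2 n) (n : ℕ) :
    ofSectors N F n = if n < N then F n else 0 := by
  rw [ofSectors, lp.coeFn_sum, Finset.sum_apply]
  simp only [lp.single_apply]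
  rw [Finset.sum_pi_single]
  simp

theorem continuous_ofSectors {X : Type*} [TopologicalSpace X] (N : ℕ) {F : X → ∀ n, symL2 n}
    (hF : ∀ n, Continuous fun x => F x n) : Continuous fun x => ofSectors N (F x) := by
  unfold ofSectors
  exact continuous_finsetSum _ fun n _ => (lp.isometry_single n).continuous.comp (hF n)

attribute [irreducible] ofSectors

theorem dense_of_finite {S : Set Fock}
    (hS : ∀ ψ : Fock, (∃ N, ∀ n, N ≤ n → ψ n = 0) → ψ ∈ S) : Dense S := by
  intro ψ
  have h := (lp.hasSum_single (by norm_num : (2 : ENNReal) ≠ ⊤) ψ).tendsto_sum_nat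
  refine mem_closure_of_tendsto h (Filter.Eventually.of_forall fun N => hS _ ⟨N, fun n hn => ?_⟩)
  rw [lp.coeFn_sum, Finset.sum_apply]
  simp only [lp.single_apply]
  rw [Finset.sum_pi_single]
  simp [hn]

/-- The components of `a*(g) ψ`. -/
def creationSectors (g : Lp ℂ 2 photonMeasure) (ψ : Fock) : ∀ n, symL2 n
  | 0 => 0
  | n + 1 => sectorCreation n g (ψ n)

/-- The components of `a(g) ψ`. -/
def annihilationSectors (g : Lp ℂ 2 photonMeasure) (ψ : Fock) (n : ℕ) : symL2 n :=
  (sectorCreation n g).adjoint (ψ (n + 1))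

theorem continuous_creationSectors (ψ : Fock) (n : ℕ) :
    Continuous fun g => creationSectors g ψ n := by
  cases n with
  | zero => exact continuous_const
  | succ n => exact (sectorCreation n).continuous.clm_apply continuous_const

theorem continuous_adjoint_apply {X H H' : Type*} [TopologicalSpace X] [NormedAddCommGroup H]
    [InnerProductSpace ℂ H] [CompleteSpace H] [NormedAddCommGroup H'] [InnerProductSpace ℂ H']
    [CompleteSpace H'] {T : X → H →L[ℂ] H'} (hT : Continuous T) (v : H') :
    Continuous fun x => (T x).adjoint v :=
  (ContinuousLinearMap.adjoint.continuous.comp hT).clm_apply continuous_const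

theorem continuous_annihilationSectors (ψ : Fock) (n : ℕ) :
    Continuous fun g => annihilationSectors g ψ n :=
  continuous_adjoint_apply (sectorCreation n).continuous (ψ (n + 1))

variable {g : Photon → ℂ} (hg : MemLp g 2 photonMeasure)

theorem ofSectors_mem_graph_creation {ψ : Fock} {N : ℕ} (hψ : ∀ n, N ≤ n → ψ n = 0) :
    (ψ, ofSectors (N + 1) (creationSectors (hg.toLp g) ψ)) ∈ (creation g).graph := by
  rw [mem_graph_creation hg]
  refine ⟨by rw [ofSectors_apply]; rfl, fun n => ?_⟩
  rw [ofSectors_apply]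
  split_ifs with h
  · rfl
  · rw [hψ n (by omega), map_zero]

include hg in
theorem creation_dense : Dense ((creation g).domain : Set Fock) :=
  dense_of_finite fun _ ⟨_, hN⟩ => LinearPMap.mem_domain_of_mem_graph
    (ofSectors_mem_graph_creation hg hN)

/-- On vectors with finitely many photons the adjoint of `a*(g)` is computed sector by sector. -/
theorem ofSectors_mem_graph_annihilation {ψ : Fock} {N : ℕ} (hψ : ∀ n, N ≤ n → ψ n = 0) :
    (ψ, ofSectors N (annihilationSectors (hg.toLp g) ψ)) ∈ (annihilation g).graph := by
  rw [annihilation, mem_graph_adjoint_iff (creation_dense hg)]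
  intro x w hxw
  rw [mem_graph_creation hg] at hxw
  -- The vector `w = a*(g) x` has no vacuum component, so the sum over sectors may start at one;
  -- this produces the shift between `ψ (n + 1)` and `x n`.
  have h1 := (hasSum_nat_add_iff' 1).2 (lp.hasSum_inner (𝕜 := ℂ) w ψ)
  have h2 := lp.hasSum_inner (𝕜 := ℂ) x (ofSectors N (annihilationSectors (hg.toLp g) ψ))
  rw [Finset.sum_range_one, hxw.1, inner_zero_left, sub_zero] at h1
  suffices h3 : (fun n => ⟪w (n + 1), ψ (n + 1)⟫_ℂ) = fun n =>
      ⟪x n, ofSectors N (annihilationSectors (hg.toLp g) ψ) n⟫_ℂ by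
    rw [h3] at h1
    exact h1.unique h2
  funext n
  rw [hxw.2 n, ofSectors_apply]
  split_ifs with h
  · rw [annihilationSectors, ContinuousLinearMap.adjoint_inner_right]
  · rw [hψ (n + 1) (by omega), inner_zero_right, inner_zero_right]

end Finite

/-! ### The vector potential -/

section Potential

theorem mem_graph_smul_add {H : Type*} [NormedAddCommGroup H] [InnerProductSpace ℂ H] (c : ℂ)
    (A B : H →ₗ.[ℂ] H) (x y : H) : (x, y) ∈ (c • (A + B)).graph ↔
      ∃ a b, (x, a) ∈ A.graph ∧ (x, b) ∈ B.graph ∧ y = c • (a + b) := by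
  constructor
  · intro h
    obtain ⟨z, hz, hy⟩ := (LinearPMap.mem_graph_iff _).1 h
    refine ⟨A ⟨z, z.2.1⟩, B ⟨z, z.2.2⟩, ?_, ?_, ?_⟩
    · rw [← show (z : H) = x from hz]; exact LinearPMap.mem_graph A ⟨z, z.2.1⟩
    · rw [← show (z : H) = x from hz]; exact LinearPMap.mem_graph B ⟨z, z.2.2⟩
    · exact hy.symm
  · rintro ⟨a, b, ha, hb, rfl⟩
    obtain ⟨z, hz, rfl⟩ := (LinearPMap.mem_graph_iff _).1 ha
    obtain ⟨z', hz', rfl⟩ := (LinearPMap.mem_graph_iff _).1 hb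
    refine (LinearPMap.mem_graph_iff _).2 ⟨⟨x, ?_, ?_⟩, rfl, ?_⟩
    · rw [← show (z : H) = x from hz]; exact z.2
    · rw [← show (z' : H) = x from hz']; exact z'.2
    · rw [LinearPMap.smul_apply, LinearPMap.add_apply]
      congr 2
      · congr 1; exact Subtype.ext hz.symm
      · congr 1; exact Subtype.ext hz'.symm

/-- Multiplication by `e^{i k·q}` on one-photon functions. -/
theorem isMultiplier_planeWave_fst (k : Rd 3) : IsMultiplier fun q : Photon => planeWave k q.1 :=
  ⟨(isMultiplier_planeWave k).measurable.comp measurable_fst, 1, fun q => (norm_planeWave k q.1).le⟩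

theorem continuous_mulOp_planeWave_fst (F : Lp ℂ 2 photonMeasure) :
    Continuous fun k => mulOp photonMeasure ℂ (isMultiplier_planeWave_fst k) F := by
  rw [continuous_iff_continuousAt]
  intro k₀
  rw [ContinuousAt, tendsto_iff_norm_sub_tendsto_zero, ← tendsto_zero_iff_norm_tendsto_zero]
  have hm : ∀ k : Rd 3, IsMultiplier fun q : Photon => planeWave k q.1 - planeWave k₀ q.1 :=
    fun k => ⟨(isMultiplier_planeWave_fst k).measurable.sub
      (isMultiplier_planeWave_fst k₀).measurable, 2,
      fun x => (norm_sub_le _ _).trans (by rw [norm_planeWave, norm_planeWave]; norm_num)⟩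
  have hsub : ∀ k, mulOp photonMeasure ℂ (isMultiplier_planeWave_fst k) F -
      mulOp photonMeasure ℂ (isMultiplier_planeWave_fst k₀) F = mulOp photonMeasure ℂ (hm k) F :=
    fun k => sub_mulOp _ _ _ (fun x => rfl) F
  simp_rw [hsub]
  refine tendsto_mulOp_zero hm (C := 2) (fun k x => (norm_sub_le _ _).trans
    (by rw [norm_planeWave, norm_planeWave]; norm_num)) (fun x => ?_) F
  have hc : Continuous fun k : Rd 3 => planeWave k x.1 - planeWave k₀ x.1 :=
    (continuous_planeWave.comp (by fun_prop : Continuous fun k : Rd 3 => (k, x.1))).sub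
      continuous_const
  simpa using hc.tendsto k₀

variable {Λ : Rd 3 → ℝ} {e : Fin 2 → Rd 3 → Rd 3}

/-- The point `x` enters only through a plane wave. Both the continuity of `A_j(x) η` in `x` and the
covariance of `A_j` under translations come from this. -/
theorem coupling_eq (j : Fin 3) (x : Rd 3) (q : Photon) :
    coupling Λ e j x q = planeWave (-x) q.1 * coupling Λ e j 0 q := by
  simp only [coupling, planeWave, inner_neg_left, inner_zero_right, Complex.ofReal_zero, zero_mul,
    neg_zero, Complex.exp_zero, mul_one, Complex.ofReal_neg, neg_mul, real_inner_comm q.1 x]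
  ring

theorem planeWave_mul_coupling (j : Fin 3) (k x : Rd 3) (q : Photon) :
    planeWave k q.1 * coupling Λ e j (x + k) q = coupling Λ e j x q := by
  rw [coupling_eq, coupling_eq j x, ← mul_assoc, ← planeWave_add]
  congr 2
  abel

/-- The components of the unit vectors `e l k` are at most 1, so the coupling function is dominated
by `Λ(k) |k|^{-1/2}`. The two polarizations carry a finite measure. -/
theorem memLp_coupling (hΛ' : MemLp (fun k => Λ k / √‖k‖) 2 volume) (he : ∀ l, Measurable (e l))
    (hn : ∀ l k, ‖e l k‖ = 1) (j : Fin 3) (x : Rd 3) :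
    MemLp (coupling Λ e j x) 2 photonMeasure := by
  have hfst : MemLp (fun q : Photon => Λ q.1 / √‖q.1‖) 2 photonMeasure := by
    exact hΛ'.comp_fst _
  have hmeas : Measurable fun q : Photon => e q.2 q.1 j := by
    refine measurable_from_prod_countable_left fun l => ?_
    exact (EuclideanSpace.proj j : Rd 3 →L[ℝ] ℝ).continuous.measurable.comp (he l)
  refine hfst.of_le ?_ (Filter.Eventually.of_forall fun q => ?_)
  · refine AEStronglyMeasurable.mul ?_ (Continuous.aestronglyMeasurable (by fun_prop))
    exact Complex.continuous_ofReal.comp_aestronglyMeasurable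
      (hfst.1.mul hmeas.aestronglyMeasurable)
  · have h1 : ‖Complex.exp (-(((inner ℝ q.1 x : ℝ) : ℂ) * Complex.I))‖ = 1 := by
      rw [← neg_mul, ← Complex.ofReal_neg, Complex.norm_exp_ofReal_mul_I]
    have h2 : ‖e q.2 q.1 j‖ ≤ 1 := (PiLp.norm_apply_le _ _).trans (hn _ _).le
    rw [coupling, norm_mul, h1, mul_one, Complex.norm_real, norm_mul]
    exact mul_le_of_le_one_right (norm_nonneg _) h2

theorem toLp_coupling (j : Fin 3) (hc : ∀ x, MemLp (coupling Λ e j x) 2 photonMeasure) (x : Rd 3) :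
    (hc x).toLp _ = mulOp photonMeasure ℂ (isMultiplier_planeWave_fst (-x)) ((hc 0).toLp _) := by
  refine Lp.ext ?_
  filter_upwards [(hc x).coeFn_toLp, (hc 0).coeFn_toLp,
    coeFn_mulOp (isMultiplier_planeWave_fst (-x)) ((hc 0).toLp _)] with q h1 h2 h3
  rw [h1, h3, h2, coupling_eq, smul_eq_mul]

theorem continuous_toLp_coupling (j : Fin 3)
    (hc : ∀ x, MemLp (coupling Λ e j x) 2 photonMeasure) :
    Continuous fun x => (hc x).toLp _ := by
  have h : (fun x => (hc x).toLp _) = fun x =>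
      mulOp photonMeasure ℂ (isMultiplier_planeWave_fst (-x)) ((hc 0).toLp _) :=
    funext (toLp_coupling j hc)
  rw [h]
  exact (continuous_mulOp_planeWave_fst _).comp continuous_neg

/-- On vectors with finitely many photons, `A_j(x) η` is defined and continuous in `x`. -/
theorem exists_continuous_vectorPotential (j : Fin 3)
    (hc : ∀ x, MemLp (coupling Λ e j x) 2 photonMeasure) {η : Fock} {N : ℕ}
    (hη : ∀ n, N ≤ n → η n = 0) : ∃ ξ : Rd 3 → Fock,
      (∀ x, (η, ξ x) ∈ (vectorPotential Λ e j x).graph) ∧ Continuous ξ := by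
  refine ⟨fun x => (((√2 : ℝ) : ℂ)⁻¹) • (ofSectors N (annihilationSectors ((hc x).toLp _) η) +
    ofSectors (N + 1) (creationSectors ((hc x).toLp _) η)), fun x => ?_, ?_⟩
  · rw [vectorPotential, mem_graph_smul_add]
    exact ⟨_, _, ofSectors_mem_graph_annihilation (hc x) hη,
      ofSectors_mem_graph_creation (hc x) hη, rfl⟩
  · have h1 : Continuous fun x => ofSectors N (annihilationSectors ((hc x).toLp _) η) :=
      continuous_ofSectors N fun n =>
        (continuous_annihilationSectors η n).comp (continuous_toLp_coupling j hc)
    have h2 : Continuous fun x => ofSectors (N + 1) (creationSectors ((hc x).toLp _) η) :=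
      continuous_ofSectors (N + 1) fun n =>
        (continuous_creationSectors η n).comp (continuous_toLp_coupling j hc)
    exact (h1.add h2).const_smul (((√2 : ℝ) : ℂ)⁻¹)

theorem phase_succAbove (k : Rd 3) {n : ℕ} (q : Fin (n + 1) → Photon) (i : Fin (n + 1)) :
    phase k (n + 1) q = planeWave k (q i).1 * phase k n fun j => q (i.succAbove j) := by
  rw [phase, phase, planeWave, ← Complex.exp_add, totalMomentum, Fin.sum_univ_succAbove _ i,
    totalMomentum]
  push_cast
  ring_nf

theorem fieldTranslation_apply_eq_zero (k : Rd 3) {ψ : Fock} {n : ℕ} (h : ψ n = 0) :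
    fieldTranslation k ψ n = 0 := by
  refine Subtype.ext (Lp.ext ?_)
  have h1 : comp ψ n =ᵐ[photonMeasureN n] 0 := by
    rw [comp, h]
    exact Lp.coeFn_zero _ _ _
  filter_upwards [comp_fieldTranslation k ψ n, h1, Lp.coeFn_zero ℂ 2 (photonMeasureN n)]
    with q h2 h3 h4
  refine h2.trans ?_
  rw [h3, Pi.zero_apply, mul_zero]
  exact h4.symm

/-- The phase of `n + 1` photons is the plane wave of the created photon times the phase of the
others. Hence `e^{ik·P_f} a*(g) = a*(e^{ik·q} g) e^{ik·P_f}`, `q` denoting the photon momentum. -/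
theorem fieldTranslation_mem_graph_creation (k : Rd 3) {g : Photon → ℂ} {ψ φ : Fock}
    (h : (ψ, φ) ∈ (creation g).graph) : (fieldTranslation k ψ, fieldTranslation k φ) ∈
      (creation fun q => planeWave k q.1 * g q).graph := by
  rw [mem_graph_creation_iff_ae] at h ⊢
  refine ⟨fieldTranslation_apply_eq_zero k h.1, fun n => ?_⟩
  have h' : ∀ i : Fin (n + 1), ∀ᵐ q ∂photonMeasureN (n + 1),
      comp (fieldTranslation k ψ) n (fun j => q (i.succAbove j)) =
        phase k n (fun j => q (i.succAbove j)) * comp ψ n (fun j => q (i.succAbove j)) :=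
    fun i => (quasi_removeNth n i).ae (comp_fieldTranslation k ψ n)
  filter_upwards [comp_fieldTranslation k φ (n + 1), h.2 n, ae_all_iff.2 h'] with q h1 h2 h3
  rw [h1, h2, mul_left_comm, Finset.mul_sum]
  congr 1
  refine Finset.sum_congr rfl fun i _ => ?_
  rw [h3, phase_succAbove k q i]
  ring

/-- The adjoint relation for `A'` is tested on pairs of its graph, and `U'` carries these into the
graph of `A`. -/
theorem map_mem_graph_adjoint {H : Type*} [NormedAddCommGroup H] [InnerProductSpace ℂ H]
    [CompleteSpace H] {A A' : H →ₗ.[ℂ] H} (hA : Dense (A.domain : Set H))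
    (hA' : Dense (A'.domain : Set H)) {U U' : H →L[ℂ] H} (hU : ∀ x y, ⟪U' x, y⟫_ℂ = ⟪x, U y⟫_ℂ)
    (h : ∀ x w, (x, w) ∈ A'.graph → (U' x, U' w) ∈ A.graph) {ψ φ : H}
    (hψ : (ψ, φ) ∈ A.adjoint.graph) : (U ψ, U φ) ∈ A'.adjoint.graph := by
  rw [mem_graph_adjoint_iff hA] at hψ
  rw [mem_graph_adjoint_iff hA']
  intro x w hxw
  rw [← hU, ← hU]
  exact hψ _ _ (h x w hxw)

theorem map_mem_graph_smul_add {H : Type*} [NormedAddCommGroup H] [InnerProductSpace ℂ H] (c : ℂ)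
    {A A' B B' : H →ₗ.[ℂ] H} {U : H →L[ℂ] H} {x : H}
    (hA : ∀ y, (x, y) ∈ A.graph → (U x, U y) ∈ A'.graph)
    (hB : ∀ y, (x, y) ∈ B.graph → (U x, U y) ∈ B'.graph) {y : H}
    (h : (x, y) ∈ (c • (A + B)).graph) : (U x, U y) ∈ (c • (A' + B')).graph := by
  rw [mem_graph_smul_add] at h ⊢
  obtain ⟨a, b, ha, hb, rfl⟩ := h
  exact ⟨U a, U b, hA a ha, hB b hb, by rw [map_smul, map_add]⟩

theorem fieldTranslation_mem_graph_creation' (k : Rd 3) {g g' : Photon → ℂ}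
    (hgg' : ∀ q, g' q = planeWave k q.1 * g q) {ψ φ : Fock} (h : (ψ, φ) ∈ (creation g).graph) :
    (fieldTranslation k ψ, fieldTranslation k φ) ∈ (creation g').graph := by
  rw [funext hgg']
  exact fieldTranslation_mem_graph_creation k h

theorem inner_fieldTranslation_neg (k : Rd 3) (x y : Fock) :
    ⟪fieldTranslation (-k) x, y⟫_ℂ = ⟪x, fieldTranslation k y⟫_ℂ := by
  have h := inner_fieldTranslation (-k) x y
  rwa [neg_neg] at h

theorem fieldTranslation_mem_graph_annihilation (k : Rd 3) {g g' : Photon → ℂ}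
    (hg : MemLp g 2 photonMeasure) (hg' : MemLp g' 2 photonMeasure)
    (hgg' : ∀ q, g' q = planeWave k q.1 * g q) {ψ φ : Fock}
    (h : (ψ, φ) ∈ (annihilation g).graph) : (fieldTranslation k ψ, fieldTranslation k φ) ∈
      (annihilation g').graph := by
  refine map_mem_graph_adjoint (creation_dense hg) (creation_dense hg')
    (inner_fieldTranslation_neg k) (fun x w hxw => ?_) h
  refine fieldTranslation_mem_graph_creation' (-k) (fun q => ?_) hxw
  rw [hgg', ← mul_assoc, ← planeWave_add, neg_add_cancel, planeWave_zero, one_mul]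

/-- The factor `e^{ik·q}` produced by `e^{ik·P_f}` cancels the shift of `x` in the coupling
function. -/
theorem fieldTranslation_mem_graph_vectorPotential (j : Fin 3)
    (hc : ∀ x, MemLp (coupling Λ e j x) 2 photonMeasure) (k x : Rd 3) {η ξ : Fock}
    (h : (η, ξ) ∈ (vectorPotential Λ e j (x + k)).graph) :
    (fieldTranslation k η, fieldTranslation k ξ) ∈ (vectorPotential Λ e j x).graph :=
  map_mem_graph_smul_add _
    (fun _ => fieldTranslation_mem_graph_annihilation k (hc _) (hc _)
      fun q => (planeWave_mul_coupling j k x q).symm)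
    (fun _ => fieldTranslation_mem_graph_creation' k
      fun q => (planeWave_mul_coupling j k x q).symm) h

end Potential

/-! ### The finite photon subspace -/

section FinitePhoton

/-- At most `N - 1` photons, all of them with momentum at most `R`. -/
def IsBoundedState (N : ℕ) (R : ℝ) (ψ : Fock) : Prop :=
  (∀ n, N ≤ n → ψ n = 0) ∧
    ∀ n, ∀ᵐ q ∂photonMeasureN n, comp ψ n q ≠ 0 → ∀ i, ‖(q i).1‖ ≤ R

theorem IsBoundedState.mono {N N' : ℕ} {R R' : ℝ} {ψ : Fock} (h : IsBoundedState N R ψ)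
    (hN : N ≤ N') (hR : R ≤ R') : IsBoundedState N' R' ψ :=
  ⟨fun n hn => h.1 n (hN.trans hn), fun n => by
    filter_upwards [h.2 n] with q hq h0 i using (hq h0 i).trans hR⟩

theorem exists_norm_le_of_test {f : Photon → ℂ} (hf : ∀ l, IsTest fun k => f (k, l)) :
    ∃ R : ℝ, ∀ q, f q ≠ 0 → ‖q.1‖ ≤ R := by
  have h : ∀ l, ∃ R : ℝ, ∀ k, f (k, l) ≠ 0 → ‖k‖ ≤ R := fun l => by
    obtain ⟨R, hR⟩ := (hf l).2.isCompact.isBounded.exists_norm_le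
    exact ⟨R, fun k hk => hR k (subset_tsupport _ hk)⟩
  choose R hR using h
  refine ⟨max (R 0) (R 1), fun ⟨k, l⟩ hq => ?_⟩
  fin_cases l
  · exact (hR 0 k hq).trans (le_max_left _ _)
  · exact (hR 1 k hq).trans (le_max_right _ _)

/-- Each creation operator adds one photon, whose momentum lies in the support of a test function.
-/
theorem IsProductState.exists_isBoundedState {ψ : Fock} (h : IsProductState ψ) :
    ∃ N R, IsBoundedState N R ψ := by
  induction h with
  | vacuum ψ h =>
    refine ⟨1, 0, fun n hn => ?_, fun n => ?_⟩
    · obtain ⟨n, rfl⟩ := Nat.exists_eq_add_of_le' hn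
      exact h.2 n
    · cases n with
      | zero => exact Filter.Eventually.of_forall fun q _ i => i.elim0
      | succ n =>
        have h1 : comp ψ (n + 1) =ᵐ[photonMeasureN (n + 1)] 0 := by
          rw [comp, h.2 n]; exact Lp.coeFn_zero _ _ _
        filter_upwards [h1] with q h2 h3
        exact (h3 h2).elim
  | create f hf ψ φ hψ hφ ih =>
    obtain ⟨N, R, hN, hR⟩ := ih
    obtain ⟨R', hR'⟩ := exists_norm_le_of_test hf
    rw [mem_graph_creation_iff_ae] at hφ
    have hz : ∀ n, ψ n = 0 → φ (n + 1) = 0 := fun n hn => by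
      refine Subtype.ext (Lp.ext ?_)
      have h1 : comp ψ n =ᵐ[photonMeasureN n] 0 := by
        rw [comp, hn]; exact Lp.coeFn_zero _ _ _
      have h' : ∀ i : Fin (n + 1), ∀ᵐ k ∂photonMeasureN (n + 1),
          comp ψ n (fun j => k (i.succAbove j)) = 0 :=
        fun i => (quasi_removeNth n i).ae h1
      filter_upwards [hφ.2 n, ae_all_iff.2 h', Lp.coeFn_zero ℂ 2 (photonMeasureN (n + 1))]
        with q h2 h3 h4
      refine h2.trans ?_
      simp only [h3, mul_zero, Finset.sum_const_zero]
      exact h4.symm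
    refine ⟨N + 1, max R R', fun n hn => ?_, fun n => ?_⟩
    · obtain ⟨n, rfl⟩ := Nat.exists_eq_add_of_le' ((Nat.le_add_left 1 N).trans hn)
      exact hz n (hN n (by omega))
    · cases n with
      | zero => exact Filter.Eventually.of_forall fun q _ i => i.elim0
      | succ n =>
        have h' : ∀ i : Fin (n + 1), ∀ᵐ k ∂photonMeasureN (n + 1),
            comp ψ n (fun j => k (i.succAbove j)) ≠ 0 → ∀ j, ‖(k (i.succAbove j)).1‖ ≤ R :=
          fun i => (quasi_removeNth n i).ae (hR n)
        filter_upwards [hφ.2 n, ae_all_iff.2 h'] with q h2 h3 h4 i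
        rw [h2] at h4
        -- A nonzero value needs a nonzero term `l`: photon `l` is then in the support of `f`, and
        -- all the others are controlled by `ψ`.
        obtain ⟨l, -, hl⟩ := Finset.exists_ne_zero_of_sum_ne_zero (right_ne_zero_of_mul h4)
        rcases Fin.eq_self_or_eq_succAbove l i with rfl | ⟨j, rfl⟩
        · exact (hR' _ (left_ne_zero_of_mul hl)).trans (le_max_right _ _)
        · exact (h3 l (right_ne_zero_of_mul hl) j).trans (le_max_left _ _)

theorem exists_isBoundedState {η : Fock} (h : η ∈ finitePhoton) :
    ∃ N R, IsBoundedState N R η := by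
  induction h using Submodule.span_induction with
  | mem ψ h => exact IsProductState.exists_isBoundedState h
  | zero =>
    refine ⟨0, 0, fun n _ => rfl, fun n => ?_⟩
    filter_upwards [comp_zero n] with q h1 h2
    exact (h2 h1).elim
  | add ψ φ _ _ h1 h2 =>
    obtain ⟨N, R, hN⟩ := h1
    obtain ⟨N', R', hN'⟩ := h2
    replace hN := hN.mono (le_max_left N N') (le_max_left R R')
    replace hN' := hN'.mono (le_max_right N N') (le_max_right R R')
    refine ⟨max N N', max R R', fun n hn => ?_, fun n => ?_⟩
    · rw [lp.coeFn_add, Pi.add_apply, hN.1 n hn, hN'.1 n hn, add_zero]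
    · filter_upwards [comp_add ψ φ n, hN.2 n, hN'.2 n] with q h3 h4 h5 h6
      by_cases h7 : comp ψ n q = 0
      · refine h5 fun h8 => h6 ?_
        rw [h3, Pi.add_apply, h7, h8, add_zero]
      · exact h4 h7
  | smul c ψ _ h =>
    obtain ⟨N, R, hN⟩ := h
    refine ⟨N, R, fun n hn => ?_, fun n => ?_⟩
    · rw [lp.coeFn_smul, Pi.smul_apply, hN.1 n hn, smul_zero]
    · filter_upwards [comp_smul c ψ n, hN.2 n] with q h3 h4 h5
      refine h4 fun h6 => h5 ?_
      rw [h3, Pi.smul_apply, h6, smul_zero]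

theorem exists_forall_apply_eq_zero {η : Fock} (h : η ∈ finitePhoton) :
    ∃ N, ∀ n, N ≤ n → η n = 0 := by
  obtain ⟨N, R, hN⟩ := exists_isBoundedState h
  exact ⟨N, hN.1⟩

/-- `H_f^{1/2} η` is defined for finite photon vectors. -/
theorem exists_mem_graph_sqrtFieldEnergy {η : Fock} (h : η ∈ finitePhoton) :
    ∃ φ, (η, φ) ∈ sqrtFieldEnergy.graph := by
  obtain ⟨N, R, hN, hR⟩ := exists_isBoundedState h
  have hw : ∀ n, Measurable fun k : Fin n → Photon => √(∑ i, ‖(k i).1‖) := fun n => by fun_prop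
  have hs : ∀ n (σ : Equiv.Perm (Fin n)) (k : Fin n → Photon),
      √(∑ i, ‖(k (σ i)).1‖) = √(∑ i, ‖(k i).1‖) := fun n σ k => by
    rw [Equiv.sum_comp σ fun i => ‖(k i).1‖]
  -- On the support of `η` there are at most `N` photons with momenta bounded by `|R|`, so `√(∑
  -- |kᵢ|) ≤ √(N |R|)`. Clamping the multiplier at this level makes it bounded without changing the
  -- product.
  let f : ℝ → ℂ := fun s => ((max (-√(N * |R|)) (min s (√(N * |R|))) : ℝ) : ℂ)
  have hf : Measurable f := by fun_prop
  have hC : ∀ s, ‖f s‖ ≤ √(N * |R|) := fun s => by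
    have h0 := Real.sqrt_nonneg (N * |R|)
    simp only [f, Complex.norm_real, Real.norm_eq_abs, abs_le]
    exact ⟨le_max_left _ _, max_le (by linarith) (min_le_right _ _)⟩
  refine ⟨sectorOp (isSectorMultiplier_comp hw hs hf hC) η, ?_⟩
  rw [sqrtFieldEnergy, mem_graph_sectorMul]
  intro n
  have hn : ∀ᵐ q ∂photonMeasureN n, comp η n q ≠ 0 → n ≤ N := by
    by_cases hn : n ≤ N
    · exact Filter.Eventually.of_forall fun _ _ => hn
    · have hq0 : comp η n =ᵐ[photonMeasureN n] 0 := by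
        rw [comp, hN n (by omega)]; exact Lp.coeFn_zero _ _ _
      filter_upwards [hq0] with q h1 h2
      exact (h2 h1).elim
  filter_upwards [comp_sectorOp (isSectorMultiplier_comp hw hs hf hC) η n, hR n, hn] with q h1 h2 hn
  rw [h1]
  by_cases h0 : comp η n q = 0
  · rw [h0, mul_zero, mul_zero]
  · congr 1
    have h3 : ∑ i, ‖(q i).1‖ ≤ N * |R| := by
      calc ∑ i, ‖(q i).1‖ ≤ ∑ _i : Fin n, |R| :=
            Finset.sum_le_sum fun i _ => (h2 h0 i).trans (le_abs_self R)
        _ = n * |R| := by simp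
        _ ≤ N * |R| := by gcongr; exact hn h0
    have h4 : √(∑ i, ‖(q i).1‖) ≤ √(N * |R|) := Real.sqrt_le_sqrt h3
    simp only [f]
    rw [min_eq_left h4, max_eq_right
      (by linarith [Real.sqrt_nonneg (N * |R|), Real.sqrt_nonneg (∑ i, ‖(q i).1‖)])]

theorem IsTest.planeWave_mul (k : Rd 3) {f : Rd 3 → ℂ} (hf : IsTest f) :
    IsTest fun x => planeWave k x * f x := by
  refine ⟨ContDiff.mul ?_ hf.1, hf.2.mul_left⟩
  unfold planeWave
  have h : ContDiff ℝ ∞ fun x : Rd 3 => ((inner ℝ k x : ℝ) : ℂ) :=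
    Complex.ofRealCLM.contDiff.comp (innerSL ℝ k).contDiff
  exact (h.mul contDiff_const).cexp

theorem IsProductState.fieldTranslation (k : Rd 3) {ψ : Fock} (h : IsProductState ψ) :
    IsProductState (fieldTranslation k ψ) := by
  induction h with
  | vacuum ψ h =>
    refine .vacuum _ ⟨?_, fun n => fieldTranslation_apply_eq_zero k (h.2 n)⟩
    filter_upwards [comp_fieldTranslation k ψ 0, h.1] with q h1 h2
    rw [h1, h2, phase, totalMomentum]
    simp
  | create f hf ψ φ hψ hφ ih =>
    exact .create (fun q => planeWave k q.1 * f q) (fun l => (hf l).planeWave_mul k) _ _ ih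
      (fieldTranslation_mem_graph_creation k hφ)

theorem fieldTranslation_mem_finitePhoton (k : Rd 3) {η : Fock} (h : η ∈ finitePhoton) :
    fieldTranslation k η ∈ finitePhoton := by
  have h1 : finitePhoton ≤ finitePhoton.comap (SRPF.fieldTranslation k).toLinearMap :=
    Submodule.span_le.2 fun ψ hψ => Submodule.subset_span (IsProductState.fieldTranslation k hψ)
  exact h1 h

end FinitePhoton

/-! ### Totality of product functions -/

section Totality

/-- Rectangles form a π-system generating the product σ-algebra, and the sets with vanishing
integral are stable under complements and countable disjoint unions. -/
theorem setIntegral_eq_zero_of_rectangles {X Y : Type*} [MeasurableSpace X] [MeasurableSpace Y]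
    {ρ : Measure (X × Y)} {h : X × Y → ℂ} (hh : Integrable h ρ)
    (h0 : ∀ s t, MeasurableSet s → MeasurableSet t → ∫ p in s ×ˢ t, h p ∂ρ = 0)
    {A : Set (X × Y)} (hA : MeasurableSet A) : ∫ p in A, h p ∂ρ = 0 := by
  have huniv : ∫ p, h p ∂ρ = 0 := by
    have := h0 _ _ MeasurableSet.univ MeasurableSet.univ
    rwa [Set.univ_prod_univ, setIntegral_univ] at this
  induction A, hA using MeasurableSpace.induction_on_inter generateFrom_prod.symm
    isPiSystem_prod with
  | empty => simp
  | basic A hA =>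
    obtain ⟨s, hs, t, ht, rfl⟩ := hA
    exact h0 s t hs ht
  | compl A hA ih => simpa [ih, huniv] using integral_add_compl hA hh
  | iUnion A hd hA ih => simp [integral_iUnion hA hd hh.integrableOn, ih]

/-- The space is exhausted by rectangles of finite measure, on which a square integrable function is
integrable. -/
theorem ae_eq_zero_of_rectangles {X Y : Type*} [MeasurableSpace X] [MeasurableSpace Y]
    {μ : Measure X} {ν : Measure Y} [SigmaFinite μ] [SigmaFinite ν] {h : X × Y → ℂ}
    (hh : MemLp h 2 (μ.prod ν))
    (h0 : ∀ s t, MeasurableSet s → MeasurableSet t → μ s < ⊤ → ν t < ⊤ →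
      ∫ p in s ×ˢ t, h p ∂(μ.prod ν) = 0) : h =ᵐ[μ.prod ν] 0 := by
  let S : ℕ → Set (X × Y) := fun i => spanningSets μ i ×ˢ spanningSets ν i
  have hSm : ∀ i, MeasurableSet (S i) := fun i =>
    (measurableSet_spanningSets μ i).prod (measurableSet_spanningSets ν i)
  have hS : ⋃ i, S i = Set.univ := by
    refine Set.eq_univ_of_forall fun p => Set.mem_iUnion.2 ?_
    obtain ⟨i, hi⟩ := Set.mem_iUnion.1 ((iUnion_spanningSets μ).symm ▸ Set.mem_univ p.1)
    obtain ⟨j, hj⟩ := Set.mem_iUnion.1 ((iUnion_spanningSets ν).symm ▸ Set.mem_univ p.2)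
    exact ⟨max i j, monotone_spanningSets μ (le_max_left i j) hi,
      monotone_spanningSets ν (le_max_right i j) hj⟩
  rw [← Measure.restrict_univ (μ := μ.prod ν), ← hS]
  refine (ae_restrict_iUnion_iff _ _).2 fun i => ?_
  have hfin : (μ.prod ν) (S i) < ⊤ := by
    rw [Measure.prod_prod]
    exact ENNReal.mul_lt_top (measure_spanningSets_lt_top μ i) (measure_spanningSets_lt_top ν i)
  have : IsFiniteMeasure ((μ.prod ν).restrict (S i)) := ⟨by simpa using hfin⟩
  have hint : Integrable h ((μ.prod ν).restrict (S i)) := (hh.restrict _).integrable (by norm_num)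
  refine hint.ae_eq_zero_of_forall_setIntegral_eq_zero fun A hA _ =>
    setIntegral_eq_zero_of_rectangles hint (fun s t hs ht => ?_) hA
  rw [Measure.restrict_restrict (hs.prod ht), Set.prod_inter_prod]
  refine h0 _ _ (hs.inter (measurableSet_spanningSets μ i))
    (ht.inter (measurableSet_spanningSets ν i)) ?_ ?_
  · exact (measure_mono Set.inter_subset_right).trans_lt (measure_spanningSets_lt_top μ i)
  · exact (measure_mono Set.inter_subset_right).trans_lt (measure_spanningSets_lt_top ν i)

/-- The indicator of a rectangle is the tensor product of two indicators, so tensors already detect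
all integrals over rectangles of finite measure. -/
theorem eq_zero_of_inner_tens {n : ℕ} {h : Lp ℂ 2 (photonMeasureN (n + 1))}
    (h0 : ∀ g F, ⟪tens n g F, h⟫_ℂ = 0) : h = 0 := by
  have he := measurePreserving_piFinSuccAbove (fun _ : Fin (n + 1) => photonMeasure) 0
  set ε := MeasurableEquiv.piFinSuccAbove (fun _ : Fin (n + 1) => Photon) 0 with hε
  have hh : MemLp (fun p => h (ε.symm p)) 2 (photonMeasure.prod (photonMeasureN n)) :=
    (Lp.memLp h).comp_measurePreserving (he.symm ε)
  have key := ae_eq_zero_of_rectangles hh fun s t hs ht hμ hν => ?_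
  · refine Lp.ext ?_
    filter_upwards [he.quasiMeasurePreserving.ae key, Lp.coeFn_zero ℂ 2 (photonMeasureN (n + 1))]
      with k h1 h2
    rw [h2, Pi.zero_apply]
    simpa using h1
  · have h1 := h0 (indicatorConstLp 2 hs hμ.ne 1) (indicatorConstLp 2 ht hν.ne 1)
    rw [L2.inner_def] at h1
    rw [← integral_indicator (hs.prod ht), ← he.integral_comp', ← h1]
    refine integral_congr_ae ?_
    filter_upwards [coeFn_tens (indicatorConstLp 2 hs hμ.ne (1 : ℂ))
      (indicatorConstLp 2 ht hν.ne (1 : ℂ)),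
      (quasi_head n).ae (indicatorConstLp_coeFn (p := 2) (hs := hs) (hμs := hμ.ne) (c := (1 : ℂ))),
      (quasi_tail n).ae (indicatorConstLp_coeFn (p := 2) (hs := ht) (hμs := hν.ne) (c := (1 : ℂ)))]
      with k h2 h3 h4
    have h5 : ε k = (k 0, fun j : Fin n => k j.succ) := rfl
    rw [RCLike.inner_apply, h2, tensFun, h3, h4]
    simp only [Set.indicator, Set.mem_prod, h5]
    have h6 : ε.symm (k 0, fun j : Fin n => k j.succ) = k := by
      rw [← h5, MeasurableEquiv.symm_apply_apply]
    rw [h6]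
    split_ifs <;> simp_all

/-- Functions on `ℝ³ × {1,2}` orthogonal to all test functions vanish. -/
theorem eq_zero_of_inner_test {h : Lp ℂ 2 photonMeasure}
    (h0 : ∀ f : Photon → ℂ, (∀ l, IsTest fun k => f (k, l)) →
      ∫ q, starRingEnd ℂ (f q) * h q ∂photonMeasure = 0) : h = 0 := by
  have hint : Integrable (fun q => ‖h q‖ ^ 2) photonMeasure :=
    (memLp_two_iff_integrable_sq_norm (Lp.memLp h).1).1 (Lp.memLp h)
  have hsm : ∀ l : Fin 2, StronglyMeasurable fun k : Rd 3 => h (k, l) := fun l =>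
    (Lp.stronglyMeasurable h).comp_measurable measurable_prodMk_right
  have hslice : ∀ l : Fin 2, MemLp (fun k : Rd 3 => h (k, l)) 2 volume := fun l => by
    rw [memLp_two_iff_integrable_sq_norm (hsm l).aestronglyMeasurable]
    exact Measure.ae_count_iff.1 hint.prod_left_ae l
  have hl : ∀ l : Fin 2, ∀ᵐ k : Rd 3, h (k, l) = 0 := fun l => by
    refine ae_eq_zero_of_integral_contDiff_smul_eq_zero
      ((hslice l).locallyIntegrable (by norm_num)) fun g hg hgc => ?_
    -- A test function carried by a single polarization isolates the slice `h (·, l)`.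
    let f : Photon → ℂ := fun q => if q.2 = l then (g q.1 : ℂ) else 0
    have hgC : IsTest fun k => (g k : ℂ) :=
      ⟨Complex.ofRealCLM.contDiff.comp hg, hgc.comp_left Complex.ofReal_zero⟩
    have hf : ∀ l', IsTest fun k => f (k, l') := fun l' => by
      by_cases hl : l' = l
      · simpa only [f, hl, if_true] using hgC
      · simp only [f, hl, if_false]
        exact ⟨contDiff_const, HasCompactSupport.zero⟩
    have hgL : MemLp (fun k => (g k : ℂ)) 2 (volume : Measure (Rd 3)) :=
      hgC.1.continuous.memLp_of_hasCompactSupport hgC.2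
    have h1 := h0 f hf
    have hslint : ∀ l' : Fin 2, Integrable (fun k : Rd 3 =>
        starRingEnd ℂ (f (k, l')) * h (k, l')) volume := fun l' => by
      have hfl : MemLp (fun k => starRingEnd ℂ (f (k, l'))) 2 (volume : Measure (Rd 3)) := by
        exact ((hf l').1.continuous.memLp_of_hasCompactSupport (hf l').2).star
      exact hfl.integrable_mul (hslice l')
    have hprod : Integrable (fun q => starRingEnd ℂ (f q) * h q) photonMeasure := by
      have hfm : Measurable f := measurable_from_prod_countable_left fun l' =>
        (hf l').1.continuous.measurable
      have hfL : MemLp (fun q => starRingEnd ℂ (f q)) 2 photonMeasure := by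
        refine (hgL.comp_fst (Measure.count : Measure (Fin 2))).of_le
          (Complex.continuous_conj.measurable.comp hfm).aestronglyMeasurable
          (Filter.Eventually.of_forall fun q => ?_)
        rw [RCLike.norm_conj]
        simp only [f]
        split_ifs <;> simp
      exact hfL.integrable_mul (Lp.memLp h)
    rw [integral_prod_symm _ hprod, integral_count, Fin.sum_univ_two] at h1
    have h2 : ∀ l', ∫ k : Rd 3, starRingEnd ℂ (f (k, l')) * h (k, l') =
        if l' = l then ∫ k, g k • h (k, l) else 0 := fun l' => by
      by_cases hl : l' = l
      · simp [f, hl]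
      · simp [f, hl]
    rw [h2, h2] at h1
    fin_cases l
    · simpa using h1
    · simpa using h1
  refine Lp.ext ((?_ : ⇑h =ᵐ[photonMeasure] 0).trans ?_)
  · have hms : MeasurableSet {q | h q ≠ 0} :=
      ((Lp.stronglyMeasurable h).measurable (measurableSet_singleton 0)).compl
    refine (Measure.measure_prod_null hms).2 ?_
    filter_upwards [hl 0, hl 1] with k h1 h2
    have h3 : Prod.mk k ⁻¹' {q : Photon | h q ≠ 0} = ∅ := by
      ext l
      fin_cases l
      · simpa using h1
      · simpa using h2
    rw [h3]
    simp
  · exact (Lp.coeFn_zero ℂ 2 photonMeasure).symm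

end Totality

/-! ### Density of the finite photon subspace -/

section Density

/-- The constant function `1` on the space of configurations of zero photons. -/
def vacuumSector : symL2 0 :=
  ⟨(memLp_const (1 : ℂ)).toLp _, mem_symL2_iff.2 fun σ => by
    filter_upwards with k
    congr 1
    exact Subsingleton.elim _ _⟩

theorem coeFn_vacuumSector :
    (vacuumSector : Lp ℂ 2 (photonMeasureN 0)) =ᵐ[photonMeasureN 0] fun _ => 1 :=
  (memLp_const (1 : ℂ)).coeFn_toLp

theorem isVacuum_vacuumSector : IsVacuum (lp.single 2 0 vacuumSector) := by
  refine ⟨?_, fun n => ?_⟩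
  · rw [comp, lp.single_apply_self]
    exact coeFn_vacuumSector
  · exact lp.single_apply_ne 2 0 _ (Nat.succ_ne_zero n)

theorem integral_photonMeasureN_zero {E : Type*} [NormedAddCommGroup E] [NormedSpace ℝ E]
    [CompleteSpace E] (f : (Fin 0 → Photon) → E) : ∫ k, f k ∂photonMeasureN 0 = f isEmptyElim := by
  have h : photonMeasureN 0 = Measure.dirac isEmptyElim := Measure.pi_of_empty _ _
  rw [h, integral_dirac]

theorem norm_vacuumSector : ‖vacuumSector‖ = 1 := by
  have h : ‖vacuumSector‖ ^ 2 = 1 := by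
    have h1 := norm_sq_eq_integral (vacuumSector : Lp ℂ 2 (photonMeasureN 0))
    rw [integral_congr_ae (g := fun _ => (1 : ℝ))
      (by filter_upwards [coeFn_vacuumSector] with k h; simp [h]),
      integral_photonMeasureN_zero] at h1
    exact h1
  exact (pow_eq_one_iff_of_nonneg (norm_nonneg _) two_ne_zero).1 h

theorem exists_norm_eq_one_finitePhoton : ∃ η ∈ finitePhoton, ‖η‖ = 1 :=
  ⟨lp.single 2 0 vacuumSector,
    Submodule.subset_span (IsProductState.vacuum _ isVacuum_vacuumSector), by
      rw [lp.norm_single (by norm_num), norm_vacuumSector]⟩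

theorem memLp_test {f : Photon → ℂ} (hf : ∀ l, IsTest fun k => f (k, l)) :
    MemLp f 2 photonMeasure := by
  have hfm : Measurable f := measurable_from_prod_countable_left fun l' =>
    (hf l').1.continuous.measurable
  have h : ∀ l, MemLp (fun k => f (k, l)) 2 (volume : Measure (Rd 3)) := fun l =>
    (hf l).1.continuous.memLp_of_hasCompactSupport (hf l).2
  have h1 := ((h 0).norm.add (h 1).norm).comp_fst (Measure.count : Measure (Fin 2))
  refine h1.of_le hfm.aestronglyMeasurable (Filter.Eventually.of_forall fun ⟨k, l⟩ => ?_)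
  simp only [Pi.add_apply]
  rw [Real.norm_of_nonneg (by positivity)]
  fin_cases l
  · exact le_add_of_nonneg_right (norm_nonneg _)
  · exact le_add_of_nonneg_left (norm_nonneg _)

theorem single_mem_graph_creation {f : Photon → ℂ} (hf : MemLp f 2 photonMeasure) {n : ℕ}
    (F : symL2 n) : (lp.single 2 n F, lp.single 2 (n + 1) (sectorCreation n (hf.toLp f) F)) ∈
      (creation f).graph := by
  rw [mem_graph_creation hf]
  refine ⟨lp.single_apply_ne 2 (n + 1) _ (Nat.succ_ne_zero n).symm, fun m => ?_⟩
  by_cases h : m = n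
  · subst h
    rw [lp.single_apply_self, lp.single_apply_self]
  · rw [lp.single_apply_ne 2 (n + 1) _ (by omega), lp.single_apply_ne 2 n _ h, map_zero]

/-- Against a symmetric `h`, the `n + 1` terms of the symmetrised tensor have equal inner products.
-/
theorem inner_sectorCreation {n : ℕ} (g : Lp ℂ 2 photonMeasure) (F : symL2 n) (h : symL2 (n + 1)) :
    ⟪sectorCreation n g F, h⟫_ℂ = ((√((n : ℝ) + 1) : ℝ) : ℂ)⁻¹ * ((n : ℂ) + 1) *
      ⟪tens n g (F : Lp ℂ 2 (photonMeasureN n)), (h : Lp ℂ 2 (photonMeasureN (n + 1)))⟫_ℂ := by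
  rw [Submodule.coe_inner, coe_sectorCreation, inner_smul_left, symTens_apply, sum_inner]
  have h1 : ∀ i : Fin (n + 1), ⟪permOp (frontPerm i) (tens n g (F : Lp ℂ 2 (photonMeasureN n))),
      (h : Lp ℂ 2 (photonMeasureN (n + 1)))⟫_ℂ =
      ⟪tens n g (F : Lp ℂ 2 (photonMeasureN n)), (h : Lp ℂ 2 (photonMeasureN (n + 1)))⟫_ℂ :=
    fun i => by
      conv_lhs => rw [← mem_symL2_iff_permOp.1 h.2 (frontPerm i)]
      exact (permOp (frontPerm i)).inner_map_map _ _
  simp only [h1, Finset.sum_const, Finset.card_univ, Fintype.card_fin, nsmul_eq_mul, map_inv₀,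
    Complex.conj_ofReal]
  push_cast
  ring

/-- Extension of a permutation of `{1, …, n}` to `{0, …, n}`. -/
theorem permOp_tens {n : ℕ} (σ : Equiv.Perm (Fin n)) (g : Lp ℂ 2 photonMeasure)
    (F : Lp ℂ 2 (photonMeasureN n)) : ∃ τ : Equiv.Perm (Fin (n + 1)),
      permOp τ (tens n g F) = tens n g (permOp σ F) := by
  refine ⟨Equiv.Perm.decomposeFin.symm (0, σ), Lp.ext ?_⟩
  filter_upwards [coeFn_permOp (Equiv.Perm.decomposeFin.symm (0, σ)) (tens n g F),
    (measurePreserving_perm (n + 1) (Equiv.Perm.decomposeFin.symm (0, σ))).quasiMeasurePreserving.ae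
      (coeFn_tens g F), coeFn_tens g (permOp σ F), (quasi_tail n).ae (coeFn_permOp σ F)]
    with k h1 h2 h3 h4
  rw [h1, h2, h3, tensFun, tensFun, h4]
  simp [Equiv.Perm.decomposeFin_symm_apply_succ]

/-- Symmetrising `F` over `n!` permutations multiplies its pairing with the symmetric `h` by `n!`,
because permutations of the last `n` slots extend to all `n + 1` slots. Hence symmetric `F` suffice.
-/
theorem inner_tens_eq_zero {n : ℕ} {g : Lp ℂ 2 photonMeasure} {h : symL2 (n + 1)}
    (h0 : ∀ F : symL2 n, ⟪tens n g (F : Lp ℂ 2 (photonMeasureN n)),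
      (h : Lp ℂ 2 (photonMeasureN (n + 1)))⟫_ℂ = 0) (F : Lp ℂ 2 (photonMeasureN n)) :
    ⟪tens n g F, (h : Lp ℂ 2 (photonMeasureN (n + 1)))⟫_ℂ = 0 := by
  have hsym : ∑ σ : Equiv.Perm (Fin n), permOp σ F ∈ symL2 n := by
    rw [mem_symL2_iff_permOp]
    intro τ
    rw [map_sum]
    have h1 : ∀ σ, permOp τ (permOp σ F) = permOp (τ * σ) F := fun σ => by
      refine Lp.ext ?_
      filter_upwards [coeFn_permOp τ (permOp σ F), coeFn_permOp (τ * σ) F,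
        (measurePreserving_perm n τ).quasiMeasurePreserving.ae (coeFn_permOp σ F)] with k h1 h2 h3
      rw [h1, h2, h3]
      rfl
    simp only [h1]
    exact Equiv.sum_comp (Equiv.mulLeft τ) fun σ => permOp σ F
  have h2 := h0 ⟨_, hsym⟩
  have h3 : ∀ σ : Equiv.Perm (Fin n), ⟪tens n g (permOp σ F),
      (h : Lp ℂ 2 (photonMeasureN (n + 1)))⟫_ℂ =
      ⟪tens n g F, (h : Lp ℂ 2 (photonMeasureN (n + 1)))⟫_ℂ := fun σ => by
    obtain ⟨τ, hτ⟩ := permOp_tens σ g F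
    rw [← hτ]
    conv_lhs => rw [← mem_symL2_iff_permOp.1 h.2 τ]
    exact (permOp τ).inner_map_map _ _
  simp only [map_sum, sum_inner, h3, Finset.sum_const, nsmul_eq_mul, mul_eq_zero] at h2
  refine h2.resolve_left ?_
  simp [Finset.card_univ, Fintype.card_perm, Nat.factorial_ne_zero]

theorem exists_inner_eq {E F G : Type*} [NormedAddCommGroup E] [InnerProductSpace ℂ E]
    [CompleteSpace E] [NormedAddCommGroup F] [InnerProductSpace ℂ F] [NormedAddCommGroup G]
    [InnerProductSpace ℂ G] [CompleteSpace G] (B : E →L[ℂ] F →L[ℂ] G) (y : F) (z : G) :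
    ∃ v : E, ∀ x, ⟪B x y, z⟫_ℂ = ⟪x, v⟫_ℂ :=
  ⟨(B.flip y).adjoint z, fun x => by rw [ContinuousLinearMap.adjoint_inner_right]; rfl⟩

theorem exists_inner_eq' {F G : Type*} [NormedAddCommGroup F] [InnerProductSpace ℂ F]
    [CompleteSpace F] [NormedAddCommGroup G] [InnerProductSpace ℂ G] [CompleteSpace G]
    (T : F →L[ℂ] G) (z : G) : ∃ v : F, ∀ x, ⟪T x, z⟫_ℂ = ⟪x, v⟫_ℂ :=
  ⟨T.adjoint z, fun x => by rw [ContinuousLinearMap.adjoint_inner_right]⟩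

/-- Induction on the number of photons. For a product state `F`, the vector representing `g ↦ ⟪a*(g)
F, h⟫` is orthogonal to all test functions, hence zero. For each fixed `g`, the vector representing
`F ↦ ⟪a*(g) F, h⟫` is therefore orthogonal to all product states with `n` photons, hence zero by
induction. So `h` is orthogonal to every tensor `g ⊗ F`. -/
theorem eq_zero_of_inner_productState : ∀ (n : ℕ) (h : symL2 n),
    (∀ F : symL2 n, IsProductState (lp.single 2 n F) → ⟪F, h⟫_ℂ = 0) → h = 0 := by
  intro n
  induction n with
  | zero =>
    intro h h0
    have h1 := h0 vacuumSector (.vacuum _ isVacuum_vacuumSector)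
    rw [Submodule.coe_inner, L2.inner_def, integral_congr_ae
      (g := fun k => (h : Lp ℂ 2 (photonMeasureN 0)) k)
      (by filter_upwards [coeFn_vacuumSector] with k h; simp [h])] at h1
    rw [integral_photonMeasureN_zero] at h1
    refine Subtype.ext (Lp.ext ?_)
    filter_upwards [Lp.coeFn_zero ℂ 2 (photonMeasureN 0)] with k h2
    refine Eq.trans ?_ h2.symm
    rw [Pi.zero_apply, ← h1]
    congr 1
    exact Subsingleton.elim _ _
  | succ n ih =>
    intro h h0
    have h1 : ∀ F : symL2 n, IsProductState (lp.single 2 n F) →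
        ∀ g : Lp ℂ 2 photonMeasure, ⟪sectorCreation n g F, h⟫_ℂ = 0 := by
      intro F hF g
      obtain ⟨v, hv⟩ := exists_inner_eq (sectorCreation n) F h
      have h2 : v = 0 := by
        refine eq_zero_of_inner_test fun f hf => ?_
        have h3 := h0 _ (.create f hf _ _ hF (single_mem_graph_creation (memLp_test hf) F))
        rw [hv, L2.inner_def] at h3
        rw [← h3]
        refine integral_congr_ae ?_
        filter_upwards [(memLp_test hf).coeFn_toLp] with q hq
        rw [RCLike.inner_apply, hq, mul_comm]
      rw [hv, h2, inner_zero_right]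
    have h3 : ∀ (g : Lp ℂ 2 photonMeasure) (F : symL2 n),
        ⟪tens n g (F : Lp ℂ 2 (photonMeasureN n)),
          (h : Lp ℂ 2 (photonMeasureN (n + 1)))⟫_ℂ = 0 := fun g F => by
      obtain ⟨v, hv⟩ := exists_inner_eq' (sectorCreation n g) h
      have h2 : v = 0 := ih _ fun F hF => by rw [← hv, h1 F hF g]
      have h4 : ⟪sectorCreation n g F, h⟫_ℂ = 0 := by rw [hv, h2, inner_zero_right]
      rw [inner_sectorCreation] at h4
      refine (mul_eq_zero.1 h4).resolve_left (mul_ne_zero (inv_ne_zero ?_) ?_)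
      · rw [Complex.ofReal_ne_zero]
        positivity
      · exact_mod_cast Nat.succ_ne_zero n
    exact Subtype.ext (eq_zero_of_inner_tens fun g F => inner_tens_eq_zero (h3 g) F)

theorem finitePhoton_dense : Dense (finitePhoton : Set Fock) := by
  rw [Submodule.dense_iff_topologicalClosure_eq_top,
    Submodule.topologicalClosure_eq_top_iff, Submodule.eq_bot_iff]
  intro η hη
  rw [Submodule.mem_orthogonal] at hη
  refine lp.ext (funext fun n => eq_zero_of_inner_productState n (η n) fun F hF => ?_)
  have h := hη _ (Submodule.subset_span hF)
  rwa [lp.inner_single_left] at h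

end Density

end SRPF

namespace SRPF

/-! ### Operators on triples of vectors -/

section Shear

variable {H : Type*} [NormedAddCommGroup H] [InnerProductSpace ℂ H]

/-- The operator acting by `T` on each component of a triple. -/
def tripleMap (T : H →L[ℂ] H) :
    (PiLp 2 fun _ : Fin 3 => H) →L[ℂ] PiLp 2 fun _ : Fin 3 => H :=
  (PiLp.continuousLinearEquiv 2 ℂ fun _ : Fin 3 => H).symm.toContinuousLinearMap.comp
    (ContinuousLinearMap.pi fun j => T.comp (PiLp.proj 2 (fun _ : Fin 3 => H) j))

theorem tripleMap_apply (T : H →L[ℂ] H) (v : PiLp 2 fun _ : Fin 3 => H) (j : Fin 3) :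
    tripleMap T v j = T (v j) := rfl

theorem inner_tripleMap {T T' : H →L[ℂ] H} (hT : ∀ x y, ⟪T x, y⟫_ℂ = ⟪x, T' y⟫_ℂ)
    (v w : PiLp 2 fun _ : Fin 3 => H) : ⟪tripleMap T v, w⟫_ℂ = ⟪v, tripleMap T' w⟫_ℂ := by
  rw [PiLp.inner_apply, PiLp.inner_apply]
  exact Finset.sum_congr rfl fun j _ => hT _ _

/-- The operator `(u, v) ↦ (M u, (M vⱼ + cⱼ M u)ⱼ)`. -/
def shear (M : H →L[ℂ] H) (c : Fin 3 → ℝ) : WithLp 2 (H × PiLp 2 fun _ : Fin 3 => H) →L[ℂ]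
    WithLp 2 (H × PiLp 2 fun _ : Fin 3 => H) :=
  (WithLp.prodContinuousLinearEquiv 2 ℂ H (PiLp 2 fun _ : Fin 3 => H)).symm.toContinuousLinearMap.comp
    ((M.comp (WithLp.fstL 2 ℂ H (PiLp 2 fun _ : Fin 3 => H))).prod
      ((PiLp.continuousLinearEquiv 2 ℂ fun _ : Fin 3 => H).symm.toContinuousLinearMap.comp
        (ContinuousLinearMap.pi fun j =>
          M.comp ((PiLp.proj 2 (fun _ : Fin 3 => H) j).comp
            (WithLp.sndL 2 ℂ H (PiLp 2 fun _ : Fin 3 => H))) +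
          (c j : ℂ) • M.comp (WithLp.fstL 2 ℂ H (PiLp 2 fun _ : Fin 3 => H)))))

theorem shear_fst (M : H →L[ℂ] H) (c : Fin 3 → ℝ)
    (g : WithLp 2 (H × PiLp 2 fun _ : Fin 3 => H)) : (shear M c g).fst = M g.fst := rfl

theorem shear_snd (M : H →L[ℂ] H) (c : Fin 3 → ℝ)
    (g : WithLp 2 (H × PiLp 2 fun _ : Fin 3 => H)) (j : Fin 3) :
    (shear M c g).snd j = M (g.snd j) + (c j : ℂ) • M g.fst := rfl

theorem norm_sq_triple {H : Type*} [NormedAddCommGroup H]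
    (g : WithLp 2 (H × PiLp 2 fun _ : Fin 3 => H)) :
    ‖g‖ ^ 2 = ‖g.fst‖ ^ 2 + ∑ j, ‖g.snd j‖ ^ 2 := by
  rw [WithLp.prod_norm_sq_eq_of_L2, PiLp.norm_sq_eq_of_L2]

theorem norm_sq_shear {M : H →L[ℂ] H} (hM : ∀ x, ‖M x‖ = ‖x‖) (c : Fin 3 → ℝ)
    (g : WithLp 2 (H × PiLp 2 fun _ : Fin 3 => H)) :
    ‖shear M c g‖ ^ 2 = ‖g.fst‖ ^ 2 + ∑ j, ‖g.snd j + (c j : ℂ) • g.fst‖ ^ 2 := by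
  rw [norm_sq_triple, shear_fst, hM]
  congr 1
  refine Finset.sum_congr rfl fun j _ => ?_
  rw [shear_snd, ← map_smul, ← map_add, hM]

/-- The parallelogram law in each component. For `M = e^{ik·x}` and `M' = e^{-ik·x}` it expresses
that the average of `(π + k)²` and `(π - k)²` is `π² + k²`. -/
theorem norm_sq_shear_add {M M' : H →L[ℂ] H} (hM : ∀ x, ‖M x‖ = ‖x‖) (hM' : ∀ x, ‖M' x‖ = ‖x‖)
    (c : Fin 3 → ℝ) (g : WithLp 2 (H × PiLp 2 fun _ : Fin 3 => H)) :
    ‖shear M c g‖ ^ 2 + ‖shear M' (-c) g‖ ^ 2 =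
      2 * ‖g‖ ^ 2 + 2 * (∑ j, c j ^ 2) * ‖g.fst‖ ^ 2 := by
  have h : ∀ j, ‖g.snd j + (c j : ℂ) • g.fst‖ ^ 2 + ‖g.snd j + ((-c) j : ℂ) • g.fst‖ ^ 2 =
      2 * ‖g.snd j‖ ^ 2 + 2 * c j ^ 2 * ‖g.fst‖ ^ 2 := fun j => by
    have h1 := parallelogram_law_with_norm ℂ (g.snd j) ((c j : ℂ) • g.fst)
    have h2 : ‖(c j : ℂ) • g.fst‖ ^ 2 = c j ^ 2 * ‖g.fst‖ ^ 2 := by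
      rw [norm_smul, Complex.norm_real, mul_pow, Real.norm_eq_abs, sq_abs]
    rw [Pi.neg_apply, Complex.ofReal_neg, neg_smul, ← sub_eq_add_neg]
    nlinarith
  rw [norm_sq_shear hM, norm_sq_shear hM', norm_sq_triple g, add_add_add_comm,
    ← Finset.sum_add_distrib]
  simp only [h, Finset.sum_add_distrib, ← Finset.mul_sum, ← Finset.sum_mul]
  ring

attribute [irreducible] tripleMap shear

end Shear

/-! ### Translations -/

section Translation

variable {d : ℕ} {𝒦 : Type*} [NormedAddCommGroup 𝒦] [InnerProductSpace ℂ 𝒦]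
  (U : Rd d → 𝒦 →L[ℂ] 𝒦)

/-- The operator `e^{i k·P}` as a continuous linear map. -/
def transOp (k : Rd d) : L2 d 𝒦 →L[ℂ] L2 d 𝒦 :=
  ((U k).compLpL 2 (volume : Measure (Rd d))).comp
    (Lp.compMeasurePreservingₗᵢ ℂ (fun x : Rd d => x + k)
      (measurePreserving_add_right volume k)).toContinuousLinearMap

theorem totalTranslation_apply (k : Rd d) (Ψ : L2 d 𝒦) :
    totalTranslation U k Ψ = transOp U k Ψ := rfl

theorem coeFn_transOp (k : Rd d) (Ψ : L2 d 𝒦) :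
    transOp U k Ψ =ᵐ[volume] fun x => U k (Ψ (x + k)) := by
  have h1 := ContinuousLinearMap.coeFn_compLpL (U k)
    (Lp.compMeasurePreservingₗᵢ ℂ (fun x : Rd d => x + k) (measurePreserving_add_right volume k) Ψ)
  have h2 := Lp.coeFn_compMeasurePreserving Ψ (measurePreserving_add_right volume k)
  filter_upwards [h1, h2] with x h3 h4
  exact h3.trans (congrArg (U k) h4)

attribute [irreducible] transOp

variable {U}

theorem inner_transOp (hU : ∀ k ψ φ, ⟪U k ψ, φ⟫_ℂ = ⟪ψ, U (-k) φ⟫_ℂ) (k : Rd d)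
    (Ψ Φ : L2 d 𝒦) : ⟪transOp U k Ψ, Φ⟫_ℂ = ⟪Ψ, transOp U (-k) Φ⟫_ℂ := by
  rw [L2.inner_def, L2.inner_def]
  have h1 : ∫ x, ⟪transOp U k Ψ x, Φ x⟫_ℂ = ∫ x, ⟪Ψ (x + k), U (-k) (Φ (x + k - k))⟫_ℂ := by
    refine integral_congr_ae ?_
    filter_upwards [coeFn_transOp U k Ψ] with x h2
    rw [h2, hU, add_sub_cancel_right]
  rw [h1, integral_add_right_eq_self (fun x => ⟪Ψ x, U (-k) (Φ (x - k))⟫_ℂ) k]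
  refine integral_congr_ae ?_
  filter_upwards [coeFn_transOp U (-k) Φ] with x h2
  rw [h2, sub_eq_add_neg]

theorem transOp_transOp (hU : ∀ k l ψ, U (k + l) ψ = U k (U l ψ)) (k l : Rd d) (Ψ : L2 d 𝒦) :
    transOp U k (transOp U l Ψ) = transOp U (k + l) Ψ := by
  refine Lp.ext ?_
  filter_upwards [coeFn_transOp U k (transOp U l Ψ), coeFn_transOp U (k + l) Ψ,
    (measurePreserving_add_right volume k).quasiMeasurePreserving.ae (coeFn_transOp U l Ψ)]
    with x h1 h2 h3
  rw [h1, h2, h3, hU, add_assoc, add_comm k l]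

theorem transOp_zero (hU : ∀ ψ, U 0 ψ = ψ) (Ψ : L2 d 𝒦) : transOp U 0 Ψ = Ψ := by
  refine Lp.ext ?_
  filter_upwards [coeFn_transOp U 0 Ψ] with x h1
  rw [h1, hU, add_zero]

theorem norm_transOp (hU : ∀ k ψ, ‖U k ψ‖ = ‖ψ‖) (k : Rd d) (Ψ : L2 d 𝒦) :
    ‖transOp U k Ψ‖ = ‖Ψ‖ := by
  have h : ‖transOp U k Ψ‖ ^ 2 = ‖Ψ‖ ^ 2 := by
    rw [norm_sq_eq_integral, norm_sq_eq_integral,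
      ← integral_add_right_eq_self (fun x => ‖Ψ x‖ ^ 2) k]
    refine integral_congr_ae ?_
    filter_upwards [coeFn_transOp U k Ψ] with x h1
    rw [h1, hU]
  exact (pow_left_inj₀ (norm_nonneg _) (norm_nonneg _) two_ne_zero).1 h

end Translation

/-! ### Fibre operators -/

section Fiber

variable {d : ℕ} {𝒦 : Type*} [NormedAddCommGroup 𝒦] [InnerProductSpace ℂ 𝒦] {A : 𝒦 →ₗ.[ℂ] 𝒦}

theorem mem_graph_fiberOp (Ψ Φ : L2 d 𝒦) :
    (Ψ, Φ) ∈ (fiberOp A).graph ↔ ∀ᵐ x, (Ψ x, Φ x) ∈ A.graph := by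
  rw [fiberOp, Submodule.toLinearPMap_graph_eq]
  · rfl
  · rintro ⟨Ψ, Φ⟩ h (rfl : Ψ = 0)
    refine Lp.ext ?_
    have h' : ∀ᵐ x, ((0 : L2 d 𝒦) x, Φ x) ∈ A.graph := h
    filter_upwards [h', Lp.coeFn_zero 𝒦 2 (volume : Measure (Rd d))] with x h1 h2
    rw [h2, Pi.zero_apply] at h1 ⊢
    exact A.graph_fst_eq_zero_snd h1 rfl

/-- Along a common subsequence both components converge almost everywhere, and the graph of `A` is
closed in each fibre. -/
theorem fiberOp_isClosed (hA : IsClosed (A.graph : Set (𝒦 × 𝒦))) :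
    (fiberOp A : L2 d 𝒦 →ₗ.[ℂ] L2 d 𝒦).IsClosed := by
  refine IsSeqClosed.isClosed fun p q hp hpq => ?_
  have h1 := (Prod.tendsto_iff p q).1 hpq
  obtain ⟨φ, hφ, hφ'⟩ := (tendstoInMeasure_of_tendsto_Lp h1.1).exists_seq_tendsto_ae
  obtain ⟨χ, hχ, hχ'⟩ := (tendstoInMeasure_of_tendsto_Lp
    (h1.2.comp hφ.tendsto_atTop)).exists_seq_tendsto_ae
  have hp' : ∀ᵐ x, ∀ n, ((p n).1 x, (p n).2 x) ∈ A.graph :=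
    ae_all_iff.2 fun n => (mem_graph_fiberOp _ _).1 (hp n)
  refine (mem_graph_fiberOp q.1 q.2).2 ?_
  filter_upwards [hφ', hχ', hp'] with x h2 h3 h4
  exact hA.mem_of_tendsto ((h2.comp hχ.tendsto_atTop).prodMk_nhds h3)
    (Filter.Eventually.of_forall fun n => h4 _)

theorem mulOp_mem_graph_fiberOp {θ : Rd d → ℂ} (hθ : IsMultiplier θ) {Ψ Φ : L2 d 𝒦}
    (h : (Ψ, Φ) ∈ (fiberOp A).graph) :
    (mulOp volume 𝒦 hθ Ψ, mulOp volume 𝒦 hθ Φ) ∈ (fiberOp A).graph := by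
  rw [mem_graph_fiberOp] at h ⊢
  filter_upwards [h, coeFn_mulOp hθ Ψ, coeFn_mulOp hθ Φ] with x h1 h2 h3
  rw [h2, h3]
  exact A.graph.smul_mem _ h1

theorem transOp_mem_graph_fiberOp {U : Rd d → 𝒦 →L[ℂ] 𝒦} {k : Rd d}
    (hU : ∀ ψ φ, (ψ, φ) ∈ A.graph → (U k ψ, U k φ) ∈ A.graph) {Ψ Φ : L2 d 𝒦}
    (h : (Ψ, Φ) ∈ (fiberOp A).graph) : (transOp U k Ψ, transOp U k Φ) ∈ (fiberOp A).graph := by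
  rw [mem_graph_fiberOp] at h ⊢
  filter_upwards [(measurePreserving_add_right volume k).quasiMeasurePreserving.ae h,
    coeFn_transOp U k Ψ, coeFn_transOp U k Φ] with x h1 h2 h3
  rw [h2, h3]
  exact hU _ _ h1

end Fiber

/-! ### Test functions with values in a Hilbert space -/

section Test

variable {𝒦 : Type*} [NormedAddCommGroup 𝒦] [InnerProductSpace ℂ 𝒦] {f : Rd 3 → ℂ}

theorem IsTest.memLp_smul (hf : IsTest f) {ξ : Rd 3 → 𝒦} (hξ : Continuous ξ) :
    MemLp (fun x => f x • ξ x) 2 volume :=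
  (hf.1.continuous.smul hξ).memLp_of_hasCompactSupport hf.2.smul_right

theorem IsTest.fderiv_apply (hf : IsTest f) (v : Rd 3) : IsTest fun x => fderiv ℝ f x v :=
  ⟨(hf.1.fderiv_right (m := ∞) (by norm_num)).clm_apply contDiff_const,
    hf.2.fderiv_apply ℝ v⟩

theorem IsTest.comp_add (hf : IsTest f) (k : Rd 3) : IsTest fun x => f (x + k) :=
  ⟨hf.1.comp (contDiff_id.add contDiff_const), hf.2.comp_homeomorph (Homeomorph.addRight k)⟩

theorem IsTest.mul {g : Rd 3 → ℂ} (hf : IsTest f) (hg : IsTest g) : IsTest fun x => f x * g x :=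
  ⟨hf.1.mul hg.1, hf.2.mul_right⟩

theorem IsTest.conj (hf : IsTest f) : IsTest fun x => starRingEnd ℂ (f x) :=
  ⟨Complex.conjCLE.contDiff.comp hf.1, hf.2.comp_left (map_zero _)⟩

theorem IsTest.isMultiplier (hf : IsTest f) : IsMultiplier f :=
  ⟨hf.1.continuous.measurable, hf.1.continuous.bounded_above_of_compact_support hf.2⟩

/-- The vector `f ⊗ η`. -/
def testVec (hf : IsTest f) (η : 𝒦) : L2 3 𝒦 := (hf.memLp_smul (continuous_const (y := η))).toLp _

theorem coeFn_testVec (hf : IsTest f) (η : 𝒦) : testVec hf η =ᵐ[volume] fun x => f x • η :=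
  (hf.memLp_smul (continuous_const (y := η))).coeFn_toLp

/-- The function `|V| |f|²` is integrable, being a locally integrable function times a continuous
one of compact support. -/
theorem mem_mulFormDomain_of_test {V : Rd 3 → ℝ} (hV : Measurable V)
    (hVloc : LocallyIntegrable V volume) (hf : IsTest f) {η : 𝒦} {Ψ : L2 3 𝒦}
    (hΨ : Ψ =ᵐ[volume] fun x => f x • η) : Ψ ∈ (mulForm 𝒦 V hV).dom := by
  show MemLp (fun x => ((√|V x| : ℝ) : ℂ) • Ψ x) 2 volume
  have hm : AEStronglyMeasurable (fun x => ((√|V x| : ℝ) : ℂ) • Ψ x) volume :=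
    (Complex.measurable_ofReal.comp hV.norm.sqrt).aestronglyMeasurable.smul
      (Lp.aestronglyMeasurable Ψ)
  rw [memLp_two_iff_integrable_sq_norm hm]
  have hc : Continuous fun x => ‖f x‖ ^ 2 * ‖η‖ ^ 2 := by have := hf.1.continuous; fun_prop
  have hs : HasCompactSupport fun x => ‖f x‖ ^ 2 * ‖η‖ ^ 2 :=
    (hf.2.comp_left (g := fun z : ℂ => ‖z‖ ^ 2) (by simp)).mul_right
  have hi : Integrable (fun x => (‖f x‖ ^ 2 * ‖η‖ ^ 2) • V x) volume :=
    hVloc.integrable_smul_left_of_hasCompactSupport hc hs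
  refine hi.norm.congr ?_
  filter_upwards [hΨ] with x hx
  rw [hx, norm_smul, norm_smul, norm_smul, Complex.norm_real, Real.norm_of_nonneg (by positivity),
    Real.norm_of_nonneg (Real.sqrt_nonneg _), mul_pow, Real.sq_sqrt (abs_nonneg _), mul_pow,
    Real.norm_eq_abs]
  ring

end Test

/-! ### An abstract particle coupled to a field -/

section Abstract

variable {𝒦 : Type*} [NormedAddCommGroup 𝒦] [InnerProductSpace ℂ 𝒦]

/-- The algebraic tensor product `C₀^∞(ℝ³) ⊗̂ S`. -/
def tensorDomain (S : Submodule ℂ 𝒦) : Submodule ℂ (L2 3 𝒦) :=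
  Submodule.span ℂ {Ψ | ∃ f, IsTest f ∧ ∃ η ∈ S, Ψ =ᵐ[volume] fun x => f x • η}

/-- All vectors `(m Ψ, π₁Ψ, π₂Ψ, π₃Ψ)` with `Ψ` in `C₀^∞(ℝ³) ⊗̂ S`, for `π_j = p_j ⊗ 1 + √α A_j(x)`. -/
def gaugeGraph (α m : ℝ) (A : Fin 3 → Rd 3 → 𝒦 →ₗ.[ℂ] 𝒦) (S : Submodule ℂ 𝒦) :
    Submodule ℂ (WithLp 2 (L2 3 𝒦 × PiLp 2 fun _ : Fin 3 => L2 3 𝒦)) :=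
  Submodule.span ℂ {G | ∃ f, IsTest f ∧ ∃ η ∈ S,
    (G.fst =ᵐ[volume] fun x => (m : ℂ) • f x • η) ∧
    ∀ j : Fin 3, ∃ ξ : Rd 3 → 𝒦, (∀ x, (η, ξ x) ∈ (A j x).graph) ∧
      G.snd j =ᵐ[volume] fun x =>
        (-Complex.I * fderiv ℝ f x (EuclideanSpace.single j (1 : ℝ))) • η
          + ((√α : ℝ) : ℂ) • f x • ξ x}

/-- The resolvent `((p ⊗ 1 + √α A(x))² + m²)⁻¹`. -/
def gaugeResolvent [CompleteSpace 𝒦] (α m : ℝ) (A : Fin 3 → Rd 3 → 𝒦 →ₗ.[ℂ] 𝒦)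
    (S : Submodule ℂ 𝒦) : L2 3 𝒦 →L[ℂ] L2 3 𝒦 :=
  massResolvent (H := L2 3 𝒦) (H' := PiLp 2 fun _ : Fin 3 => L2 3 𝒦) m (gaugeGraph α m A S)

/-- The form `√((p ⊗ 1 + √α A(x))² + m²) - m + 1 ⊗ B*B`. -/
def gaugeForm [CompleteSpace 𝒦] (α m : ℝ) (A : Fin 3 → Rd 3 → 𝒦 →ₗ.[ℂ] 𝒦) (S : Submodule ℂ 𝒦)
    (B : 𝒦 →ₗ.[ℂ] 𝒦) : QForm (L2 3 𝒦) :=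
  ((QForm.ofOp (fourthRootInv (gaugeResolvent α m A S))).add (QForm.const _ (-m))).add
    (QForm.ofOp (fiberOp B))

/-- The properties of a translation covariant field which are needed for (H.1)–(H.4). -/
structure IsCovariantField (S : Submodule ℂ 𝒦) (A : Fin 3 → Rd 3 → 𝒦 →ₗ.[ℂ] 𝒦)
    (B : 𝒦 →ₗ.[ℂ] 𝒦) (U : Rd 3 → 𝒦 →L[ℂ] 𝒦) : Prop where
  dense : Dense (S : Set 𝒦)
  exists_unit : ∃ η ∈ S, ‖η‖ = 1
  exists_potential : ∀ η ∈ S, ∀ j, ∃ ξ : Rd 3 → 𝒦, (∀ x, (η, ξ x) ∈ (A j x).graph) ∧ Continuous ξ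
  closed : IsClosed (B.graph : Set (𝒦 × 𝒦))
  exists_energy : ∀ η ∈ S, ∃ φ, (η, φ) ∈ B.graph
  map_zero : ∀ ψ, U 0 ψ = ψ
  map_add : ∀ k l ψ, U (k + l) ψ = U k (U l ψ)
  norm_map : ∀ k ψ, ‖U k ψ‖ = ‖ψ‖
  inner_map : ∀ k ψ φ, ⟪U k ψ, φ⟫_ℂ = ⟪ψ, U (-k) φ⟫_ℂ
  map_mem : ∀ k, ∀ η ∈ S, U k η ∈ S
  map_energy : ∀ k ψ φ, (ψ, φ) ∈ B.graph → (U k ψ, U k φ) ∈ B.graph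
  map_potential : ∀ k j x η ξ, (η, ξ) ∈ (A j (x + k)).graph → (U k η, U k ξ) ∈ (A j x).graph

end Abstract

/-! ### The domain `C₀^∞(ℝ³) ⊗̂ S` -/

section Domain

variable {𝒦 : Type*} [NormedAddCommGroup 𝒦] [InnerProductSpace ℂ 𝒦] {S : Submodule ℂ 𝒦}
  {A : Fin 3 → Rd 3 → 𝒦 →ₗ.[ℂ] 𝒦} {B : 𝒦 →ₗ.[ℂ] 𝒦} {U : Rd 3 → 𝒦 →L[ℂ] 𝒦}

theorem testVec_mem_tensorDomain {f : Rd 3 → ℂ} (hf : IsTest f) {η : 𝒦} (hη : η ∈ S) :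
    testVec hf η ∈ tensorDomain S :=
  Submodule.subset_span ⟨f, hf, η, hη, coeFn_testVec hf η⟩

theorem tensorDomain_le {p : Submodule ℂ (L2 3 𝒦)}
    (h : ∀ f (hf : IsTest f), ∀ η ∈ S, testVec hf η ∈ p) : tensorDomain S ≤ p := by
  refine Submodule.span_le.2 ?_
  rintro Ψ ⟨f, hf, η, hη, hΨ⟩
  have h1 : Ψ = testVec hf η := Lp.ext (hΨ.trans (coeFn_testVec hf η).symm)
  rw [h1]
  exact h f hf η hη

/-- Testing with `g ⊗ η` for real `g` shows that the vector `∫ g(x) Φ(x) dx` is orthogonal to the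
dense space `S`. It vanishes for every test function `g`, hence `Φ = 0`. -/
theorem eq_zero_of_inner_testVec [CompleteSpace 𝒦] (hS : Dense (S : Set 𝒦)) {Φ : L2 3 𝒦}
    (h : ∀ f (hf : IsTest f), ∀ η ∈ S, ⟪testVec hf η, Φ⟫_ℂ = 0) : Φ = 0 := by
  refine Lp.ext ((?_ : ⇑Φ =ᵐ[volume] 0).trans (Lp.coeFn_zero _ _ _).symm)
  have hloc : LocallyIntegrable Φ volume := (Lp.memLp Φ).locallyIntegrable (by norm_num)
  refine ae_eq_zero_of_integral_contDiff_smul_eq_zero hloc fun g hg hgc => ?_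
  have hgC : IsTest fun k => (g k : ℂ) :=
    ⟨Complex.ofRealCLM.contDiff.comp hg, hgc.comp_left Complex.ofReal_zero⟩
  have hint : Integrable (fun x => g x • Φ x) volume :=
    hloc.integrable_smul_left_of_hasCompactSupport hg.continuous hgc
  refine hS.eq_zero_of_mem_orthogonal (𝕜 := ℂ) ?_
  rw [Submodule.mem_orthogonal]
  intro η hη
  have h1 := h _ hgC η hη
  rw [L2.inner_def] at h1
  rw [← integral_inner hint, ← h1]
  refine integral_congr_ae ?_
  filter_upwards [coeFn_testVec hgC η] with x hx
  rw [hx, inner_smul_left, Complex.conj_ofReal, ← Complex.coe_smul, inner_smul_right]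

theorem tensorDomain_dense [CompleteSpace 𝒦] (hS : Dense (S : Set 𝒦)) :
    Dense (tensorDomain S : Set (L2 3 𝒦)) := by
  rw [Submodule.dense_iff_topologicalClosure_eq_top,
    Submodule.topologicalClosure_eq_top_iff, Submodule.eq_bot_iff]
  intro Φ hΦ
  rw [Submodule.mem_orthogonal] at hΦ
  exact eq_zero_of_inner_testVec hS fun f hf η hη => hΦ _ (testVec_mem_tensorDomain hf hη)

theorem tensorDomain_le_mulForm_dom {V : Rd 3 → ℝ} (hV : Measurable V)
    (hVloc : LocallyIntegrable V volume) : tensorDomain S ≤ (mulForm 𝒦 V hV).dom :=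
  tensorDomain_le fun _ hf η _ => mem_mulFormDomain_of_test hV hVloc hf (coeFn_testVec hf η)

theorem tensorDomain_le_fiberOp_domain (hB : ∀ η ∈ S, ∃ φ, (η, φ) ∈ B.graph) : tensorDomain S ≤
      (fiberOp B : L2 3 𝒦 →ₗ.[ℂ] L2 3 𝒦).domain := by
  refine tensorDomain_le fun f hf η hη => ?_
  obtain ⟨φ, hφ⟩ := hB η hη
  refine LinearPMap.mem_domain_of_mem_graph (y := testVec hf φ) ?_
  rw [mem_graph_fiberOp]
  filter_upwards [coeFn_testVec hf η, coeFn_testVec hf φ] with x h1 h2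
  rw [h1, h2]
  exact Submodule.smul_mem _ (f x) hφ

theorem mulOp_mem_tensorDomain {θ : Rd 3 → ℂ} (hθ : IsMultiplier θ)
    (h : ∀ f, IsTest f → IsTest fun x => θ x * f x) {Ψ : L2 3 𝒦} (hΨ : Ψ ∈ tensorDomain S) :
    mulOp volume 𝒦 hθ Ψ ∈ tensorDomain S := by
  have h1 : tensorDomain S ≤ (tensorDomain S).comap (mulOp volume 𝒦 hθ).toLinearMap :=
      tensorDomain_le fun f hf η hη => by
    refine Submodule.subset_span ⟨_, h f hf, η, hη, ?_⟩
    filter_upwards [coeFn_testVec hf η, coeFn_mulOp hθ (testVec hf η)] with x h2 h3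
    refine h3.trans ?_
    rw [h2, smul_smul]
  exact h1 hΨ

theorem modOp_mem_tensorDomain (k : Rd 3) {Ψ : L2 3 𝒦} (hΨ : Ψ ∈ tensorDomain S) :
    modOp k Ψ ∈ tensorDomain S := by
  unfold modOp
  exact mulOp_mem_tensorDomain _ (fun f hf => hf.planeWave_mul k) hΨ

theorem transOp_mem_tensorDomain (hU : ∀ k, ∀ η ∈ S, U k η ∈ S) (k : Rd 3) {Ψ : L2 3 𝒦}
    (hΨ : Ψ ∈ tensorDomain S) :
    transOp U k Ψ ∈ tensorDomain S := by
  have h1 : tensorDomain S ≤ (tensorDomain S).comap (transOp U k).toLinearMap :=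
      tensorDomain_le fun f hf η hη => by
    refine Submodule.subset_span ⟨_, hf.comp_add k, _, hU k η hη, ?_⟩
    filter_upwards [(measurePreserving_add_right volume k).quasiMeasurePreserving.ae
      (coeFn_testVec hf η), coeFn_transOp U k (testVec hf η)] with x h2 h3
    refine h3.trans ?_
    rw [h2]
    exact (U k).map_smul _ _
  exact h1 hΨ

end Domain

/-! ### The space `gaugeGraph` -/

section GaugeGraph

variable {𝒦 : Type*} [NormedAddCommGroup 𝒦] [InnerProductSpace ℂ 𝒦] {S : Submodule ℂ 𝒦}
  {A : Fin 3 → Rd 3 → 𝒦 →ₗ.[ℂ] 𝒦} {U : Rd 3 → 𝒦 →L[ℂ] 𝒦} {α m : ℝ}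
  (hA : ∀ η ∈ S, ∀ j, ∃ ξ : Rd 3 → 𝒦, (∀ x, (η, ξ x) ∈ (A j x).graph) ∧ Continuous ξ)

include hA in
theorem exists_mem_gaugeGraph_testVec {f : Rd 3 → ℂ} (hf : IsTest f) {η : 𝒦}
    (hη : η ∈ S) : ∃ g ∈ gaugeGraph α m A S, g.fst = (m : ℂ) • testVec hf η := by
  choose ξ hξ hξc using hA η hη
  let v : Fin 3 → L2 3 𝒦 := fun j =>
    (-Complex.I) • testVec (hf.fderiv_apply (EuclideanSpace.single j (1 : ℝ))) η +
      ((√α : ℝ) : ℂ) • (hf.memLp_smul (hξc j)).toLp _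
  refine ⟨WithLp.toLp 2 ((m : ℂ) • testVec hf η, WithLp.toLp 2 v), Submodule.subset_span
    ⟨f, hf, η, hη, ?_, fun j => ⟨ξ j, hξ j, ?_⟩⟩, rfl⟩
  · filter_upwards [coeFn_testVec hf η, Lp.coeFn_smul (m : ℂ) (testVec hf η)] with x h1 h2
    refine h2.trans ?_
    rw [Pi.smul_apply, h1]
  · filter_upwards [coeFn_testVec (hf.fderiv_apply (EuclideanSpace.single j (1 : ℝ))) η,
      Lp.coeFn_smul (-Complex.I) (testVec (hf.fderiv_apply (EuclideanSpace.single j (1 : ℝ))) η),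
      (hf.memLp_smul (hξc j)).coeFn_toLp,
      Lp.coeFn_smul ((√α : ℝ) : ℂ) ((hf.memLp_smul (hξc j)).toLp _),
      Lp.coeFn_add ((-Complex.I) • testVec (hf.fderiv_apply (EuclideanSpace.single j (1 : ℝ))) η)
        (((√α : ℝ) : ℂ) • (hf.memLp_smul (hξc j)).toLp _)] with x h1 h2 h3 h4 h5
    refine h5.trans ?_
    rw [Pi.add_apply, h2, h4, Pi.smul_apply, Pi.smul_apply, h1, h3, smul_smul]

include hA in
theorem exists_mem_gaugeGraph (hm : m ≠ 0) {Ψ : L2 3 𝒦} (hΨ : Ψ ∈ tensorDomain S) :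
    ∃ g ∈ gaugeGraph α m A S, g.fst = (m : ℂ) • Ψ := by
  have h : tensorDomain S ≤ (gaugeGraph α m A S).map (WithLp.fstL 2 ℂ (L2 3 𝒦)
      (PiLp 2 fun _ : Fin 3 => L2 3 𝒦)).toLinearMap := tensorDomain_le fun f hf η hη => by
    obtain ⟨g, hg, hg1⟩ := exists_mem_gaugeGraph_testVec (α := α) (m := m) hA hf hη
    refine ⟨(m : ℂ)⁻¹ • g, Submodule.smul_mem _ _ hg, ?_⟩
    show (m : ℂ)⁻¹ • g.fst = _
    rw [hg1, smul_smul, inv_mul_cancel₀ (by exact_mod_cast hm), one_smul]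
  obtain ⟨g, hg, rfl⟩ := h hΨ
  exact ⟨(m : ℂ) • g, Submodule.smul_mem _ _ hg, rfl⟩

include hA in
theorem dense_fst_gaugeGraph [CompleteSpace 𝒦] (hS : Dense (S : Set 𝒦)) (hm : m ≠ 0) :
    Dense (((gaugeGraph α m A S).map (WithLp.fstL 2 ℂ (L2 3 𝒦) (PiLp 2 fun _ : Fin 3 => L2 3 𝒦)).toLinearMap : Submodule ℂ (L2 3 𝒦)) :
      Set (L2 3 𝒦)) := by
  refine (tensorDomain_dense hS).mono fun Ψ hΨ => ?_
  obtain ⟨g, hg, hg1⟩ := exists_mem_gaugeGraph (α := α) hA hm hΨ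
  refine ⟨(m : ℂ)⁻¹ • g, Submodule.smul_mem _ _ hg, ?_⟩
  show (m : ℂ)⁻¹ • g.fst = _
  rw [hg1, smul_smul, inv_mul_cancel₀ (by exact_mod_cast hm), one_smul]

theorem fderiv_planeWave_mul {f : Rd 3 → ℂ} (hf : IsTest f) (k x : Rd 3) (j : Fin 3) :
    fderiv ℝ (fun x => planeWave k x * f x) x (EuclideanSpace.single j (1 : ℝ)) =
      planeWave k x * fderiv ℝ f x (EuclideanSpace.single j (1 : ℝ)) +
        Complex.I * k j * (planeWave k x * f x) := by
  have h1 : HasFDerivAt (fun x : Rd 3 => ((inner ℝ k x : ℝ) : ℂ) * Complex.I)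
      (Complex.I • (Complex.ofRealCLM.comp (innerSL ℝ k))) x := by
    have := ((Complex.ofRealCLM.comp (innerSL ℝ k)).hasFDerivAt (x := x)).mul_const Complex.I
    exact this
  have h2 := h1.cexp.mul ((hf.1.differentiable (by norm_num)) x).hasFDerivAt
  have h3 : (fun x => planeWave k x * f x) = (fun x => Complex.exp (((inner ℝ k x : ℝ) : ℂ) *
    Complex.I)) * f := rfl
  rw [h3, h2.fderiv]
  simp [planeWave, EuclideanSpace.inner_single_right]
  ring

/-- The commutation rule `π_j e^{ik·x} = e^{ik·x} (π_j + k_j)`. The shear constant is `k_j / m`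
because the first component stores `m Ψ` rather than `Ψ`. -/
theorem shear_mem_gaugeGraph (hm : m ≠ 0) (k : Rd 3)
    {g : WithLp 2 (L2 3 𝒦 × PiLp 2 fun _ : Fin 3 => L2 3 𝒦)} (hg : g ∈ gaugeGraph α m A S) :
    shear (modOp k) (fun j => k j / m) g ∈ gaugeGraph α m A S := by
  have h : gaugeGraph α m A S ≤ (gaugeGraph α m A S).comap
      (shear (modOp k) fun j => k j / m).toLinearMap := by
    refine Submodule.span_le.2 ?_
    rintro g ⟨f, hf, η, hη, h1, h2⟩
    refine Submodule.subset_span ⟨_, hf.planeWave_mul k, η, hη, ?_, fun j => ?_⟩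
    · filter_upwards [h1, coeFn_modOp k g.fst] with x h3 h4
      refine (congrArg (fun F : L2 3 𝒦 => F x) (shear_fst _ _ g)).trans (h4.trans ?_)
      rw [h3, smul_comm, smul_smul (planeWave k x)]
    · obtain ⟨ξ, hξ, h3⟩ := h2 j
      refine ⟨ξ, hξ, ?_⟩
      have h4 : (shear (modOp k) (fun j => k j / m) g).snd j =
        modOp k (g.snd j) + ((k j / m : ℝ) : ℂ) • modOp k g.fst := shear_snd _ _ _ _
      filter_upwards [h1, h3, coeFn_modOp k g.fst, coeFn_modOp k (g.snd j),
        Lp.coeFn_add (modOp k (g.snd j)) (((k j / m : ℝ) : ℂ) • modOp k g.fst),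
        Lp.coeFn_smul ((k j / m : ℝ) : ℂ) (modOp k g.fst)] with x e1 e2 e3 e4 e5 e6
      refine (congrArg (fun F : L2 3 𝒦 => F x) h4).trans (e5.trans ?_)
      rw [Pi.add_apply, e6, Pi.smul_apply, e3, e4, e1, e2, fderiv_planeWave_mul hf]
      have hm' : (m : ℂ) ≠ 0 := by exact_mod_cast hm
      push_cast
      match_scalars
      · field_simp
        linear_combination (planeWave k x * f x * k j) * Complex.I_sq
      · ring
  exact h hg

/-- Translations commute with `p`, and the shift in the argument of `A_j` is undone by covariance:
`ξ` is replaced by `x ↦ U(k) ξ(x + k)`. -/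
theorem trans_mem_gaugeGraph (hU : ∀ k, ∀ η ∈ S, U k η ∈ S)
    (hUA : ∀ k j x η ξ, (η, ξ) ∈ (A j (x + k)).graph → (U k η, U k ξ) ∈ (A j x).graph) (k : Rd 3)
    {g : WithLp 2 (L2 3 𝒦 × PiLp 2 fun _ : Fin 3 => L2 3 𝒦)} (hg : g ∈ gaugeGraph α m A S) :
    WithLp.toLp 2 (transOp U k g.fst, tripleMap (transOp U k) g.snd) ∈ gaugeGraph α m A S := by
  let T : WithLp 2 (L2 3 𝒦 × PiLp 2 fun _ : Fin 3 => L2 3 𝒦) →ₗ[ℂ]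
      WithLp 2 (L2 3 𝒦 × PiLp 2 fun _ : Fin 3 => L2 3 𝒦) :=
    { toFun := fun g => WithLp.toLp 2 (transOp U k g.fst, tripleMap (transOp U k) g.snd)
      map_add' := fun g g' => by simp [← WithLp.toLp_add]
      map_smul' := fun c g => by simp [← WithLp.toLp_smul] }
  have h : gaugeGraph α m A S ≤ (gaugeGraph α m A S).comap T := by
    refine Submodule.span_le.2 ?_
    rintro g ⟨f, hf, η, hη, h1, h2⟩
    refine Submodule.subset_span ⟨_, hf.comp_add k, U k η, hU k η hη, ?_, fun j => ?_⟩
    · filter_upwards [(measurePreserving_add_right volume k).quasiMeasurePreserving.ae h1,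
        coeFn_transOp U k g.fst] with x h3 h4
      refine h4.trans ?_
      rw [h3, map_smul, map_smul]
    · obtain ⟨ξ, hξ, h3⟩ := h2 j
      refine ⟨fun x => U k (ξ (x + k)), fun x => hUA k j x _ _ (hξ (x + k)), ?_⟩
      filter_upwards [(measurePreserving_add_right volume k).quasiMeasurePreserving.ae h3,
        coeFn_transOp U k (g.snd j)] with x h4 h5
      have h6 : (T g).snd j = transOp U k (g.snd j) := tripleMap_apply _ _ _
      refine (congrArg (fun F : L2 3 𝒦 => F x) h6).trans (h5.trans ?_)
      rw [h4, map_add, map_smul, map_smul, map_smul, fderiv_comp_add_right]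
  exact h hg

end GaugeGraph

/-! ### The hypotheses (H.1)–(H.3) -/

theorem norm_sq_shear_div_le {H : Type*} [NormedAddCommGroup H] [InnerProductSpace ℂ H]
    {M M' : H →L[ℂ] H} (hM : ∀ x, ‖M x‖ = ‖x‖) (hM' : ∀ x, ‖M' x‖ = ‖x‖) (k : Rd 3) {m : ℝ}
    (hm : 0 < m) (g : WithLp 2 (H × PiLp 2 fun _ : Fin 3 => H)) :
    ‖shear M (fun j => k j / m) g‖ ^ 2 + ‖shear M' (fun j => (-k) j / m) g‖ ^ 2 ≤
      2 * ‖g‖ ^ 2 + 2 * ‖k‖ ^ 2 * ‖(m : ℂ)⁻¹ • g.fst‖ ^ 2 := by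
  have hneg : (fun j => (-k) j / m) = -fun j => k j / m := by
    funext j
    simp [neg_div]
  rw [hneg, norm_sq_shear_add hM hM', norm_smul, norm_inv, Complex.norm_real,
    Real.norm_of_nonneg hm.le, EuclideanSpace.norm_sq_eq]
  simp only [div_pow, ← Finset.sum_div, Real.norm_eq_abs, sq_abs]
  refine le_of_eq ?_
  field_simp

/-- The abstract inequality with `s = ‖k‖²` and `κ = K(k)`, for which `(K(k) + m)² = k² + m²`. -/
theorem fourthRootInv_shear_le {H : Type*} [NormedAddCommGroup H] [InnerProductSpace ℂ H]
    [CompleteSpace H] {G : Submodule ℂ (WithLp 2 (H × PiLp 2 fun _ : Fin 3 => H))} {m : ℝ}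
    (hm : 0 < m) (hG : Dense ((G.map (WithLp.fstL 2 ℂ H (PiLp 2 fun _ : Fin 3 => H)).toLinearMap :
      Submodule ℂ H) : Set H)) {Mp Mm : H →L[ℂ] H} (hadj : ∀ x y, ⟪Mp x, y⟫_ℂ = ⟪x, Mm y⟫_ℂ)
    (hMp : ∀ x, ‖Mp x‖ = ‖x‖) (hMm : ∀ x, ‖Mm x‖ = ‖x‖) (k : Rd 3)
    (hNp : ∀ g ∈ G, shear Mp (fun j => k j / m) g ∈ G)
    (hNm : ∀ g ∈ G, shear Mm (fun j => (-k) j / m) g ∈ G)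
    {g : WithLp 2 (H × PiLp 2 fun _ : Fin 3 => H)} (hg : g ∈ G) {x : H}
    (hx : (m : ℂ)⁻¹ • g.fst = x) :
    1 / 2 * (‖extendZero (fourthRootInv (massResolvent m G)) (Mp x)‖ ^ 2 +
      ‖extendZero (fourthRootInv (massResolvent m G)) (Mm x)‖ ^ 2) ≤
      ‖extendZero (fourthRootInv (massResolvent m G)) x‖ ^ 2 + relKinetic m k * ‖x‖ ^ 2 := by
  have hκ : 0 ≤ relKinetic m k := by
    rw [relKinetic, sub_nonneg]
    exact Real.le_sqrt_of_sq_le (by nlinarith [sq_nonneg ‖k‖])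
  have hκs : (relKinetic m k + m) ^ 2 = ‖k‖ ^ 2 + m ^ 2 := by
    rw [relKinetic, sub_add_cancel, Real.sq_sqrt (by positivity)]
  rw [← hx]
  exact fourthRootInv_conj_le hm hG hadj hMp hMm hNp hNm (shear_fst _ _) (shear_fst _ _) hκ hκs
    (norm_sq_shear_div_le hMp hMm k hm) (Submodule.le_topologicalClosure _ hg)

section Hypotheses

section

variable {𝒦 : Type*} [NormedAddCommGroup 𝒦] [InnerProductSpace ℂ 𝒦]
  {S : Submodule ℂ 𝒦} {A : Fin 3 → Rd 3 → 𝒦 →ₗ.[ℂ] 𝒦} {B : 𝒦 →ₗ.[ℂ] 𝒦} {U : Rd 3 → 𝒦 →L[ℂ] 𝒦}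

namespace IsCovariantField

theorem inner_transOp_transOp (h : IsCovariantField S A B U) (k : Rd 3) (Ψ Φ : L2 3 𝒦) :
    ⟪transOp U k Ψ, transOp U k Φ⟫_ℂ = ⟪Ψ, Φ⟫_ℂ := by
  rw [inner_transOp h.inner_map, transOp_transOp h.map_add, neg_add_cancel, transOp_zero h.map_zero]

theorem norm_extendZero_fiberOp_modOp (h : IsCovariantField S A B U) (k : Rd 3)
    {Ψ : L2 3 𝒦} (hΨ : Ψ ∈ tensorDomain S) :
    ‖extendZero (fiberOp B) (modOp k Ψ)‖ = ‖extendZero (fiberOp B) Ψ‖ := by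
  have h1 : extendZero (fiberOp B) (modOp k Ψ) = modOp k (extendZero (fiberOp B) Ψ) := by
    refine extendZero_eq ?_
    unfold modOp
    exact mulOp_mem_graph_fiberOp _ (mem_graph_extendZero
      (tensorDomain_le_fiberOp_domain h.exists_energy hΨ))
  rw [h1, norm_modOp]

theorem exists_gaugeGraph {α m : ℝ} (h : IsCovariantField S A B U) (hm : 0 < m) {Ψ : L2 3 𝒦}
    (hΨ : Ψ ∈ tensorDomain S) :
    ∃ g ∈ gaugeGraph α m A S, (m : ℂ)⁻¹ • g.fst = Ψ := by
  obtain ⟨g, hg, hg1⟩ := exists_mem_gaugeGraph (α := α) (m := m) h.exists_potential hm.ne' hΨ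
  refine ⟨g, hg, ?_⟩
  rw [hg1, smul_smul, inv_mul_cancel₀ (by exact_mod_cast hm.ne'), one_smul]

end IsCovariantField

end

variable {𝒦 : Type*} [NormedAddCommGroup 𝒦] [InnerProductSpace ℂ 𝒦] [CompleteSpace 𝒦]
  {S : Submodule ℂ 𝒦} {A : Fin 3 → Rd 3 → 𝒦 →ₗ.[ℂ] 𝒦} {B : 𝒦 →ₗ.[ℂ] 𝒦} {U : Rd 3 → 𝒦 →L[ℂ] 𝒦}
  {α m : ℝ}

theorem gaugeResolvent_nonneg : 0 ≤ gaugeResolvent α m A S :=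
  massResolvent_nonneg (H := L2 3 𝒦) (H' := PiLp 2 fun _ : Fin 3 => L2 3 𝒦)

theorem gaugeForm_quad (Ψ : L2 3 𝒦) : (gaugeForm α m A S B).quad Ψ =
    ‖extendZero (fourthRootInv (gaugeResolvent α m A S)) Ψ‖ ^ 2 + -m * ‖Ψ‖ ^ 2 +
      ‖extendZero (fiberOp B) Ψ‖ ^ 2 := by
  rw [gaugeForm, add_quad, add_quad, ofOp_quad, ofOp_quad, const_quad]

theorem gaugeForm_boundedBelowOn (D : Submodule ℂ (L2 3 𝒦)) :
    (gaugeForm α m A S B).BoundedBelowOn D :=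
  ⟨-m, fun Ψ _ => by
    rw [gaugeForm_quad]
    nlinarith [sq_nonneg ‖extendZero (fourthRootInv (gaugeResolvent α m A S)) Ψ‖,
      sq_nonneg ‖extendZero (fiberOp B) Ψ‖]⟩

theorem withPotential_zero_quad {𝒦 : Type*} [NormedAddCommGroup 𝒦] [InnerProductSpace ℂ 𝒦]
    (q : QForm (L2 3 𝒦)) (h0 : Measurable (0 : Rd 3 → ℝ))
    (Ψ : L2 3 𝒦) : (withPotential q 0 h0).quad Ψ = q.quad Ψ := by
  have h1 : (mulForm 𝒦 0 h0).quad Ψ = 0 := by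
    show (∫ x, (((0 : Rd 3 → ℝ) x : ℝ) : ℂ) * ⟪Ψ x, Ψ x⟫_ℂ).re = 0
    simp
  rw [withPotential, add_quad, h1, add_zero]

namespace IsCovariantField

theorem commute_gaugeResolvent (h : IsCovariantField S A B U) (k : Rd 3) :
    Commute (gaugeResolvent α m A S) (transOp U k) :=
  commute_massResolvent (H := L2 3 𝒦) (H' := PiLp 2 fun _ : Fin 3 => L2 3 𝒦)
    (inner_transOp h.inner_map k) (inner_tripleMap (inner_transOp h.inner_map k))
    (fun _ hg => trans_mem_gaugeGraph h.map_mem h.map_potential k hg)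
    (fun _ hg => trans_mem_gaugeGraph h.map_mem h.map_potential (-k) hg)

variable (h : IsCovariantField S A B U) (hm : 0 < m)

include h hm

theorem dense_fst : Dense (((gaugeGraph α m A S).map (WithLp.fstL 2 ℂ
    (L2 3 𝒦) (PiLp 2 fun _ : Fin 3 => L2 3 𝒦)).toLinearMap : Submodule ℂ (L2 3 𝒦)) :
      Set (L2 3 𝒦)) :=
  dense_fst_gaugeGraph h.exists_potential h.dense hm.ne'

theorem gaugeResolvent_injective : Function.Injective (gaugeResolvent α m A S) :=
  massResolvent_injective (H := L2 3 𝒦) (H' := PiLp 2 fun _ : Fin 3 => L2 3 𝒦) hm.ne'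
    (h.dense_fst hm)

theorem mem_graph_of_mem_gaugeGraph
    {g : WithLp 2 (L2 3 𝒦 × PiLp 2 fun _ : Fin 3 => L2 3 𝒦)} (hg : g ∈ gaugeGraph α m A S) :
    ((m : ℂ)⁻¹ • g.fst, opSqrt (opSqrt (gaugeResolvent α m A S))
      ((formIso (H := L2 3 𝒦) (H' := PiLp 2 fun _ : Fin 3 => L2 3 𝒦) m
        (gaugeGraph α m A S)).adjoint g)) ∈ (fourthRootInv (gaugeResolvent α m A S)).graph :=
  mem_graph_fourthRootInv_of_mem_closure (H := L2 3 𝒦) (H' := PiLp 2 fun _ : Fin 3 => L2 3 𝒦)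
    hm (h.dense_fst hm) (Submodule.le_topologicalClosure _ hg)

theorem le_fourthRootInv_domain :
    tensorDomain S ≤ (fourthRootInv (gaugeResolvent α m A S)).domain := fun Ψ hΨ => by
  obtain ⟨g, hg, rfl⟩ := h.exists_gaugeGraph (α := α) hm hΨ
  exact LinearPMap.mem_domain_of_mem_graph (h.mem_graph_of_mem_gaugeGraph hm hg)

theorem le_gaugeForm_dom : tensorDomain S ≤ (gaugeForm α m A S B).dom := fun _ hΨ =>
  ⟨⟨h.le_fourthRootInv_domain hm hΨ, trivial⟩,
    tensorDomain_le_fiberOp_domain h.exists_energy hΨ⟩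

theorem gaugeForm_closableOn : (gaugeForm α m A S B).ClosableOn (tensorDomain S) :=
  closableOn_ofOp_add_const_add_ofOp
    (fourthRootInv_isClosed gaugeResolvent_nonneg (h.gaugeResolvent_injective hm))
    (fiberOp_isClosed h.closed) (-m) (h.le_fourthRootInv_domain hm)
    (tensorDomain_le_fiberOp_domain h.exists_energy)

theorem hypH1 {V : Rd 3 → ℝ} (hV : Measurable V) (hVloc : LocallyIntegrable V volume)
    (hb : (withPotential (gaugeForm α m A S B) V hV).BoundedBelowOn (tensorDomain S))
    (hcl : (withPotential (gaugeForm α m A S B) V hV).ClosableOn (tensorDomain S)) :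
    HypH1 (gaugeForm α m A S B) V hV (tensorDomain S) where
  dense := tensorDomain_dense h.dense
  le_dom := le_inf (h.le_gaugeForm_dom hm) (tensorDomain_le_mulForm_dom hV hVloc)
  boundedBelow := gaugeForm_boundedBelowOn _
  closable := h.gaugeForm_closableOn hm
  boundedBelow_V := hb
  closable_V := hcl

theorem hypH1_zero (h0 : Measurable (0 : Rd 3 → ℝ)) :
    HypH1 (gaugeForm α m A S B) 0 h0 (tensorDomain S) := by
  refine h.hypH1 hm h0 (locallyIntegrable_const 0) ?_ ?_
  · obtain ⟨c, hc⟩ := gaugeForm_boundedBelowOn (α := α) (m := m) (A := A) (S := S) (B := B)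
      (tensorDomain S)
    exact ⟨c, fun Ψ hΨ => by rw [withPotential_zero_quad]; exact hc Ψ hΨ⟩
  · intro Ψ hΨ hΨ0 hc
    simp only [withPotential_zero_quad] at hc ⊢
    exact h.gaugeForm_closableOn hm Ψ hΨ hΨ0 hc

theorem gaugeForm_val_transOp (k : Rd 3) {Ψ Φ : L2 3 𝒦} (hΨ : Ψ ∈ tensorDomain S)
    (hΦ : Φ ∈ tensorDomain S) : (gaugeForm α m A S B).val (transOp U k Ψ) (transOp U k Φ) =
      (gaugeForm α m A S B).val Ψ Φ := by
  have h1 : ∀ Ψ ∈ tensorDomain S,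
      extendZero (fourthRootInv (gaugeResolvent α m A S)) (transOp U k Ψ) =
        transOp U k (extendZero (fourthRootInv (gaugeResolvent α m A S)) Ψ) := fun Ψ hΨ =>
    (extendZero_fourthRootInv_of_commute gaugeResolvent_nonneg (h.gaugeResolvent_injective hm)
      (h.commute_gaugeResolvent k) (h.le_fourthRootInv_domain hm hΨ)).2
  have h2 : ∀ Ψ ∈ tensorDomain S, extendZero (fiberOp B) (transOp U k Ψ) =
      transOp U k (extendZero (fiberOp B) Ψ) := fun Ψ hΨ =>
    extendZero_eq (transOp_mem_graph_fiberOp (h.map_energy k) (mem_graph_extendZero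
      (tensorDomain_le_fiberOp_domain h.exists_energy hΨ)))
  show ⟪extendZero (fourthRootInv (gaugeResolvent α m A S)) (transOp U k Ψ),
      extendZero (fourthRootInv (gaugeResolvent α m A S)) (transOp U k Φ)⟫_ℂ +
        ((-m : ℝ) : ℂ) * ⟪transOp U k Ψ, transOp U k Φ⟫_ℂ +
        ⟪extendZero (fiberOp B) (transOp U k Ψ), extendZero (fiberOp B) (transOp U k Φ)⟫_ℂ =
    ⟪extendZero (fourthRootInv (gaugeResolvent α m A S)) Ψ,
      extendZero (fourthRootInv (gaugeResolvent α m A S)) Φ⟫_ℂ + ((-m : ℝ) : ℂ) * ⟪Ψ, Φ⟫_ℂ +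
        ⟪extendZero (fiberOp B) Ψ, extendZero (fiberOp B) Φ⟫_ℂ
  rw [h1 Ψ hΨ, h1 Φ hΦ, h2 Ψ hΨ, h2 Φ hΦ, h.inner_transOp_transOp, h.inner_transOp_transOp,
    h.inner_transOp_transOp]

theorem hypH2 {Pf : Fin 3 → 𝒦 →ₗ.[ℂ] 𝒦} (hPf : ∀ j, IsSelfAdjoint (Pf j))
    (hU : IsExpGroup Pf U) : HypH2 (gaugeForm α m A S B) (tensorDomain S) Pf := by
  refine ⟨hPf, U, hU, fun k => ⟨le_antisymm ?_ fun Ψ hΨ => ?_, fun Ψ hΨ Φ hΦ => ?_⟩⟩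
  · rintro _ ⟨Ψ, hΨ, rfl⟩
    rw [totalTranslation_apply]
    exact transOp_mem_tensorDomain h.map_mem k hΨ
  · refine ⟨transOp U (-k) Ψ, transOp_mem_tensorDomain h.map_mem (-k) hΨ, ?_⟩
    refine (totalTranslation_apply U k _).trans ((transOp_transOp h.map_add k (-k) Ψ).trans ?_)
    rw [add_neg_cancel, transOp_zero h.map_zero]
  · rw [totalTranslation_apply, totalTranslation_apply]
    exact h.gaugeForm_val_transOp hm k hΨ hΦ

/-- The kinetic energy part of (H.3). -/
theorem fourthRootInv_modOp_le (k : Rd 3) {Ψ : L2 3 𝒦} (hΨ : Ψ ∈ tensorDomain S) :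
    1 / 2 * (‖extendZero (fourthRootInv (gaugeResolvent α m A S)) (modOp k Ψ)‖ ^ 2 +
      ‖extendZero (fourthRootInv (gaugeResolvent α m A S)) (modOp (-k) Ψ)‖ ^ 2) ≤
      ‖extendZero (fourthRootInv (gaugeResolvent α m A S)) Ψ‖ ^ 2 +
        relKinetic m k * ‖Ψ‖ ^ 2 := by
  obtain ⟨g, hg, hx⟩ := h.exists_gaugeGraph (α := α) hm hΨ
  have hG := h.dense_fst (α := α) hm
  have h1 : ∀ (k : Rd 3), ∀ g ∈ gaugeGraph α m A S,
      shear (modOp k) (fun j => k j / m) g ∈ gaugeGraph α m A S :=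
    fun k _ hg => shear_mem_gaugeGraph hm.ne' k hg
  exact fourthRootInv_shear_le (H := L2 3 𝒦) hm hG (inner_modOp k) (norm_modOp k)
    (norm_modOp (-k)) k (h1 k) (h1 (-k)) hg hx

theorem hypH3 : HypH3 (gaugeForm α m A S B) (tensorDomain S) (relKinetic m) := by
  refine ⟨measurable_relKinetic m, fun k => ⟨fun Ψ hΨ => ?_, fun Ψ hΨ => ?_⟩⟩
  · have h1 : modulation k Ψ ∈ tensorDomain S := by
      rw [modulation_apply]
      exact modOp_mem_tensorDomain k hΨ
    exact h.le_gaugeForm_dom hm h1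
  -- The mass term and the field energy do not depend on `k`, so they cancel in the second
  -- difference and only the kinetic part remains.
  · have h1 : ∀ k, (conjugated (gaugeForm α m A S B) k).quad Ψ =
        ‖extendZero (fourthRootInv (gaugeResolvent α m A S)) (modOp k Ψ)‖ ^ 2 + -m * ‖Ψ‖ ^ 2 +
          ‖extendZero (fiberOp B) Ψ‖ ^ 2 := fun k => by
      have h2 : (conjugated (gaugeForm α m A S B) k).quad Ψ =
        (gaugeForm α m A S B).quad (modulation k Ψ) := rfl
      rw [h2, modulation_apply, gaugeForm_quad, norm_modOp, h.norm_extendZero_fiberOp_modOp k hΨ]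
    have h3 := h.fourthRootInv_modOp_le (α := α) hm k hΨ
    rw [h1, h1, h1, modOp_zero]
    linarith

end IsCovariantField

end Hypotheses

/-! ### The quantized radiation field -/

section Field

theorem norm_polarization {e : Fin 2 → Rd 3 → Rd 3}
    (he : ∀ k l l', inner ℝ (e l k) (e l' k) = if l = l' then (1 : ℝ) else 0) (l : Fin 2)
    (k : Rd 3) : ‖e l k‖ = 1 := by
  have h := he k l l
  rw [if_pos rfl, real_inner_self_eq_norm_sq] at h
  exact (pow_eq_one_iff_of_nonneg (norm_nonneg _) two_ne_zero).1 h

theorem isCovariantField_vectorPotential {Λ : Rd 3 → ℝ} {e : Fin 2 → Rd 3 → Rd 3}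
    (hc : ∀ j x, MemLp (coupling Λ e j x) 2 photonMeasure) :
    IsCovariantField finitePhoton (vectorPotential Λ e) sqrtFieldEnergy fieldTranslation where
  dense := finitePhoton_dense
  exists_unit := exists_norm_eq_one_finitePhoton
  exists_potential := fun _ hη j => by
    obtain ⟨N, hN⟩ := exists_forall_apply_eq_zero hη
    exact exists_continuous_vectorPotential j (hc j) hN
  closed := sectorMul_isClosed _
  exists_energy := fun _ hη => exists_mem_graph_sqrtFieldEnergy hη
  map_zero := fun ψ => congrArg (fun T : Fock →L[ℂ] Fock => T ψ) fieldTranslation_zero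
  map_add := fun k l ψ => congrArg (fun T : Fock →L[ℂ] Fock => T ψ) (fieldTranslation_add k l)
  norm_map := norm_fieldTranslation
  inner_map := inner_fieldTranslation
  map_mem := fun k _ hη => fieldTranslation_mem_finitePhoton k hη
  map_energy := fun k _ _ h => fieldTranslation_mem_graph_sectorMul k h
  map_potential := fun k j x _ _ h => fieldTranslation_mem_graph_vectorPotential j (hc j) k x h

end Field

open scoped FourierTransform SchwartzMap

/-! ### Plancherel's theorem for vector-valued functions and convolutions -/

section Plancherel

variable {d : ℕ} {H : Type*} [NormedAddCommGroup H] [InnerProductSpace ℂ H] [CompleteSpace H]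

/-- Both sides define the same distribution: in either case the transform can be moved onto the test
function. This is what makes Plancherel available for the Fourier integral of a vector-valued
function. -/
theorem fourier_toLp_ae_eq {F : Rd d → H} (h1 : Integrable F volume) (h2 : MemLp F 2 volume) :
    (𝓕 (h2.toLp F) : L2 d H) =ᵐ[volume] 𝓕 F := by
  have hc : Continuous (𝓕 F) := VectorFourier.fourierIntegral_continuous
    Real.continuous_fourierChar (innerSL ℝ).continuous₂ h1
  have hl : LocallyIntegrable (𝓕 (h2.toLp F) : L2 d H) volume :=
    (Lp.memLp _).locallyIntegrable (by norm_num)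
  refine ae_eq_of_integral_contDiff_smul_eq hl hc.locallyIntegrable fun g hg hgc => ?_
  have hgC : ContDiff ℝ ∞ fun x => (g x : ℂ) := Complex.ofRealCLM.contDiff.comp hg
  have hgCc : HasCompactSupport fun x => (g x : ℂ) := hgc.comp_left Complex.ofReal_zero
  let φ : 𝓢(Rd d, ℂ) := hgCc.toSchwartzMap hgC
  have e1 : ∫ x, φ x • (𝓕 (h2.toLp F) : L2 d H) x = ∫ x, (𝓕 φ) x • (h2.toLp F) x := by
    rw [← Lp.toTemperedDistribution_apply, ← Lp.toTemperedDistribution_apply,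
      ← Lp.fourier_toTemperedDistribution_eq, TemperedDistribution.fourier_apply]
  have e2 : ∫ ξ, (𝓕 (φ : Rd d → ℂ)) ξ • F ξ = ∫ x, φ x • 𝓕 F x := by
    simpa using! VectorFourier.integral_fourierIntegral_smul_eq_flip (L := innerₗ (Rd d))
      Real.continuous_fourierChar continuous_inner φ.integrable h1
  have e3 : ∀ (G : Rd d → H), ∫ x, g x • G x = ∫ x, φ x • G x := fun G =>
    integral_congr_ae (Filter.Eventually.of_forall fun x => (Complex.coe_smul _ _).symm)
  rw [e3, e3, e1, ← e2]
  refine integral_congr_ae ?_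
  filter_upwards [h2.coeFn_toLp] with x hx
  rw [hx, SchwartzMap.fourier_coe]

theorem memLp_fourier {F : Rd d → H} (h1 : Integrable F volume) (h2 : MemLp F 2 volume) :
    MemLp (𝓕 F) 2 volume :=
  (memLp_congr_ae (fourier_toLp_ae_eq h1 h2)).1 (Lp.memLp _)

theorem integral_norm_sq_fourier {F : Rd d → H} (h1 : Integrable F volume)
    (h2 : MemLp F 2 volume) : ∫ y, ‖𝓕 F y‖ ^ 2 = ∫ ξ, ‖F ξ‖ ^ 2 := by
  have e1 : ‖(𝓕 (h2.toLp F) : L2 d H)‖ ^ 2 = ‖h2.toLp F‖ ^ 2 := by rw [Lp.norm_fourier_eq]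
  rw [norm_sq_eq_integral, norm_sq_eq_integral] at e1
  refine (integral_congr_ae ?_).trans (e1.trans (integral_congr_ae ?_))
  · filter_upwards [fourier_toLp_ae_eq h1 h2] with x hx
    rw [hx]
  · filter_upwards [h2.coeFn_toLp] with x hx
    rw [hx]

end Plancherel

/-! ### Correlation integrals -/

section Correlation

variable {d : ℕ} {a b : Rd d → ℝ}

/-- The map `(x, y) ↦ (x, x + y)` preserves Lebesgue measure. -/
theorem integrable_mul_comp_add (ha : Integrable a volume) (hb : Integrable b volume) :
    Integrable (fun p : Rd d × Rd d => a p.1 * b (p.1 + p.2)) (volume.prod volume) :=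
  (measurePreserving_prod_add (volume : Measure (Rd d)) volume).integrable_comp_of_integrable
    (ha.mul_prod hb)

theorem integrable_correlation (ha : Integrable a volume) (hb : Integrable b volume) :
    Integrable (fun y => ∫ x, a x * b (x + y)) volume :=
  (integrable_mul_comp_add ha hb).integral_prod_right

theorem integral_correlation (ha : Integrable a volume) (hb : Integrable b volume) :
    ∫ y, ∫ x, a x * b (x + y) = (∫ x, a x) * ∫ x, b x := by
  rw [← integral_integral_swap (integrable_mul_comp_add ha hb)]
  simp only [integral_const_mul]
  have h : ∀ x : Rd d, ∫ y, b (x + y) = ∫ y, b y := fun x => integral_add_left_eq_self b x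
  simp only [h, integral_mul_const]

end Correlation

/-! ### The domain `C₀^∞(ℝ³)` and the hypothesis (H.4) -/

/-! ### Linear growth of the relativistic kinetic energy -/

section Kinetic

variable {m : ℝ}

theorem relKinetic_nonneg (k : Rd 3) : 0 ≤ relKinetic m k := by
  rw [relKinetic, sub_nonneg]
  exact Real.le_sqrt_of_sq_le (by nlinarith [sq_nonneg ‖k‖])

theorem relKinetic_le (hm : 0 < m) (k : Rd 3) : relKinetic m k ≤ ‖k‖ := by
  rw [relKinetic, sub_le_iff_le_add]
  refine Real.sqrt_le_iff.2 ⟨by positivity, ?_⟩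
  nlinarith [mul_nonneg (norm_nonneg k) hm.le]

theorem relKinetic_two_pi_smul_le (hm : 0 < m) (ξ : Rd 3) :
    relKinetic m ((2 * Real.pi) • ξ) ≤ 2 * Real.pi * ‖ξ‖ := by
  refine (relKinetic_le hm _).trans_eq ?_
  rw [norm_smul, Real.norm_of_nonneg (by positivity)]

theorem integrable_norm_sq_schwartz (φ : 𝓢(Rd 3, ℂ)) :
    Integrable (fun ξ => ‖φ ξ‖ ^ 2) volume :=
  (memLp_two_iff_integrable_sq_norm φ.continuous.aestronglyMeasurable).1 (φ.memLp 2 volume)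

theorem integrable_relKinetic_mul_norm (hm : 0 < m) (φ : 𝓢(Rd 3, ℂ)) :
    Integrable (fun ξ => relKinetic m ((2 * Real.pi) • ξ) * ‖φ ξ‖) volume := by
  refine ((φ.integrable_pow_mul volume 1).const_mul (2 * Real.pi)).mono' ?_
    (Filter.Eventually.of_forall fun ξ => ?_)
  · exact ((measurable_relKinetic m).comp (measurable_const_smul _)).aestronglyMeasurable.mul
      φ.continuous.norm.aestronglyMeasurable
  · rw [Real.norm_of_nonneg (mul_nonneg (relKinetic_nonneg _) (norm_nonneg _)), pow_one,
      ← mul_assoc]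
    exact mul_le_mul_of_nonneg_right (relKinetic_two_pi_smul_le hm ξ) (norm_nonneg _)

theorem integrable_relKinetic_mul_norm_sq (hm : 0 < m) (φ : 𝓢(Rd 3, ℂ)) :
    Integrable (fun ξ => relKinetic m ((2 * Real.pi) • ξ) * ‖φ ξ‖ ^ 2) volume := by
  obtain ⟨C, hC⟩ := φ.toBoundedContinuousFunction.bddAbove_range_norm_comp
  have hC' : ∀ ξ, ‖φ ξ‖ ≤ C := fun ξ => hC ⟨ξ, rfl⟩
  have h := (integrable_relKinetic_mul_norm hm φ).mul_bdd (c := C)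
    φ.continuous.norm.aestronglyMeasurable (Filter.Eventually.of_forall fun ξ => by
      rw [norm_norm]; exact hC' ξ)
  refine h.congr (Filter.Eventually.of_forall fun ξ => ?_)
  show _ * ‖φ ξ‖ * ‖φ ξ‖ = _
  ring

end Kinetic

theorem mem_D1_iff {f : L2 3 ℂ} : f ∈ D1 ↔ ∃ g, IsTest g ∧ f =ᵐ[volume] g := by
  refine ⟨fun hf => ?_, fun hf => Submodule.subset_span hf⟩
  induction hf using Submodule.span_induction with
  | mem f hf => exact hf
  | zero =>
    exact ⟨0, ⟨contDiff_const, HasCompactSupport.zero⟩, Lp.coeFn_zero _ _ _⟩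
  | add f f' _ _ h h' =>
    obtain ⟨g, hg, h1⟩ := h
    obtain ⟨g', hg', h2⟩ := h'
    exact ⟨g + g', ⟨hg.1.add hg'.1, hg.2.add hg'.2⟩, (Lp.coeFn_add f f').trans (h1.add h2)⟩
  | smul c f _ h =>
    obtain ⟨g, hg, h1⟩ := h
    exact ⟨c • g, ⟨hg.1.const_smul c, hg.2.smul_left (f := fun _ => c)⟩,
      (Lp.coeFn_smul c f).trans (h1.const_smul c)⟩

/-- A test function as a Schwartz function. -/
def IsTest.schwartz {g : Rd 3 → ℂ} (hg : IsTest g) : 𝓢(Rd 3, ℂ) := hg.2.toSchwartzMap hg.1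

theorem IsTest.schwartz_apply {g : Rd 3 → ℂ} (hg : IsTest g) (x : Rd 3) : hg.schwartz x = g x :=
  rfl

theorem fourierTransform_ae_eq {f : L2 3 ℂ} {g : Rd 3 → ℂ} (hg : IsTest g)
    (hf : f =ᵐ[volume] g) :
    Lp.fourierTransformₗᵢ (Rd 3) ℂ f =ᵐ[volume] (𝓕 hg.schwartz : 𝓢(Rd 3, ℂ)) := by
  have h1 : f = hg.schwartz.toLp 2 := Lp.ext (hf.trans (hg.schwartz.coeFn_toLp 2 volume).symm)
  have h2 : Lp.fourierTransformₗᵢ (Rd 3) ℂ f = (𝓕 hg.schwartz).toLp 2 := by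
    rw [h1]
    exact SchwartzMap.toLp_fourier_eq _
  rw [h2]
  exact SchwartzMap.coeFn_toLp _ 2 volume

theorem exists_testVec_ne_zero {𝒦 : Type*} [NormedAddCommGroup 𝒦] [InnerProductSpace ℂ 𝒦] {η : 𝒦}
    (hη : η ≠ 0) : ∃ (g : Rd 3 → ℂ) (hg : IsTest g), testVec hg η ≠ 0 := by
  let b : ContDiffBump (0 : Rd 3) := ⟨1, 2, one_pos, one_lt_two⟩
  have hb : IsTest fun x => (b x : ℂ) :=
    ⟨Complex.ofRealCLM.contDiff.comp b.contDiff, b.hasCompactSupport.comp_left Complex.ofReal_zero⟩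
  refine ⟨_, hb, fun h => ?_⟩
  have h1 : (fun x => (b x : ℂ) • η) =ᵐ[volume] fun _ => (0 : 𝒦) := by
    refine (coeFn_testVec hb η).symm.trans ?_
    rw [h]
    exact Lp.coeFn_zero _ _ _
  have h2 : (b 0 : ℂ) • η = 0 := congrFun ((Continuous.ae_eq_iff_eq volume
    (hb.1.continuous.smul continuous_const)
    continuous_const).1 h1) 0
  have h3 : b 0 = 1 := b.one_of_mem_closedBall (Metric.mem_closedBall_self zero_le_one)
  rw [h3, Complex.ofReal_one, one_smul] at h2
  exact hη h2

theorem mulForm_quad {𝒦 : Type*} [NormedAddCommGroup 𝒦] [InnerProductSpace ℂ 𝒦] {V : Rd 3 → ℝ}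
    (hV : Measurable V) (Ψ : L2 3 𝒦) : (mulForm 𝒦 V hV).quad Ψ = ∫ x, V x * ‖Ψ x‖ ^ 2 := by
  have h : ∀ x, (V x : ℂ) * ⟪Ψ x, Ψ x⟫_ℂ = ((V x * ‖Ψ x‖ ^ 2 : ℝ) : ℂ) := fun x => by
    rw [inner_self_eq_norm_sq_to_K]
    push_cast
    rfl
  show (∫ x, (V x : ℂ) * ⟪Ψ x, Ψ x⟫_ℂ).re = _
  simp only [h]
  rw [integral_complex_ofReal, Complex.ofReal_re]

theorem hypH4 {𝒦 : Type*} [NormedAddCommGroup 𝒦] [InnerProductSpace ℂ 𝒦] (S : Submodule ℂ 𝒦)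
    {m : ℝ} (hm : 0 < m) {V : Rd 3 → ℝ} (hV : Measurable V) (hVloc : LocallyIntegrable V volume) :
    HypH4 (tensorDomain S) (relKinetic m) (measurable_relKinetic m) V hV D1 where
  nontrivial h := by
    obtain ⟨g, hg, hne⟩ := exists_testVec_ne_zero (one_ne_zero (α := ℂ))
    have h1 : testVec hg (1 : ℂ) ∈ D1 := mem_D1_iff.2 ⟨g, hg, (coeFn_testVec hg 1).trans
      (Filter.Eventually.of_forall fun x => mul_one _)⟩
    rw [h] at h1
    exact hne ((Submodule.mem_bot ℂ).1 h1)
  le_dom f hf := by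
    obtain ⟨g, hg, hfg⟩ := mem_D1_iff.1 hf
    refine ⟨?_, mem_mulFormDomain_of_test hV hVloc hg (η := (1 : ℂ))
      (hfg.trans (Filter.Eventually.of_forall fun x => (mul_one _).symm))⟩
    have h1 := fourierTransform_ae_eq hg hfg
    show MemLp (fun ξ => ((√|relKinetic m ((2 * Real.pi) • ξ)| : ℝ) : ℂ) •
      (Lp.fourierTransformₗᵢ (Rd 3) ℂ f) ξ) 2 volume
    have hmeas : AEStronglyMeasurable (fun ξ => ((√|relKinetic m ((2 * Real.pi) • ξ)| : ℝ) : ℂ) •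
      (Lp.fourierTransformₗᵢ (Rd 3) ℂ f) ξ) volume :=
      (Complex.measurable_ofReal.comp ((measurable_relKinetic m).comp
        (measurable_const_smul _)).norm.sqrt).aestronglyMeasurable.smul (Lp.aestronglyMeasurable _)
    rw [memLp_two_iff_integrable_sq_norm hmeas]
    refine (integrable_relKinetic_mul_norm_sq hm (𝓕 hg.schwartz)).congr ?_
    filter_upwards [h1] with ξ hξ
    rw [hξ, norm_smul, mul_pow, Complex.norm_real, Real.norm_of_nonneg (Real.sqrt_nonneg _),
      Real.sq_sqrt (abs_nonneg _), abs_of_nonneg (relKinetic_nonneg _)]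
  mul_mem f hf Ψ hΨ := by
    obtain ⟨g, hg, hfg⟩ := mem_D1_iff.1 hf
    refine ⟨mulOp volume 𝒦 hg.isMultiplier Ψ,
      mulOp_mem_tensorDomain _ (fun f hf => hg.mul hf) hΨ, ?_⟩
    filter_upwards [coeFn_mulOp hg.isMultiplier Ψ, hfg] with x h1 h2
    rw [h1, h2]
  star_mem f hf := by
    obtain ⟨g, hg, hfg⟩ := mem_D1_iff.1 hf
    refine mem_D1_iff.2 ⟨_, hg.conj, ?_⟩
    filter_upwards [Lp.coeFn_star f, hfg] with x h1 h2
    rw [h1, Pi.star_apply, h2]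
    rfl

theorem particleForm_quad {f : L2 3 ℂ} {g : Rd 3 → ℂ} (hg : IsTest g) (hf : f =ᵐ[volume] g) {m : ℝ}
    {V : Rd 3 → ℝ} (hV : Measurable V) :
    (particleForm (relKinetic m) (measurable_relKinetic m) V hV).quad f =
      (∫ ξ, relKinetic m ((2 * Real.pi) • ξ) * ‖(𝓕 hg.schwartz : 𝓢(Rd 3, ℂ)) ξ‖ ^ 2) +
        ∫ x, V x * ‖g x‖ ^ 2 := by
  have h1 : (momentumForm (relKinetic m) (measurable_relKinetic m)).quad f =
      (mulForm ℂ (fun ξ => relKinetic m ((2 * Real.pi) • ξ)) ((measurable_relKinetic m).comp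
        (measurable_const_smul _))).quad (Lp.fourierTransformₗᵢ (Rd 3) ℂ f) := rfl
  rw [particleForm, add_quad, h1, mulForm_quad, mulForm_quad]
  congr 1
  · refine integral_congr_ae ?_
    filter_upwards [fourierTransform_ae_eq hg hf] with ξ hξ
    rw [hξ]
  · refine integral_congr_ae ?_
    filter_upwards [hf] with x hx
    rw [hx]

/-! ### Superpositions of plane waves -/

section Superposition

variable {d : ℕ} {𝒦 : Type*} [NormedAddCommGroup 𝒦] [InnerProductSpace ℂ 𝒦]

theorem fourier_inversion (φ : 𝓢(Rd d, ℂ)) (x : Rd d) :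
    ∫ ξ, planeWave ((2 * Real.pi) • ξ) x * (𝓕 φ) ξ = φ x := by
  have h1 : (𝓕⁻ (𝓕 φ)) x = φ x := by rw [FourierTransform.fourierInv_fourier_eq]
  rw [SchwartzMap.fourierInv_coe, Real.fourierInv_eq'] at h1
  rw [← h1]
  refine integral_congr_ae (Filter.Eventually.of_forall fun ξ => ?_)
  show planeWave _ _ * _ = _ • _
  rw [planeWave, inner_smul_left, smul_eq_mul]
  rfl

/-- Fubini, followed by Fourier inversion at the point `x - y`. -/
theorem integral_planeWave_mul (φ : 𝓢(Rd d, ℂ)) (y : Rd d) {u : Rd d → ℂ}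
    (hu : Integrable u volume) :
    ∫ ξ, (𝓕 φ) ξ * ∫ x, planeWave ((2 * Real.pi) • ξ) (x - y) * u x = ∫ x, φ (x - y) * u x := by
  have hc : Continuous fun p : Rd d × Rd d => planeWave ((2 * Real.pi) • p.1) (p.2 - y) := by
    unfold planeWave
    fun_prop
  have hi : Integrable (fun p : Rd d × Rd d =>
      planeWave ((2 * Real.pi) • p.1) (p.2 - y) * ((𝓕 φ) p.1 * u p.2)) (volume.prod volume) :=
    ((𝓕 φ).integrable.mul_prod hu).bdd_mul (c := 1) hc.aestronglyMeasurable
      (Filter.Eventually.of_forall fun p => (norm_planeWave _ _).le)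
  have e1 : ∀ ξ, (𝓕 φ) ξ * ∫ x, planeWave ((2 * Real.pi) • ξ) (x - y) * u x =
      ∫ x, planeWave ((2 * Real.pi) • ξ) (x - y) * ((𝓕 φ) ξ * u x) := fun ξ => by
    rw [← integral_const_mul]
    exact integral_congr_ae (Filter.Eventually.of_forall fun x => by ring)
  simp only [e1]
  rw [integral_integral_swap hi]
  refine integral_congr_ae (Filter.Eventually.of_forall fun x => ?_)
  show ∫ ξ, planeWave ((2 * Real.pi) • ξ) (x - y) * ((𝓕 φ) ξ * u x) = φ (x - y) * u x
  rw [← fourier_inversion φ (x - y), ← integral_mul_const]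
  exact integral_congr_ae (Filter.Eventually.of_forall fun ξ => by ring)

theorem planeWave_sub (k x y : Rd d) :
    planeWave k (x - y) = Complex.exp (((-inner ℝ k y : ℝ) : ℂ) * Complex.I) * planeWave k x := by
  rw [planeWave, planeWave, ← Complex.exp_add, inner_sub_right]
  congr 1
  push_cast
  ring

theorem integrable_inner_coeFn (Φ Ψ : L2 d 𝒦) : Integrable (fun x => ⟪Φ x, Ψ x⟫_ℂ) volume :=
  L2.integrable_inner Φ Ψ

theorem integrable_smul_modOp (φ : 𝓢(Rd d, ℂ)) (Ψ : L2 d 𝒦) :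
    Integrable (fun ξ => φ ξ • modOp ((2 * Real.pi) • ξ) Ψ) volume := by
  have hc : Continuous fun ξ : Rd d => modOp ((2 * Real.pi) • ξ) Ψ :=
    (continuous_modOp Ψ).comp (continuous_const_smul _)
  refine (φ.integrable.norm.mul_const ‖Ψ‖).mono'
    (φ.continuous.smul hc).aestronglyMeasurable (Filter.Eventually.of_forall fun ξ => ?_)
  rw [norm_smul, norm_modOp]

/-- Fourier inversion `φ(x - y) = ∫ φ̂(ξ) e^{2πiξ·(x - y)} dξ`, read as an identity of
multiplication operators applied to `Ψ` and checked weakly. The dependence on `y` is that of a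
Fourier transform, which prepares Plancherel in `y`. -/
theorem fourier_smul_modOp [CompleteSpace 𝒦] (φ : 𝓢(Rd d, ℂ)) (Ψ : L2 d 𝒦) (y : Rd d)
    {θ : Rd d → ℂ} (hθ : IsMultiplier θ) (h : ∀ x, θ x = φ (x - y)) :
    𝓕 (fun ξ => (𝓕 φ) ξ • modOp ((2 * Real.pi) • ξ) Ψ) y = mulOp volume 𝒦 hθ Ψ := by
  have hint := (Real.fourierIntegral_convergent_iff y).2 (integrable_smul_modOp (𝓕 φ) Ψ)
  refine ext_inner_left ℂ fun Φ => ?_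
  rw [Real.fourier_eq]
  refine (integral_inner (𝕜 := ℂ) hint Φ).symm.trans ?_
  rw [L2.inner_def]
  have e1 : ∀ ξ, ⟪Φ, Real.fourierChar (-inner ℝ ξ y) • (𝓕 φ) ξ • modOp ((2 * Real.pi) • ξ) Ψ⟫_ℂ =
      (𝓕 φ) ξ * ∫ x, planeWave ((2 * Real.pi) • ξ) (x - y) * ⟪Φ x, Ψ x⟫_ℂ := fun ξ => by
    rw [Circle.smul_def, inner_smul_right, inner_smul_right, L2.inner_def, Real.fourierChar_apply]
    have e2 : ∫ x, ⟪Φ x, modOp ((2 * Real.pi) • ξ) Ψ x⟫_ℂ =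
        ∫ x, planeWave ((2 * Real.pi) • ξ) x * ⟪Φ x, Ψ x⟫_ℂ := by
      refine integral_congr_ae ?_
      filter_upwards [coeFn_modOp ((2 * Real.pi) • ξ) Ψ] with x hx
      rw [hx, inner_smul_right]
    rw [e2, mul_left_comm, ← integral_const_mul]
    congr 1
    refine integral_congr_ae (Filter.Eventually.of_forall fun x => ?_)
    show _ * (_ * _) = _ * _
    rw [planeWave_sub, ← mul_assoc]
    congr 3
    rw [real_inner_smul_left]
    push_cast
    ring_nf
  simp only [e1]
  rw [integral_planeWave_mul φ y (integrable_inner_coeFn Φ Ψ)]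
  refine integral_congr_ae ?_
  filter_upwards [coeFn_mulOp hθ Ψ] with x hx
  rw [hx, inner_smul_right, h]

end Superposition

/-! ### The kinetic energy of the trial states -/

theorem continuous_shear {H X : Type*} [NormedAddCommGroup H] [InnerProductSpace ℂ H]
    [TopologicalSpace X] {M : X → H →L[ℂ] H} (hM : ∀ x, Continuous fun t => M t x)
    {c : X → Fin 3 → ℝ} (hc : ∀ j, Continuous fun t => c t j)
    (g : WithLp 2 (H × PiLp 2 fun _ : Fin 3 => H)) : Continuous fun t => shear (M t) (c t) g := by
  have e1 : ∀ t, shear (M t) (c t) g = WithLp.toLp 2 (M t g.fst,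
      WithLp.toLp 2 fun j => M t (g.snd j) + (c t j : ℂ) • M t g.fst) := fun t =>
    WithLp.ofLp_injective 2 (Prod.ext (shear_fst _ _ g) (PiLp.ext fun j => shear_snd _ _ g j))
  simp only [e1]
  refine (WithLp.prod_continuous_toLp 2 H (PiLp 2 fun _ : Fin 3 => H)).comp
    (Continuous.prodMk (hM g.fst) ((PiLp.continuous_toLp 2 _).comp (continuous_pi fun j => ?_)))
  exact (hM (g.snd j)).add ((Complex.continuous_ofReal.comp (hc j)).smul (hM g.fst))

/-- Although `R^{-1/4}` is unbounded, on `M t x` it equals the bounded operator `R^{1/4} Θ*`, with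
`Θ = formIso m G`, applied to the sheared graph vector, which is continuous in `t`. -/
theorem continuous_fourthRootInv_shear {H X : Type*} [NormedAddCommGroup H] [InnerProductSpace ℂ H]
    [CompleteSpace H] [TopologicalSpace X]
    {G : Submodule ℂ (WithLp 2 (H × PiLp 2 fun _ : Fin 3 => H))} {m : ℝ}
    (hm : 0 < m) (hG : Dense ((G.map (WithLp.fstL 2 ℂ H (PiLp 2 fun _ : Fin 3 => H)).toLinearMap :
      Submodule ℂ H) : Set H)) {M : X → H →L[ℂ] H} (hM : ∀ x, Continuous fun t => M t x)
    {c : X → Fin 3 → ℝ} (hc : ∀ j, Continuous fun t => c t j)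
    (hN : ∀ t, ∀ g ∈ G, shear (M t) (c t) g ∈ G)
    {g : WithLp 2 (H × PiLp 2 fun _ : Fin 3 => H)} (hg : g ∈ G) {x : H}
    (hx : (m : ℂ)⁻¹ • g.fst = x) :
    Continuous fun t => extendZero (fourthRootInv (massResolvent m G)) (M t x) := by
  have e1 : ∀ t, extendZero (fourthRootInv (massResolvent m G)) (M t x) =
      opSqrt (opSqrt (massResolvent m G)) ((formIso m G).adjoint (shear (M t) (c t) g)) :=
    fun t => by
      have h1 := mem_graph_fourthRootInv_of_mem_closure hm hG
        (Submodule.le_topologicalClosure _ (hN t g hg))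
      rw [shear_fst, ← map_smul, hx] at h1
      exact extendZero_eq h1
  simp only [e1]
  exact (ContinuousLinearMap.continuous _).comp ((ContinuousLinearMap.continuous _).comp
    (continuous_shear hM hc g))

theorem map_fourier {d : ℕ} {H : Type*} [NormedAddCommGroup H] [InnerProductSpace ℂ H]
    [CompleteSpace H] (W : H →L[ℂ] H) {F : Rd d → H} (hF : Integrable F volume) (y : Rd d) :
    W (𝓕 F y) = 𝓕 (fun ξ => W (F ξ)) y := by
  rw [Real.fourier_eq, Real.fourier_eq,
    ← W.integral_comp_comm ((Real.fourierIntegral_convergent_iff y).2 hF)]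
  refine integral_congr_ae (Filter.Eventually.of_forall fun ξ => ?_)
  simp only [Circle.smul_def, map_smul]

/-! ### Integrability of Schwartz functions against fields of controlled growth -/

section Growth

variable {H : Type*} [NormedAddCommGroup H] [InnerProductSpace ℂ H] {β : Rd 3 → H} {m a b : ℝ}

theorem memLp_schwartz_smul (hm : 0 < m) (hβ : Continuous β)
    (hle : ∀ k, ‖β k‖ ^ 2 ≤ a + b * relKinetic m k) (φ : 𝓢(Rd 3, ℂ)) :
    MemLp (fun ξ => φ ξ • β ((2 * Real.pi) • ξ)) 2 volume := by
  have hc : Continuous fun ξ => φ ξ • β ((2 * Real.pi) • ξ) :=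
    φ.continuous.smul (hβ.comp (continuous_const_smul _))
  rw [memLp_two_iff_integrable_sq_norm hc.aestronglyMeasurable]
  refine (((integrable_norm_sq_schwartz φ).const_mul a).add
    ((integrable_relKinetic_mul_norm_sq hm φ).const_mul b)).mono'
      (hc.norm.pow 2).aestronglyMeasurable (Filter.Eventually.of_forall fun ξ => ?_)
  rw [Real.norm_of_nonneg (sq_nonneg _), norm_smul, mul_pow, Pi.add_apply]
  nlinarith [mul_le_mul_of_nonneg_left (hle ((2 * Real.pi) • ξ)) (sq_nonneg ‖φ ξ‖)]

theorem integrable_schwartz_smul (hm : 0 < m) (hβ : Continuous β)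
    (hle : ∀ k, ‖β k‖ ^ 2 ≤ a + b * relKinetic m k) (φ : 𝓢(Rd 3, ℂ)) :
    Integrable (fun ξ => φ ξ • β ((2 * Real.pi) • ξ)) volume := by
  have hc : Continuous fun ξ => φ ξ • β ((2 * Real.pi) • ξ) :=
    φ.continuous.smul (hβ.comp (continuous_const_smul _))
  refine ((φ.integrable.norm.const_mul (1 + a)).add
    ((integrable_relKinetic_mul_norm hm φ).const_mul b)).mono'
      hc.aestronglyMeasurable (Filter.Eventually.of_forall fun ξ => ?_)
  rw [norm_smul, Pi.add_apply]
  -- From `t ≤ 1 + t²`, so that the bound on the square controls the norm itself.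
  have h1 : ‖β ((2 * Real.pi) • ξ)‖ ≤ 1 + (a + b * relKinetic m ((2 * Real.pi) • ξ)) := by
    nlinarith [hle ((2 * Real.pi) • ξ), sq_nonneg (‖β ((2 * Real.pi) • ξ)‖ - 1 / 2)]
  nlinarith [mul_le_mul_of_nonneg_left h1 (norm_nonneg (φ ξ))]

end Growth

section Kinetic

variable {𝒦 : Type*} [NormedAddCommGroup 𝒦] [InnerProductSpace ℂ 𝒦] [CompleteSpace 𝒦]
  {S : Submodule ℂ 𝒦} {A : Fin 3 → Rd 3 → 𝒦 →ₗ.[ℂ] 𝒦} {B : 𝒦 →ₗ.[ℂ] 𝒦} {U : Rd 3 → 𝒦 →L[ℂ] 𝒦}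
  {α m : ℝ}

namespace IsCovariantField

variable (h : IsCovariantField S A B U) (hm : 0 < m)

include h hm

theorem continuous_fourthRootInv_modOp {Ψ : L2 3 𝒦} (hΨ : Ψ ∈ tensorDomain S) :
    Continuous fun k => extendZero (fourthRootInv (gaugeResolvent α m A S)) (modOp k Ψ) := by
  obtain ⟨g, hg, hx⟩ := h.exists_gaugeGraph (α := α) hm hΨ
  exact continuous_fourthRootInv_shear (H := L2 3 𝒦) hm (h.dense_fst hm) continuous_modOp
    (c := fun k j => k j / m) (fun j => by fun_prop) (fun k _ hg => shear_mem_gaugeGraph hm.ne' k hg)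
    hg hx

/-- The kinetic inequality with the non-negative term at `-k` dropped. It provides the growth bound
that makes the Fourier integrals over `k` converge. -/
theorem norm_sq_fourthRootInv_modOp_le (k : Rd 3) {Ψ : L2 3 𝒦} (hΨ : Ψ ∈ tensorDomain S) :
    ‖extendZero (fourthRootInv (gaugeResolvent α m A S)) (modOp k Ψ)‖ ^ 2 ≤
      2 * ‖extendZero (fourthRootInv (gaugeResolvent α m A S)) Ψ‖ ^ 2 +
        2 * ‖Ψ‖ ^ 2 * relKinetic m k := by
  have h1 := h.fourthRootInv_modOp_le (α := α) hm k hΨ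
  have h2 := sq_nonneg ‖extendZero (fourthRootInv (gaugeResolvent α m A S)) (modOp (-k) Ψ)‖
  linarith

/-- The bounded operator `R^{1/4}` passes under the integral and undoes `R^{-1/4}`. What remains is
the superposition of plane waves that reproduces multiplication by `φ(· - y)`. -/
theorem mem_graph_fourthRootInv_mulOp (φ : 𝓢(Rd 3, ℂ)) {Ψ : L2 3 𝒦} (hΨ : Ψ ∈ tensorDomain S)
    (y : Rd 3) {θ : Rd 3 → ℂ} (hθ : IsMultiplier θ) (hφ : ∀ x, θ x = φ (x - y)) :
    (mulOp volume 𝒦 hθ Ψ, 𝓕 (fun ξ => (𝓕 φ) ξ •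
      extendZero (fourthRootInv (gaugeResolvent α m A S)) (modOp ((2 * Real.pi) • ξ) Ψ)) y) ∈
        (fourthRootInv (gaugeResolvent α m A S)).graph := by
  have hR := gaugeResolvent_nonneg (α := α) (m := m) (A := A) (S := S)
  have hi := h.gaugeResolvent_injective (α := α) hm
  rw [mem_graph_fourthRootInv hR hi, map_fourier]
  · rw [← fourier_smul_modOp φ Ψ y hθ hφ]
    refine congrArg (fun F : Rd 3 → L2 3 𝒦 => 𝓕 F y) (funext fun ξ => ?_)
    rw [map_smul]
    exact congrArg _ ((mem_graph_fourthRootInv hR hi _ _).1 (mem_graph_extendZero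
      (h.le_fourthRootInv_domain hm (modOp_mem_tensorDomain _ hΨ))))
  · exact integrable_schwartz_smul hm (h.continuous_fourthRootInv_modOp hm hΨ)
      (fun k => h.norm_sq_fourthRootInv_modOp_le hm k hΨ) _

/-- Multiplying by `f` after `e^{iy·P}` is `e^{iy·P}` after multiplying by `f(· - y)`, and the
isometry `e^{iy·P}` commutes with `R^{-1/4}`. -/
theorem norm_fourthRootInv_mulOp_transOp {f : Rd 3 → ℂ} (hf : IsTest f) {Ψ : L2 3 𝒦}
    (hΨ : Ψ ∈ tensorDomain S) (y : Rd 3) :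
    ‖extendZero (fourthRootInv (gaugeResolvent α m A S))
      (mulOp volume 𝒦 hf.isMultiplier (transOp U y Ψ))‖ =
      ‖𝓕 (fun ξ => (𝓕 hf.schwartz : 𝓢(Rd 3, ℂ)) ξ •
        extendZero (fourthRootInv (gaugeResolvent α m A S)) (modOp ((2 * Real.pi) • ξ) Ψ)) y‖ := by
  have hfy : IsTest fun x => f (x - y) := by simpa only [sub_eq_add_neg] using hf.comp_add (-y)
  have h1 : mulOp volume 𝒦 hf.isMultiplier (transOp U y Ψ) =
      transOp U y (mulOp volume 𝒦 hfy.isMultiplier Ψ) := by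
    refine Lp.ext ?_
    filter_upwards [coeFn_mulOp hf.isMultiplier (transOp U y Ψ), coeFn_transOp U y Ψ,
      coeFn_transOp U y (mulOp volume 𝒦 hfy.isMultiplier Ψ),
      (measurePreserving_add_right volume y).quasiMeasurePreserving.ae
        (coeFn_mulOp hfy.isMultiplier Ψ)] with x e1 e2 e3 e4
    rw [e1, e2, e3, e4, add_sub_cancel_right, map_smul]
  have h2 := h.mem_graph_fourthRootInv_mulOp (α := α) hm hf.schwartz hΨ y hfy.isMultiplier
    fun x => rfl
  have h3 := (extendZero_fourthRootInv_of_commute gaugeResolvent_nonneg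
    (h.gaugeResolvent_injective (α := α) hm) (h.commute_gaugeResolvent y)
    (LinearPMap.mem_domain_of_mem_graph h2)).2
  rw [h1, h3, norm_transOp h.norm_map, extendZero_eq h2]

theorem integrable_fourthRootInv_mulOp_transOp {f : Rd 3 → ℂ} (hf : IsTest f) {Ψ : L2 3 𝒦}
    (hΨ : Ψ ∈ tensorDomain S) :
    Integrable (fun y => ‖extendZero (fourthRootInv (gaugeResolvent α m A S))
      (mulOp volume 𝒦 hf.isMultiplier (transOp U y Ψ))‖ ^ 2) volume ∧
    Integrable (fun ξ => ‖(𝓕 hf.schwartz : 𝓢(Rd 3, ℂ)) ξ‖ ^ 2 * ‖extendZero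
      (fourthRootInv (gaugeResolvent α m A S)) (modOp ((2 * Real.pi) • ξ) Ψ)‖ ^ 2) volume ∧
    ∫ y, ‖extendZero (fourthRootInv (gaugeResolvent α m A S))
      (mulOp volume 𝒦 hf.isMultiplier (transOp U y Ψ))‖ ^ 2 =
      ∫ ξ, ‖(𝓕 hf.schwartz : 𝓢(Rd 3, ℂ)) ξ‖ ^ 2 * ‖extendZero
        (fourthRootInv (gaugeResolvent α m A S)) (modOp ((2 * Real.pi) • ξ) Ψ)‖ ^ 2 := by
  have hc := h.continuous_fourthRootInv_modOp (α := α) hm hΨ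
  have hle := fun k => h.norm_sq_fourthRootInv_modOp_le (α := α) hm k hΨ
  have h1 := integrable_schwartz_smul hm hc hle (𝓕 hf.schwartz)
  have h2 := memLp_schwartz_smul hm hc hle (𝓕 hf.schwartz)
  simp only [h.norm_fourthRootInv_mulOp_transOp hm hf hΨ, ← mul_pow, ← norm_smul]
  exact ⟨(memLp_two_iff_integrable_sq_norm (memLp_fourier h1 h2).1).1 (memLp_fourier h1 h2),
    (memLp_two_iff_integrable_sq_norm h2.1).1 h2, integral_norm_sq_fourier h1 h2⟩

end IsCovariantField

end Kinetic

/-! ### Ground state energies -/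

section GroundEnergy

variable {H : Type*} [NormedAddCommGroup H] [InnerProductSpace ℂ H] {q : QForm H}
  {D : Submodule ℂ H}

theorem quad_smul {x : H} (hx : x ∈ q.dom) (c : ℂ) : q.quad (c • x) = ‖c‖ ^ 2 * q.quad x := by
  have hc := q.dom.smul_mem c hx
  have h1 : q.val (c • x) (c • x) = c * (starRingEnd ℂ c * q.val x x) := by
    rw [q.smul_right _ hc _ hx, ← q.conj_symm _ hc _ hx, q.smul_right _ hx _ hx, map_mul,
      q.conj_symm _ hx _ hx]
  rw [QForm.quad, h1, ← mul_assoc, Complex.mul_conj, Complex.re_ofReal_mul, Complex.normSq_eq_norm_sq,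
    QForm.quad]

theorem le_quad_of_le_groundEnergy (hD : D ≤ q.dom) {E : ℝ} (hE : (E : EReal) ≤ groundEnergy q D)
    {x : H} (hx : x ∈ D) : E * ‖x‖ ^ 2 ≤ q.quad x := by
  rcases eq_or_ne x 0 with rfl | h0
  · have h1 := quad_smul (hD hx) 0
    rw [zero_smul, norm_zero] at h1
    rw [h1, norm_zero]
    simp
  · have hn : (‖x‖ : ℝ) ≠ 0 := norm_ne_zero_iff.2 h0
    have h1 : (E : EReal) ≤ q.quad ((‖x‖⁻¹ : ℂ) • x) :=
      hE.trans (iInf_le (fun Ψ : {Ψ : H // Ψ ∈ D ∧ ‖Ψ‖ = 1} => (q.quad Ψ.1 : EReal))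
        ⟨_, D.smul_mem _ hx, by simp [norm_smul, hn]⟩)
    rw [EReal.coe_le_coe_iff, quad_smul (hD hx), norm_inv, Complex.norm_real, norm_norm] at h1
    have h2 := mul_le_mul_of_nonneg_right h1 (sq_nonneg ‖x‖)
    refine h2.trans_eq ?_
    field_simp

theorem le_groundEnergy {E : ℝ} (h : ∀ x ∈ D, ‖x‖ = 1 → E ≤ q.quad x) :
    (E : EReal) ≤ groundEnergy q D :=
  le_iInf fun Ψ => EReal.coe_le_coe_iff.2 (h _ Ψ.2.1 Ψ.2.2)

/-- Applied to `E⁰`: its finiteness excludes indeterminate sums and differences in the extended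
reals. -/
theorem exists_coe_eq_groundEnergy (hb : q.BoundedBelowOn D) (hD : D ≠ ⊥) :
    ∃ r : ℝ, groundEnergy q D = r := by
  obtain ⟨c, hc⟩ := hb
  have h1 : (c : EReal) ≤ groundEnergy q D :=
    le_groundEnergy fun x hx hx1 => by simpa [hx1] using hc x hx
  obtain ⟨x, hx, h0⟩ := D.exists_mem_ne_zero_of_ne_bot hD
  have hn : (‖x‖ : ℝ) ≠ 0 := norm_ne_zero_iff.2 h0
  have h2 : groundEnergy q D ≤ q.quad ((‖x‖⁻¹ : ℂ) • x) :=
    iInf_le (fun Ψ : {Ψ : H // Ψ ∈ D ∧ ‖Ψ‖ = 1} => (q.quad Ψ.1 : EReal))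
      ⟨_, D.smul_mem _ hx, by simp [norm_smul, hn]⟩
  exact ⟨_, (EReal.coe_toReal (h2.trans_lt (EReal.coe_lt_top _)).ne
    ((EReal.bot_lt_coe c).trans_le h1).ne').symm⟩

theorem groundEnergy_le_add {H₁ : Type*} [NormedAddCommGroup H₁] [InnerProductSpace ℂ H₁]
    {qV : QForm H} {q₁ : QForm H₁} {D₁ : Submodule ℂ H₁} (hb : q.BoundedBelowOn D) (hD : D ≠ ⊥)
    (h : ∀ E : ℝ, (E : EReal) ≤ groundEnergy qV D → ∀ x ∈ D, ‖x‖ = 1 → ∀ f ∈ D₁, ‖f‖ = 1 →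
      E ≤ q.quad x + q₁.quad f) :
    groundEnergy qV D ≤ groundEnergy q D + groundEnergy q₁ D₁ := by
  obtain ⟨r, hr⟩ := exists_coe_eq_groundEnergy hb hD
  refine EReal.ge_of_forall_gt_iff_ge.1 fun E hE => ?_
  rw [hr]
  -- For fixed `f` the infimum over `x` is taken first; it is the real number `r`, so the bound can
  -- be rearranged before the infimum over `f`.
  have h1 : ((E - r : ℝ) : EReal) ≤ groundEnergy q₁ D₁ := le_groundEnergy fun f hf hf1 => by
    have h2 : ((E - q₁.quad f : ℝ) : EReal) ≤ groundEnergy q D := le_groundEnergy fun x hx hx1 => by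
      linarith [h E hE.le x hx hx1 f hf hf1]
    rw [hr, EReal.coe_le_coe_iff] at h2
    linarith
  calc (E : EReal) = (r : EReal) + ((E - r : ℝ) : EReal) := by
        rw [← EReal.coe_add, add_sub_cancel]
    _ ≤ _ := add_le_add le_rfl h1

/-- The value `a = -∞` is allowed: then `b = -∞` too and both sides are `+∞`. The value `b = +∞` is
excluded by `a < 0`. -/
theorem neg_le_coe_sub {r : ℝ} {a b : EReal} (h : b ≤ r + a) (ha : a < 0) : -a ≤ r - b := by
  induction b with
  | bot => simp
  | top =>
    induction a with
    | bot => simp at h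
    | top => simp at ha
    | coe a => exact absurd h (by rw [← EReal.coe_add]; exact not_le.2 (EReal.coe_lt_top _))
  | coe b =>
    induction a with
    | bot => simp at h
    | top => simp at ha
    | coe a =>
      have h1 : b ≤ r + a := by exact_mod_cast h
      have h2 : -a ≤ r - b := by linarith
      exact_mod_cast h2

end GroundEnergy

/-! ### The energy of the trial states -/

theorem mul_integral_le_of_le {X : Type*} [MeasurableSpace X] {μ : Measure X} {n t u v : X → ℝ}
    (hn : Integrable n μ) (ht : Integrable t μ) (hu : Integrable u μ) (hv : Integrable v μ)
    {E c : ℝ} (h : ∀ x, E * n x ≤ t x + c * n x + u x + v x) :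
    E * ∫ x, n x ∂μ ≤ (∫ x, t x ∂μ) + c * (∫ x, n x ∂μ) + (∫ x, u x ∂μ) + ∫ x, v x ∂μ := by
  have h1 : Integrable (fun x => t x + c * n x) μ := ht.add (hn.const_mul c)
  have h2 : Integrable (fun x => t x + c * n x + u x) μ := h1.add hu
  rw [← integral_const_mul, ← integral_const_mul, ← integral_add ht (hn.const_mul c),
    ← integral_add h1 hu, ← integral_add h2 hv]
  exact integral_mono (hn.const_mul E) (h2.add hv) h

theorem norm_fourier_conj {f : Rd 3 → ℂ} (hf : IsTest f) (ξ : Rd 3) :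
    ‖(𝓕 hf.conj.schwartz : 𝓢(Rd 3, ℂ)) ξ‖ = ‖(𝓕 hf.schwartz : 𝓢(Rd 3, ℂ)) (-ξ)‖ := by
  rw [SchwartzMap.fourier_coe, SchwartzMap.fourier_coe, Real.fourier_eq', Real.fourier_eq',
    ← RCLike.norm_conj (∫ v, _), ← integral_conj]
  congr 1
  refine integral_congr_ae (Filter.Eventually.of_forall fun x => ?_)
  simp only [IsTest.schwartz_apply, smul_eq_mul, map_mul, ← Complex.exp_conj, Complex.conj_ofReal,
    Complex.conj_I, inner_neg_right]
  rw [Complex.conj_conj]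
  congr 2
  push_cast
  ring

section Trial

variable {𝒦 : Type*} [NormedAddCommGroup 𝒦] [InnerProductSpace ℂ 𝒦] {U : Rd 3 → 𝒦 →L[ℂ] 𝒦}

/-- The density of the trial state is `|f(x)|² ‖Ψ(x + y)‖²`; integration over `y` separates the two
factors. -/
theorem integral_mul_norm_sq_mulOp_transOp (hU : ∀ k ψ, ‖U k ψ‖ = ‖ψ‖) {f : Rd 3 → ℂ}
    (hf : IsTest f) {w : Rd 3 → ℝ} (hw : Integrable (fun x => w x * ‖f x‖ ^ 2) volume)
    (Ψ : L2 3 𝒦) :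
    Integrable (fun y => ∫ x, w x * ‖mulOp volume 𝒦 hf.isMultiplier (transOp U y Ψ) x‖ ^ 2)
      volume ∧
    ∫ y, ∫ x, w x * ‖mulOp volume 𝒦 hf.isMultiplier (transOp U y Ψ) x‖ ^ 2 =
      (∫ x, w x * ‖f x‖ ^ 2) * ‖Ψ‖ ^ 2 := by
  have hΨ : Integrable (fun x => ‖Ψ x‖ ^ 2) volume :=
    (memLp_two_iff_integrable_sq_norm (Lp.aestronglyMeasurable Ψ)).1 (Lp.memLp Ψ)
  have e : ∀ y, ∫ x, w x * ‖mulOp volume 𝒦 hf.isMultiplier (transOp U y Ψ) x‖ ^ 2 =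
      ∫ x, (w x * ‖f x‖ ^ 2) * ‖Ψ (x + y)‖ ^ 2 := fun y => by
    refine integral_congr_ae ?_
    filter_upwards [coeFn_mulOp hf.isMultiplier (transOp U y Ψ), coeFn_transOp U y Ψ] with x e1 e2
    rw [e1, e2, norm_smul, hU, mul_pow, mul_assoc]
  simp only [e]
  rw [norm_sq_eq_integral]
  exact ⟨integrable_correlation hw hΨ, integral_correlation hw hΨ⟩

theorem integral_norm_sq_mulOp_transOp (hU : ∀ k ψ, ‖U k ψ‖ = ‖ψ‖) {f : Rd 3 → ℂ}
    (hf : IsTest f) (Ψ : L2 3 𝒦) :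
    Integrable (fun y => ‖mulOp volume 𝒦 hf.isMultiplier (transOp U y Ψ)‖ ^ 2) volume ∧
    ∫ y, ‖mulOp volume 𝒦 hf.isMultiplier (transOp U y Ψ)‖ ^ 2 = (∫ x, ‖f x‖ ^ 2) * ‖Ψ‖ ^ 2 := by
  have h := integral_mul_norm_sq_mulOp_transOp hU hf (w := fun _ => 1)
    (by simpa [IsTest.schwartz_apply] using integrable_norm_sq_schwartz hf.schwartz) Ψ
  simpa only [one_mul, ← norm_sq_eq_integral] using h

variable {S : Submodule ℂ 𝒦} {A : Fin 3 → Rd 3 → 𝒦 →ₗ.[ℂ] 𝒦} {B : 𝒦 →ₗ.[ℂ] 𝒦} {α m : ℝ}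

namespace IsCovariantField

theorem extendZero_fiberOp_mulOp_transOp (h : IsCovariantField S A B U) {f : Rd 3 → ℂ}
    (hf : IsTest f) {Ψ : L2 3 𝒦} (hΨ : Ψ ∈ tensorDomain S) (y : Rd 3) :
    extendZero (fiberOp B) (mulOp volume 𝒦 hf.isMultiplier (transOp U y Ψ)) =
      mulOp volume 𝒦 hf.isMultiplier (transOp U y (extendZero (fiberOp B) Ψ)) :=
  extendZero_eq (mulOp_mem_graph_fiberOp hf.isMultiplier (transOp_mem_graph_fiberOp (h.map_energy y)
    (mem_graph_extendZero (tensorDomain_le_fiberOp_domain h.exists_energy hΨ))))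

theorem tensorDomain_ne_bot (h : IsCovariantField S A B U) : tensorDomain S ≠ ⊥ := fun h0 => by
  obtain ⟨η, hη, h1⟩ := h.exists_unit
  obtain ⟨g, hg, hne⟩ := exists_testVec_ne_zero (η := η) (fun h2 => by simp [h2] at h1)
  have h2 := testVec_mem_tensorDomain hg hη
  rw [h0] at h2
  exact hne ((Submodule.mem_bot ℂ).1 h2)

variable [CompleteSpace 𝒦] (h : IsCovariantField S A B U) (hm : 0 < m)

include h hm

/-- The average over `y` of the energies of the trial states `f · e^{i y·P} Ψ`. -/
theorem le_average_trial {V : Rd 3 → ℝ} (hV : Measurable V) (hVloc : LocallyIntegrable V volume)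
    {E : ℝ} (hE : ∀ Φ ∈ tensorDomain S,
      E * ‖Φ‖ ^ 2 ≤ (withPotential (gaugeForm α m A S B) V hV).quad Φ)
    {f : Rd 3 → ℂ} (hf : IsTest f) {Ψ : L2 3 𝒦} (hΨ : Ψ ∈ tensorDomain S) :
    E * ((∫ x, ‖f x‖ ^ 2) * ‖Ψ‖ ^ 2) ≤
      (∫ ξ, ‖(𝓕 hf.schwartz : 𝓢(Rd 3, ℂ)) ξ‖ ^ 2 * ‖extendZero
        (fourthRootInv (gaugeResolvent α m A S)) (modOp ((2 * Real.pi) • ξ) Ψ)‖ ^ 2) +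
      -m * ((∫ x, ‖f x‖ ^ 2) * ‖Ψ‖ ^ 2) +
      (∫ x, ‖f x‖ ^ 2) * ‖extendZero (fiberOp B) Ψ‖ ^ 2 + (∫ x, V x * ‖f x‖ ^ 2) * ‖Ψ‖ ^ 2 := by
  have hVf : Integrable (fun x => V x * ‖f x‖ ^ 2) volume := by
    have hc : Continuous fun x => ‖f x‖ ^ 2 := by have := hf.1.continuous; fun_prop
    have hs : HasCompactSupport fun x => ‖f x‖ ^ 2 :=
      hf.2.comp_left (g := fun z : ℂ => ‖z‖ ^ 2) (by simp)
    exact (hVloc.integrable_smul_left_of_hasCompactSupport hc hs).congr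
      (Filter.Eventually.of_forall fun x => mul_comm _ _)
  obtain ⟨iT, -, eT⟩ := h.integrable_fourthRootInv_mulOp_transOp (α := α) hm hf hΨ
  obtain ⟨iN, eN⟩ := integral_norm_sq_mulOp_transOp h.norm_map hf Ψ
  obtain ⟨iF, eF⟩ := integral_norm_sq_mulOp_transOp h.norm_map hf (extendZero (fiberOp B) Ψ)
  obtain ⟨iV, eV⟩ := integral_mul_norm_sq_mulOp_transOp h.norm_map hf hVf Ψ
  rw [← eT, ← eN, ← eF, ← eV]
  -- For each `y` the integrands satisfy the variational bound `hE` for one trial state.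
  refine mul_integral_le_of_le iN iT iF iV fun y => ?_
  have h1 := hE _ (mulOp_mem_tensorDomain hf.isMultiplier (fun g hg => hf.mul hg)
    (transOp_mem_tensorDomain h.map_mem y hΨ))
  rw [withPotential, add_quad, gaugeForm_quad, mulForm_quad,
    h.extendZero_fiberOp_mulOp_transOp hf hΨ] at h1
  exact h1

theorem le_add_particle {V : Rd 3 → ℝ} (hV : Measurable V) (hVloc : LocallyIntegrable V volume)
    {E : ℝ} (hE : (E : EReal) ≤
      groundEnergy (withPotential (gaugeForm α m A S B) V hV) (tensorDomain S))
    {Ψ : L2 3 𝒦} (hΨ : Ψ ∈ tensorDomain S) (hΨ1 : ‖Ψ‖ = 1) {u : L2 3 ℂ} (hu : u ∈ D1)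
    (hu1 : ‖u‖ = 1) :
    E ≤ (gaugeForm α m A S B).quad Ψ +
      (particleForm (relKinetic m) (measurable_relKinetic m) V hV).quad u := by
  obtain ⟨f, hf, huf⟩ := mem_D1_iff.1 hu
  have hE' := fun Φ hΦ => le_quad_of_le_groundEnergy (x := Φ)
    (le_inf (h.le_gaugeForm_dom hm) (tensorDomain_le_mulForm_dom hV hVloc)) hE hΦ
  have hN : ∫ x, ‖f x‖ ^ 2 = 1 := by
    rw [← one_pow 2, ← hu1, norm_sq_eq_integral]
    refine integral_congr_ae ?_
    filter_upwards [huf] with x hx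
    rw [hx]
  have hNhat : ∫ ξ, ‖(𝓕 hf.schwartz : 𝓢(Rd 3, ℂ)) ξ‖ ^ 2 = 1 := by
    rw [SchwartzMap.fourier_coe, integral_norm_sq_fourier hf.schwartz.integrable
      (hf.schwartz.memLp 2 volume)]
    exact hN
  -- The estimate for `f` involves `e^{ik·x}` with `k = 2πξ`. The one for the conjugate of `f`
  -- becomes, after `ξ ↦ -ξ`, an estimate with `e^{-ik·x}` and the same weight `|f̂(ξ)|²`. The
  -- kinetic inequality controls only the sum of the two, so half the sum of both estimates gives
  -- the claim.
  have h1 := h.le_average_trial hm hV hVloc hE' hf hΨ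
  have h2 := h.le_average_trial hm hV hVloc hE' hf.conj hΨ
  obtain ⟨-, i1, -⟩ := h.integrable_fourthRootInv_mulOp_transOp (α := α) hm hf hΨ
  obtain ⟨-, i2, -⟩ := h.integrable_fourthRootInv_mulOp_transOp (α := α) hm hf.conj hΨ
  simp only [norm_fourier_conj hf] at h2 i2
  rw [← integral_neg_eq_self (fun ξ => ‖(𝓕 hf.schwartz : 𝓢(Rd 3, ℂ)) (-ξ)‖ ^ 2 * ‖extendZero
    (fourthRootInv (gaugeResolvent α m A S)) (modOp ((2 * Real.pi) • ξ) Ψ)‖ ^ 2)] at h2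
  replace i2 := i2.comp_neg
  simp only [neg_neg, smul_neg, RCLike.norm_conj] at h2 i2
  have h3 : (∫ ξ, ‖(𝓕 hf.schwartz : 𝓢(Rd 3, ℂ)) ξ‖ ^ 2 * ‖extendZero
        (fourthRootInv (gaugeResolvent α m A S)) (modOp ((2 * Real.pi) • ξ) Ψ)‖ ^ 2) +
      (∫ ξ, ‖(𝓕 hf.schwartz : 𝓢(Rd 3, ℂ)) ξ‖ ^ 2 * ‖extendZero
        (fourthRootInv (gaugeResolvent α m A S)) (modOp (-((2 * Real.pi) • ξ)) Ψ)‖ ^ 2) ≤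
      2 * ‖extendZero (fourthRootInv (gaugeResolvent α m A S)) Ψ‖ ^ 2 *
        (∫ ξ, ‖(𝓕 hf.schwartz : 𝓢(Rd 3, ℂ)) ξ‖ ^ 2) +
      2 * ∫ ξ, relKinetic m ((2 * Real.pi) • ξ) * ‖(𝓕 hf.schwartz : 𝓢(Rd 3, ℂ)) ξ‖ ^ 2 := by
    have i3 := (integrable_norm_sq_schwartz (𝓕 hf.schwartz)).const_mul
      (2 * ‖extendZero (fourthRootInv (gaugeResolvent α m A S)) Ψ‖ ^ 2)
    have i4 := (integrable_relKinetic_mul_norm_sq hm (𝓕 hf.schwartz)).const_mul 2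
    rw [← integral_add i1 i2, ← integral_const_mul, ← integral_const_mul, ← integral_add i3 i4]
    refine integral_mono (i1.add i2) (i3.add i4) fun ξ => ?_
    have h4 := h.fourthRootInv_modOp_le (α := α) hm ((2 * Real.pi) • ξ) hΨ
    have h5 := mul_le_mul_of_nonneg_left h4 (sq_nonneg ‖(𝓕 hf.schwartz : 𝓢(Rd 3, ℂ)) ξ‖)
    rw [hΨ1] at h5
    linarith
  rw [hN, hΨ1] at h1 h2
  rw [hNhat] at h3
  rw [gaugeForm_quad, particleForm_quad hf huf, hΨ1]
  linarith

theorem groundEnergy_le {V : Rd 3 → ℝ} (hV : Measurable V) (hVloc : LocallyIntegrable V volume) :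
    groundEnergy (withPotential (gaugeForm α m A S B) V hV) (tensorDomain S) ≤
      groundEnergy (gaugeForm α m A S B) (tensorDomain S) +
        groundEnergy (particleForm (relKinetic m) (measurable_relKinetic m) V hV) D1 :=
  groundEnergy_le_add (gaugeForm_boundedBelowOn _) h.tensorDomain_ne_bot
    fun _ hE _ hΨ hΨ1 _ hu hu1 => h.le_add_particle hm hV hVloc hE hΨ hΨ1 hu hu1

theorem bindingEnergy_pos {V : Rd 3 → ℝ} (hV : Measurable V) (hVloc : LocallyIntegrable V volume)
    (h0 : groundEnergy (particleForm (relKinetic m) (measurable_relKinetic m) V hV) D1 < 0) :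
    -groundEnergy (particleForm (relKinetic m) (measurable_relKinetic m) V hV) D1 ≤
        groundEnergy (gaugeForm α m A S B) (tensorDomain S) -
          groundEnergy (withPotential (gaugeForm α m A S B) V hV) (tensorDomain S) ∧
      0 < groundEnergy (gaugeForm α m A S B) (tensorDomain S) -
          groundEnergy (withPotential (gaugeForm α m A S B) V hV) (tensorDomain S) := by
  have h1 := h.groundEnergy_le (α := α) hm hV hVloc
  obtain ⟨r, hr⟩ := exists_coe_eq_groundEnergy
    (gaugeForm_boundedBelowOn (α := α) (m := m) (A := A) (B := B) (tensorDomain S))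
    h.tensorDomain_ne_bot
  rw [hr] at h1 ⊢
  have h2 := neg_le_coe_sub h1 h0
  exact ⟨h2, (EReal.neg_pos.2 h0).trans_le h2⟩

end IsCovariantField

end Trial

end SRPF

end

theorem mainTheorem4 (α m : ℝ) (hα : 0 ≤ α) (hm : 0 < m)
    (Λ : SRPF.Rd 3 → ℝ) (hΛ : MemLp Λ 2 volume)
    (hΛ' : MemLp (fun k => Λ k / √‖k‖) 2 volume)
    (e : Fin 2 → SRPF.Rd 3 → SRPF.Rd 3) (he : ∀ l, Measurable (e l))
    (he_orth : ∀ k l l', inner ℝ (e l k) (e l' k) = if l = l' then (1 : ℝ) else 0)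
    (he_trans : ∀ k l, inner ℝ (e l k) k = (0 : ℝ))
    (V : SRPF.Rd 3 → ℝ) (hV : Measurable V) (hVloc : LocallyIntegrable V volume) :
    -- (H.1): everything that does not involve `H^V` holds, and (H.1) holds as soon as `H^V` is closable
    -- and bounded from below on `D₀`; in particular (H.1) holds for `V = 0`
    SRPF.HypH1 (SRPF.freeForm α m Λ e) 0 measurable_const SRPF.D0 ∧
    SRPF.D0 ≤ (SRPF.freeForm α m Λ e).dom ⊓ (SRPF.mulForm SRPF.Fock V hV).dom ∧
    ((SRPF.withPotential (SRPF.freeForm α m Λ e) V hV).BoundedBelowOn SRPF.D0 →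
      (SRPF.withPotential (SRPF.freeForm α m Λ e) V hV).ClosableOn SRPF.D0 →
      SRPF.HypH1 (SRPF.freeForm α m Λ e) V hV SRPF.D0) ∧
    -- (H.2), (H.3), (H.4)
    SRPF.HypH2 (SRPF.freeForm α m Λ e) SRPF.D0 SRPF.fieldMomentum ∧
    SRPF.HypH3 (SRPF.freeForm α m Λ e) SRPF.D0 (SRPF.relKinetic m) ∧
    SRPF.HypH4 SRPF.D0 (SRPF.relKinetic m) (SRPF.measurable_relKinetic m) V hV SRPF.D1 ∧
    -- `E^V ≤ E⁰ + e₀`, and `E_bin = E⁰ - E^V ≥ -e₀ > 0` if `e₀ < 0`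
    SRPF.groundEnergy (SRPF.withPotential (SRPF.freeForm α m Λ e) V hV) SRPF.D0 ≤
      SRPF.groundEnergy (SRPF.freeForm α m Λ e) SRPF.D0 +
        SRPF.groundEnergy (SRPF.particleForm (SRPF.relKinetic m) (SRPF.measurable_relKinetic m) V hV)
          SRPF.D1 ∧
    (SRPF.groundEnergy (SRPF.particleForm (SRPF.relKinetic m) (SRPF.measurable_relKinetic m) V hV)
          SRPF.D1 < 0 →
      -SRPF.groundEnergy (SRPF.particleForm (SRPF.relKinetic m) (SRPF.measurable_relKinetic m) V hV)
          SRPF.D1 ≤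
        SRPF.groundEnergy (SRPF.freeForm α m Λ e) SRPF.D0 -
          SRPF.groundEnergy (SRPF.withPotential (SRPF.freeForm α m Λ e) V hV) SRPF.D0 ∧
      0 < SRPF.groundEnergy (SRPF.freeForm α m Λ e) SRPF.D0 -
          SRPF.groundEnergy (SRPF.withPotential (SRPF.freeForm α m Λ e) V hV) SRPF.D0) := by
  have hc := fun j x => SRPF.memLp_coupling hΛ' he (SRPF.norm_polarization he_orth) j x
  have hF := SRPF.isCovariantField_vectorPotential hc
  -- `D0` and `freeForm` are definitionally `tensorDomain finitePhoton` and the `gaugeForm` of this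
  -- field, so the abstract results apply directly.
  exact ⟨hF.hypH1_zero hm _,
    le_inf (hF.le_gaugeForm_dom hm) (SRPF.tensorDomain_le_mulForm_dom hV hVloc),
    hF.hypH1 hm hV hVloc,
    hF.hypH2 hm SRPF.fieldMomentum_isSelfAdjoint SRPF.isExpGroup_fieldTranslation,
    hF.hypH3 hm, SRPF.hypH4 _ hm hV hVloc, hF.groundEnergy_le hm hV hVloc,
    hF.bindingEnergy_pos hm hV hVloc⟩
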